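/- **Setting.** Let $n\ge 2$, $\mathbb T=\mathbb R/\mathbb Z$, and let $B=B^n$ be the closed unit ball of $\mathbb R^n$. Write $\theta=(\theta^s,\theta^f)\in\mathbb T^{n-1}\times\mathbb T$ and $p=(p^s,p^f)\in\mathbb R^{n-1}\times\mathbb R$. Let $r,q\ge 4$ be integers and let $H_0$ be a $C^q$ function on an open neighbourhood of $B$ whose Hessian is positive definite on $B$. Assume that the resonance $\Gamma\cap B=\{p\in B:\partial_{p^s}H_0(p)=0\}$ is parametrized by $p^f$ over an interval, i.e. $\Gamma\cap B=\{p_*(p^f)=(p^s_*(p^f),p^f): p^f\in[a_{\min},a_{\max}]\}$ with $a_{\min}<a_{\max}$. Equip $C^r(\mathbb T^n\times B\times\mathbb T,\mathbb R)$ ($C^r$ up to the boundary, i.e. restrictions of $C^r$ functions on $\mathbb T^n\times\mathbb R^n\times\mathbb T$) with one of the two equivalent norms $$\|H\|_{\rm E}=\max_{k\le r}\ \sup_{x}\ \sup_{|v_1|=\dots=|v_k|=1}|D^kH(x)(v_1,\dots,v_k)|,\qquad \|H\|_{\rm c}=\max_{|\alpha|\le r}\ \sup_x|\partial^\alpha H(x)|,$$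 where $|\cdot|$ is the Euclidean norm of $\mathbb R^{2n+1}$ and $\partial^\alpha$ are the coordinate partial derivatives. Let $S_r$ be the unit sphere of the chosen norm. Put $M=1$ for $\|\cdot\|_{\rm E}$ and $M=\max\{1,(n-1)/4\}$ for $\|\cdot\|_{\rm c}$. For $H_1\in S_r$ let $Z(\theta^s,p)=\iint H_1(\theta^s,\theta^f,p,t)\,d\theta^f\,dt$ and consider the functions $Z(\cdot,p_*(p^f))$ on $\mathbb T^{n-1}$. A value $p^f\in[a_{\min},a_{\max}]$ is a *nondegenerate regular value* if $Z(\cdot,p_*(p^f))$ has exactly one global maximum and its Hessian there is negative definite. It is a *bifurcation value* if $Z(\cdot,p_*(p^f))$ has exactly two global maxima $\theta_1^s\neq\theta_2^s$. A bifurcation value is *nondegenerate* if both Hessians are negative definite and $\partial_{p^f}\big(Z(\theta^s_1,p_*(p^f))\big)\ne\partial_{p^f}\big(Z(\theta^s_2,p_*(p^f))\big)$ with $\theta^s_1,\theta^s_2$ fixed (one-sided derivatives at $a_{\min},a_{\max}$). Let $\mathcal U$ be the set of $H_1\in S_r$ such that every $p^f\in[a_{\min},a_{\max}]$ is a nondegenerate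 regular or a nondegenerate bifurcation value and such that, for some $\lambda>0$ and some integer $s\ge1$, the following holds. The bifurcation values in $(a_{\min},a_{\max})$ form a finite set $\{a_1<\dots<a_{s-1}\}$, and, with $a_0=a_{\min}$, $a_s=a_{\max}$ and $I_j=[a_j-\lambda,a_{j+1}+\lambda]\cap[a_{\min},a_{\max}]$, there are functions $\theta^s_j:I_j\to\mathbb T^{n-1}$ ($0\le j\le s-1$) of class $C^{\min(r,q)-1}$ satisfying: - **[G0]** for each $p^f\in I_j$, $\theta^s_j(p^f)$ is a local maximum of $Z(\cdot,p_*(p^f))$ and $$\lambda I\le-\partial^2_{\theta^s\theta^s}Z(\theta^s_j(p^f),p_*(p^f))\le M\,I;$$ - **[G1]** for $p^f\in(a_j,a_{j+1})$, $\theta^s_j(p^f)$ is the unique global maximum of $Z(\cdot,p_*(p^f))$; for $p^f=a_{j+1}$, $0\le j\le s-2$, $\theta^s_j(a_{j+1})\neq\theta^s_{j+1}(a_{j+1})$ are exactly the global maxima; - **[G2]** for $0\le j\le s-2$, at $p^f=a_{j+1}$, $$\frac{d}{dp^f}Z(\theta^s_j(p^f),p_*(p^f))\neq\frac{d}{dp^f}Z(\theta^s_{j+1}(p^f),p_*(p^f)).$$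 **Theorem.** For each of the two norms, $\mathcal U$ is open and dense in $S_r$ (for the topology of the $C^r$ norm). -/

import Mathlib

open Set

noncomputable section

namespace Resonance

/-- Euclidean space of dimension `n`. -/
abbrev Vec (n : ℕ) : Type := EuclideanSpace ℝ (Fin n)

/-- The vector `(x, y)` with slow part `x` (the first `m` coordinates) and fast (last) coordinate
`y`. The number of degrees of freedom is `n = m + 1`. -/
def join {m : ℕ} (x : Vec m) (y : ℝ) : Vec (m + 1) :=
  WithLp.toLp 2 (Fin.snoc (α := fun _ => ℝ) (fun i => x i) y)

/-- The space of triples `(θ, p, t)`, with the angles `θ` and the time `t` lifted to `ℝⁿ` and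
`ℝ`. -/
abbrev Phase (m : ℕ) : Type := Vec (m + 1) × Vec (m + 1) × ℝ

/-- The lift of `𝕋ⁿ × Bⁿ × 𝕋`, where `Bⁿ` is the closed unit ball. -/
def domain (m : ℕ) : Set (Phase m) :=
  univ ×ˢ (Metric.closedBall (0 : Vec (m + 1)) 1 ×ˢ univ)

/-- `H` represents an element of `C^r(𝕋ⁿ × Bⁿ × 𝕋, ℝ)`: it is 1-periodic in each angle and in the
time, and of class `C^r`. As usual for a closed ball, `C^r` up to the boundary means the
restriction of a `C^r` function of `p ∈ ℝⁿ`; `H` is such an extension. The values of `H` for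
`p ∉ Bⁿ` enter neither the norms nor the genericity conditions below. -/
structure IsPerturbation {m : ℕ} (r : ℕ) (H : Phase m → ℝ) : Prop where
  contDiff : ContDiff ℝ r H
  periodic_angle : ∀ (θ p : Vec (m + 1)) (t : ℝ) (i : Fin (m + 1)),
    H (θ + EuclideanSpace.single i 1, p, t) = H (θ, p, t)
  periodic_time : ∀ (θ p : Vec (m + 1)) (t : ℝ), H (θ, p, t + 1) = H (θ, p, t)

/-- The coordinate directions of `(θ, p, t)`-space. -/
def coordDirs (m : ℕ) : Set (Phase m) :=
  {v | (∃ i, v = (EuclideanSpace.single i 1, 0, 0)) ∨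
       (∃ i, v = (0, EuclideanSpace.single i 1, 0)) ∨ v = (0, 0, 1)}

/-- All unit vectors of `(θ, p, t)`-space, for the Euclidean norm of `ℝ^(2n+1)`. -/
def unitDirs (m : ℕ) : Set (Phase m) :=
  {v | ‖v.1‖ ^ 2 + ‖v.2.1‖ ^ 2 + v.2.2 ^ 2 = 1}

/-- The `C^r` norm on `𝕋ⁿ × Bⁿ × 𝕋`: the maximum of all partial derivatives of order at most `r`
in directions from `V`. For `V = coordDirs m` these are the usual partial derivatives; for
`V = unitDirs m` this is the maximum over `k ≤ r` of the supremum of the norm of the `k`-linear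
form `DᵏH`. -/
def crNorm {m : ℕ} (V : Set (Phase m)) (r : ℕ) (H : Phase m → ℝ) : ℝ :=
  sSup {y | ∃ k ≤ r, ∃ v : Fin k → Phase m, (∀ i, v i ∈ V) ∧
    ∃ x ∈ domain m, y = |iteratedFDeriv ℝ k H x v|}

/-- The unit sphere of `C^r(𝕋ⁿ × Bⁿ × 𝕋, ℝ)`. -/
def unitSphere {m : ℕ} (V : Set (Phase m)) (r : ℕ) : Set (Phase m → ℝ) :=
  {H | IsPerturbation r H ∧ crNorm V r H = 1}

/-- `U` is relatively open in the sphere, for the distance of the `C^r` norm. -/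
def IsOpenInSphere {m : ℕ} (V : Set (Phase m)) (r : ℕ) (U : Set (Phase m → ℝ)) : Prop :=
  ∀ H ∈ U, ∃ ε > 0, ∀ H' ∈ unitSphere V r, crNorm V r (H' - H) < ε → H' ∈ U

/-- `U` is dense in the sphere, for the distance of the `C^r` norm. -/
def IsDenseInSphere {m : ℕ} (V : Set (Phase m)) (r : ℕ) (U : Set (Phase m → ℝ)) : Prop :=
  ∀ H ∈ unitSphere V r, ∀ ε > 0, ∃ H' ∈ U, crNorm V r (H' - H) < ε

/-- The resonant average `Z(θˢ, p) = ∬ H(θˢ, θᶠ, p, t) dθᶠ dt`. -/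
def resonantAverage {m : ℕ} (H : Phase m → ℝ) (θs : Vec m) (p : Vec (m + 1)) : ℝ :=
  ∫ θf in (0 : ℝ)..1, ∫ t in (0 : ℝ)..1, H (join θs θf, p, t)

/-- The family `F(θˢ, pᶠ) = Z(θˢ, p_*(pᶠ))`, where `p_*(pᶠ) = (p_*ˢ(pᶠ), pᶠ)`. -/
def resonantFamily {m : ℕ} (pstar : ℝ → Vec m) (H : Phase m → ℝ) (θs : Vec m) (τ : ℝ) : ℝ :=
  resonantAverage H θs (join (pstar τ) τ)

/-- The resonance `Γ ∩ B = {p ∈ Bⁿ : ∂_{pˢ} H₀(p) = 0}`. -/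
def resonance {m : ℕ} (H₀ : Vec (m + 1) → ℝ) : Set (Vec (m + 1)) :=
  {p | p ∈ Metric.closedBall (0 : Vec (m + 1)) 1 ∧
    ∀ i : Fin m, fderiv ℝ H₀ p (EuclideanSpace.single i.castSucc 1) = 0}

/-- The two vectors are lifts of the same point of the torus `𝕋ᵐ = ℝᵐ / ℤᵐ`. -/
def SameAngle {m : ℕ} (θ θ' : Vec m) : Prop :=
  ∃ k : Fin m → ℤ, ∀ i, θ' i = θ i + k i

/-- The Hessian of `f` at `θ`, as a quadratic form. -/
def hessian {m : ℕ} (f : Vec m → ℝ) (θ v : Vec m) : ℝ :=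
  iteratedFDeriv ℝ 2 f θ ![v, v]

/-- `θ` is a global maximum of `f`. -/
def IsGlobalMax {m : ℕ} (f : Vec m → ℝ) (θ : Vec m) : Prop := ∀ x, f x ≤ f θ

/-- The Hessian of `f` at `θ` is strictly negative definite. -/
def IsNondegMax {m : ℕ} (f : Vec m → ℝ) (θ : Vec m) : Prop :=
  ∀ v, v ≠ 0 → hessian f θ v < 0

/-- `τ` is regular and nondegenerate: `F(·, τ)` has a unique global maximum on the torus, and it
is nondegenerate. -/
def IsNondegRegular {m : ℕ} (F : Vec m → ℝ → ℝ) (τ : ℝ) : Prop :=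
  ∃ θ, IsGlobalMax (F · τ) θ ∧ (∀ x, IsGlobalMax (F · τ) x → SameAngle θ x) ∧
    IsNondegMax (F · τ) θ

/-- `θ₁`, `θ₂` are distinct points of the torus and are exactly the global maxima of `f`. -/
def AreTheTwoMaxima {m : ℕ} (f : Vec m → ℝ) (θ₁ θ₂ : Vec m) : Prop :=
  ¬ SameAngle θ₁ θ₂ ∧ IsGlobalMax f θ₁ ∧ IsGlobalMax f θ₂ ∧
    ∀ x, IsGlobalMax f x → SameAngle θ₁ x ∨ SameAngle θ₂ x

/-- `τ` is a bifurcation value: `F(·, τ)` has exactly two global maxima on the torus. -/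
def IsBifurcation {m : ℕ} (F : Vec m → ℝ → ℝ) (τ : ℝ) : Prop :=
  ∃ θ₁ θ₂, AreTheTwoMaxima (F · τ) θ₁ θ₂

/-- `τ ∈ [a, b]` is a nondegenerate bifurcation value: there are exactly two global maxima, both
are nondegenerate, and the values at these maxima move with different speeds. (The derivative is
one-sided at the ends of `[a, b]`.) -/
def IsNondegBifurcation {m : ℕ} (a b : ℝ) (F : Vec m → ℝ → ℝ) (τ : ℝ) : Prop :=
  ∃ θ₁ θ₂, AreTheTwoMaxima (F · τ) θ₁ θ₂ ∧
    IsNondegMax (F · τ) θ₁ ∧ IsNondegMax (F · τ) θ₂ ∧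
    derivWithin (F θ₁) (Icc a b) τ ≠ derivWithin (F θ₂) (Icc a b) τ

/-- The data of the quantitative conditions for a family `F` over `[amin, amax]`: a constant `lam`,
a partition `amin = a 0 < a 1 < ⋯ < a s = amax` and branches `θ 0, …, θ (s - 1)` of local maxima
(lifted to `ℝᵐ`). The number `d` is the order of smoothness of the branches and `M` the upper bound
for minus the Hessian. -/
structure QuantitativelyGeneric {m : ℕ} (amin amax : ℝ) (d : ℕ) (M : ℝ) (F : Vec m → ℝ → ℝ)
    (lam : ℝ) (s : ℕ) (a : ℕ → ℝ) (θ : ℕ → ℝ → Vec m) : Prop where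
  lam_pos : 0 < lam
  s_pos : 0 < s
  first : a 0 = amin
  last : a s = amax
  increasing : ∀ j < s, a j < a (j + 1)
  bifurcations : ∀ τ ∈ Ioo amin amax, IsBifurcation F τ ↔ ∃ j, 0 < j ∧ j < s ∧ a j = τ
  /-- [G0], smoothness of the branches. -/
  smooth : ∀ j < s, ContDiffOn ℝ d (θ j) (Icc (a j - lam) (a (j + 1) + lam) ∩ Icc amin amax)
  /-- [G0], the branches consist of local maxima. -/
  isLocalMax : ∀ j < s, ∀ τ ∈ Icc (a j - lam) (a (j + 1) + lam) ∩ Icc amin amax,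
    IsLocalMax (F · τ) (θ j τ)
  /-- [G0], `lam • I ≤ -∂²F ≤ M • I` along the branches. -/
  hessian_bounds : ∀ j < s, ∀ τ ∈ Icc (a j - lam) (a (j + 1) + lam) ∩ Icc amin amax, ∀ v : Vec m,
    lam * ‖v‖ ^ 2 ≤ -hessian (F · τ) (θ j τ) v ∧ -hessian (F · τ) (θ j τ) v ≤ M * ‖v‖ ^ 2
  /-- [G1], between bifurcation values. -/
  unique_max : ∀ j < s, ∀ τ ∈ Ioo (a j) (a (j + 1)), IsGlobalMax (F · τ) (θ j τ) ∧
    ∀ x, IsGlobalMax (F · τ) x → SameAngle (θ j τ) x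
  /-- [G1], at bifurcation values. -/
  two_max : ∀ j, j + 1 < s →
    AreTheTwoMaxima (F · (a (j + 1))) (θ j (a (j + 1))) (θ (j + 1) (a (j + 1)))
  /-- [G2]. -/
  transversal : ∀ j, j + 1 < s →
    deriv (fun τ => F (θ j τ) τ) (a (j + 1)) ≠ deriv (fun τ => F (θ (j + 1) τ) τ) (a (j + 1))

/-- The set of perturbations of unit norm for which every `pᶠ ∈ [amin, amax]` is a nondegenerate
regular or a nondegenerate bifurcation value and the quantitative conditions [G0]-[G2] hold. -/
def genericSet {m : ℕ} (V : Set (Phase m)) (r d : ℕ) (M amin amax : ℝ) (pstar : ℝ → Vec m) :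
    Set (Phase m → ℝ) :=
  {H | H ∈ unitSphere V r ∧
    (∀ τ ∈ Icc amin amax, IsNondegRegular (resonantFamily pstar H) τ ∨
      IsNondegBifurcation amin amax (resonantFamily pstar H) τ) ∧
    ∃ lam s a θ, QuantitativelyGeneric amin amax d M (resonantFamily pstar H) lam s a θ}

end Resonance

end

/-! Put F(θ, τ) = Z(θ, p_*(τ)) with m = n - 1 slow angles. The slow block of the positive definite
Hessian of H₀ is invertible, so the implicit function theorem makes `pstar` of class C^(q-1)
(`contDiffOn_pstar`). Call τ good (`IsGood`) if all global maxima of F(·, τ) are nondegenerate,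
there are at most two modulo integer translations, and two inequivalent ones move with different
speeds in τ. The proof rests on `mem_genericSet_iff`: an element of the sphere lies in the generic
set exactly when every τ is good.

Conditions [G0]-[G2] then come for free. A nondegenerate maximum continues to a branch of local
maxima, smooth by the implicit function theorem. Where two branches tie, their values cross
transversally, so one wins on the left and the other on the right (`IsFamily.exists_localPicture`).
Bifurcation values are therefore isolated, hence finitely many, and local branches glue, after
integer translations, between consecutive ones (`IsFamily.exists_interval_branch`,
`IsFamily.exists_quantitativelyGeneric`). The upper bound M holds at every point with negative
semidefinite Hessian. For the Euclidean norm it is immediate. For the coordinate norm, ∂ᵢ²Z has mean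
zero over a period and derivative at most 1, so -∂ᵢ²Z ≤ 1/4; semidefiniteness controls the other
entries, and Cauchy-Schwarz yields m/4.

Openness: being good persists for nearby τ and for families close in C² and in speed
(`IsFamily.isGood_nhds`), and [amin, amax] is compact.

Density is transversality with affine parameters. Each bad event is a zero of a jet with more
components than unknowns: 2m + 1 against 2m for a degenerate maximum (the third derivative along the
kernel vanishes too), 3m + 2 against 3m + 1 for a triple maximum, 2m + 2 against 2m + 1 for a pair
with equal speeds. Perturbations q₁(θˢ) + pᶠ q₂(θˢ) realise all jet values, finitely many of them
span by compactness, and the parameters with a zero locally form C¹ images of sets of too small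
dimension (`isOpen_and_dense_forall_ne_zero`). Degenerate maxima go first: afterwards distinct
maxima are uniformly separated, which keeps pairs and triples in a compact set away from the
diagonal. Dividing by the norm returns to the sphere. -/

noncomputable section

namespace Resonance

open Filter Topology MeasureTheory Module
open scoped ContDiff

set_option linter.unusedSectionVars false
set_option maxSynthPendingDepth 3

/-! ### Differentiation under the integral over the unit interval. -/

section ParametricIntegral

variable {E G : Type} [NormedAddCommGroup E] [NormedSpace ℝ E] [FiniteDimensional ℝ E]
  [NormedAddCommGroup G] [NormedSpace ℝ G] [CompleteSpace G]

/-- The average over the unit interval of the last variable. -/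
def unitAverage (g : E × ℝ → G) (x : E) : G := ∫ t in (0 : ℝ)..1, g (x, t)

lemma continuous_unitAverage {g : E × ℝ → G} (hg : Continuous g) :
    Continuous (unitAverage g) := by
  unfold unitAverage
  exact intervalIntegral.continuous_parametric_intervalIntegral_of_continuous'
    (f := fun x t => g (x, t)) (by simpa [Function.uncurry_def] using hg) 0 1

lemma hasFDerivAt_unitAverage {g : E × ℝ → G} (hg : ContDiff ℝ 1 g) (x : E) :
    HasFDerivAt (unitAverage g)
      (unitAverage (fun y => (fderiv ℝ g y).comp (ContinuousLinearMap.inl ℝ E ℝ)) x) x := by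
  have : ProperSpace E := FiniteDimensional.proper ℝ E
  have hc : Continuous fun y => (fderiv ℝ g y).comp (ContinuousLinearMap.inl ℝ E ℝ) :=
    (hg.continuous_fderiv one_ne_zero).clm_comp continuous_const
  obtain ⟨C, hC⟩ := ((isCompact_closedBall x 1).prod (isCompact_Icc (a := (0 : ℝ)) (b := 1))).exists_bound_of_continuousOn
    hc.continuousOn
  unfold unitAverage
  refine intervalIntegral.hasFDerivAt_integral_of_dominated_of_fderiv_le (s := Metric.ball x 1)
    (F := fun x t => g (x, t))
    (F' := fun x t => (fderiv ℝ g (x, t)).comp (ContinuousLinearMap.inl ℝ E ℝ))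
    (bound := fun _ => C)
    (Metric.ball_mem_nhds x one_pos) ?_ ?_ ?_ ?_ ?_ ?_
  · exact Eventually.of_forall fun y =>
      (hg.continuous.comp (Continuous.prodMk_right y)).aestronglyMeasurable
  · exact (hg.continuous.comp (Continuous.prodMk_right x)).intervalIntegrable _ _
  · exact (hc.comp (Continuous.prodMk_right x)).aestronglyMeasurable
  · refine Eventually.of_forall fun t ht y hy => hC (y, t) ⟨Metric.ball_subset_closedBall hy, ?_⟩
    rw [uIoc_of_le zero_le_one] at ht
    exact ⟨ht.1.le, ht.2⟩
  · exact intervalIntegrable_const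
  · refine Eventually.of_forall fun t _ y _ => ?_
    have h1 := (hg.differentiable one_ne_zero (y, t)).hasFDerivAt
    have h2 : HasFDerivAt (fun z : E => (z, t)) (ContinuousLinearMap.inl ℝ E ℝ) y :=
      hasFDerivAt_prodMk_left y t
    exact h1.comp y h2

/-- Induction on the order with the target `G` left free, because the derivative of an average is
the average of a function with values in `E →L[ℝ] G`. -/
lemma contDiff_unitAverage (n : ℕ) : ∀ {G : Type} [NormedAddCommGroup G] [NormedSpace ℝ G]
    [CompleteSpace G] {g : E × ℝ → G}, ContDiff ℝ n g → ContDiff ℝ n (unitAverage g) := by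
  induction n with
  | zero =>
    intro G _ _ _ g hg
    exact contDiff_zero.2 (continuous_unitAverage hg.continuous)
  | succ n ih =>
    intro G _ _ _ g hg
    have h1 : ContDiff ℝ 1 g := hg.of_le (by exact_mod_cast Nat.le_add_left 1 n)
    refine contDiff_succ_iff_fderiv.2 ⟨fun x => (hasFDerivAt_unitAverage h1 x).differentiableAt,
      fun h => absurd h (WithTop.coe_ne_top (a := (n : ℕ∞))), ?_⟩
    have : fderiv ℝ (unitAverage g) = unitAverage
        (fun y => (fderiv ℝ g y).comp (ContinuousLinearMap.inl ℝ E ℝ)) :=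
      funext fun x => (hasFDerivAt_unitAverage h1 x).fderiv
    rw [this]
    exact ih ((hg.fderiv_right le_rfl).clm_comp contDiff_const)

lemma fderiv_unitAverage_apply {g : E × ℝ → G} (hg : ContDiff ℝ 1 g) (x v : E) :
    fderiv ℝ (unitAverage g) x v = unitAverage (fun y => fderiv ℝ g y (v, 0)) x := by
  rw [(hasFDerivAt_unitAverage hg x).fderiv]
  unfold unitAverage
  rw [ContinuousLinearMap.intervalIntegral_apply]
  · rfl
  · have hc : Continuous fun y => (fderiv ℝ g y).comp (ContinuousLinearMap.inl ℝ E ℝ) :=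
      (hg.continuous_fderiv one_ne_zero).clm_comp continuous_const
    exact (hc.comp (Continuous.prodMk_right x)).intervalIntegrable _ _

/-- The exact formula is needed, not just smoothness: the averaged variable receives the direction
0, so a bound on directional derivatives passes to the average without loss. -/
lemma iteratedFDeriv_unitAverage (k : ℕ) : ∀ {g : E × ℝ → ℝ}, ContDiff ℝ k g → ∀ (x : E)
    (v : Fin k → E), iteratedFDeriv ℝ k (unitAverage g) x v =
      unitAverage (fun y => iteratedFDeriv ℝ k g y (fun i => (v i, 0))) x := by
  induction k with
  | zero => intro g _ x v; simp [unitAverage]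
  | succ k ih =>
    intro g hg x v
    have hk : ContDiff ℝ k g := hg.of_le (by exact_mod_cast Nat.le_succ k)
    have hd : ContDiff ℝ 1 (iteratedFDeriv ℝ k g) :=
      hg.iteratedFDeriv_right (by rw [add_comm]; norm_cast)
    have hd' : ContDiff ℝ 1 (iteratedFDeriv ℝ k (unitAverage g)) :=
      (contDiff_unitAverage (k + 1) hg).iteratedFDeriv_right (by rw [add_comm]; norm_cast)
    have key : ∀ {E' : Type} [NormedAddCommGroup E'] [NormedSpace ℝ E'] {f : E' → ℝ}
        (_ : ContDiff ℝ 1 (iteratedFDeriv ℝ k f)) (x : E') (v : Fin (k + 1) → E'),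
        iteratedFDeriv ℝ (k + 1) f x v =
          fderiv ℝ (fun z => iteratedFDeriv ℝ k f z (Fin.tail v)) x (v 0) := by
      intro E' _ _ f hf x v
      rw [iteratedFDeriv_succ_apply_left, fderiv_continuousMultilinear_apply_const_apply]
      exact hf.differentiable one_ne_zero x
    rw [key hd']
    have : (fun z => iteratedFDeriv ℝ k (unitAverage g) z (Fin.tail v)) =
        unitAverage (fun y => iteratedFDeriv ℝ k g y (fun i => (Fin.tail v i, 0))) :=
      funext fun z => ih hk z _
    rw [this, fderiv_unitAverage_apply]
    · congr 1
      funext y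
      rw [key hd]
      rfl
    · exact (ContinuousMultilinearMap.apply ℝ (fun _ : Fin k => E × ℝ) ℝ _).contDiff.comp hd

end ParametricIntegral

/-! ### Splitting phase space into slow and fast variables; the resonant average. -/

section Phase

variable {m : ℕ}

/-- `join` as a continuous linear map. -/
def joinL (m : ℕ) : Vec m × ℝ →L[ℝ] Vec (m + 1) :=
  LinearMap.toContinuousLinearMap
    { toFun := fun z => join z.1 z.2
      map_add' := fun a b => by
        ext i
        refine Fin.lastCases ?_ (fun j => ?_) i <;> simp [join]
      map_smul' := fun c a => by
        ext i
        refine Fin.lastCases ?_ (fun j => ?_) i <;> simp [join] }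

@[simp] lemma joinL_apply (x : Vec m) (y : ℝ) : joinL m (x, y) = join x y := rfl

@[simp] lemma join_castSucc (x : Vec m) (y : ℝ) (i : Fin m) : join x y i.castSucc = x i := by
  simp [join]

@[simp] lemma join_last (x : Vec m) (y : ℝ) : join x y (Fin.last m) = y := by
  simp [join]

lemma join_single_zero (i : Fin m) :
    join (EuclideanSpace.single i (1 : ℝ)) 0 = EuclideanSpace.single i.castSucc 1 := by
  ext j
  refine Fin.lastCases ?_ (fun k => ?_) j
  · rw [join_last, PiLp.single_apply, if_neg (Fin.castSucc_lt_last i).ne']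
  · rw [join_castSucc]; simp [PiLp.single_apply]

lemma join_zero_one : join (0 : Vec m) 1 = EuclideanSpace.single (Fin.last m) 1 := by
  ext j
  refine Fin.lastCases ?_ (fun k => ?_) j
  · simp
  · rw [join_castSucc, PiLp.single_apply, if_neg (Fin.castSucc_lt_last k).ne]; rfl

lemma join_add (x x' : Vec m) (y y' : ℝ) : join (x + x') (y + y') = join x y + join x' y' :=
  map_add (joinL m) (x, y) (x', y')

/-- The parametrization of phase space by slow angle, action, fast angle and time. -/
def phaseL (m : ℕ) : ((Vec m × Vec (m + 1)) × ℝ) × ℝ →L[ℝ] Phase m :=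
  let s : ((Vec m × Vec (m + 1)) × ℝ) × ℝ →L[ℝ] (Vec m × Vec (m + 1)) × ℝ :=
    ContinuousLinearMap.fst ℝ _ _
  let z : ((Vec m × Vec (m + 1)) × ℝ) × ℝ →L[ℝ] Vec m × Vec (m + 1) :=
    (ContinuousLinearMap.fst ℝ _ _).comp s
  ((joinL m).comp (((ContinuousLinearMap.fst ℝ _ _).comp z).prod
      ((ContinuousLinearMap.snd ℝ _ _).comp s))).prod
    (((ContinuousLinearMap.snd ℝ _ _).comp z).prod (ContinuousLinearMap.snd ℝ _ _))

@[simp] lemma phaseL_apply (θ : Vec m) (p : Vec (m + 1)) (s t : ℝ) :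
    phaseL m (((θ, p), s), t) = (join θ s, p, t) := rfl

/-- The resonant average as a function on the product of slow angles and actions. -/
def avg (H : Phase m → ℝ) : Vec m × Vec (m + 1) → ℝ :=
  unitAverage (unitAverage (H ∘ phaseL m))

lemma contDiff_avg {n : ℕ} {H : Phase m → ℝ} (hH : ContDiff ℝ n H) : ContDiff ℝ n (avg H) :=
  contDiff_unitAverage n (contDiff_unitAverage n (hH.comp (phaseL m).contDiff))

lemma iteratedFDeriv_avg {k : ℕ} {H : Phase m → ℝ} (hH : ContDiff ℝ k H)
    (z : Vec m × Vec (m + 1)) (v : Fin k → Vec m × Vec (m + 1)) :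
    iteratedFDeriv ℝ k (avg H) z v = ∫ s in (0 : ℝ)..1, ∫ t in (0 : ℝ)..1,
      iteratedFDeriv ℝ k H (join z.1 s, z.2, t) (fun i => (join (v i).1 0, (v i).2, 0)) := by
  have h1 : ContDiff ℝ k (H ∘ phaseL m) := hH.comp (phaseL m).contDiff
  unfold avg
  rw [iteratedFDeriv_unitAverage k (contDiff_unitAverage k h1)]
  unfold unitAverage
  congr 1
  funext s
  have := iteratedFDeriv_unitAverage k h1 (z, s) (fun i => (v i, 0))
  unfold unitAverage at this
  refine this.trans ?_
  congr 1
  funext t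
  beta_reduce
  rw [ContinuousLinearMap.iteratedFDeriv_comp_right (phaseL m) hH _ le_rfl]
  rfl

lemma abs_iteratedFDeriv_avg_le {k : ℕ} {H : Phase m → ℝ} (hH : ContDiff ℝ k H)
    (z : Vec m × Vec (m + 1)) (v : Fin k → Vec m × Vec (m + 1)) {C : ℝ}
    (hC : ∀ s t, |iteratedFDeriv ℝ k H (join z.1 s, z.2, t)
      (fun i => (join (v i).1 0, (v i).2, 0))| ≤ C) :
    |iteratedFDeriv ℝ k (avg H) z v| ≤ C := by
  rw [iteratedFDeriv_avg hH]
  have h1 : ∀ s : ℝ, ‖∫ t in (0 : ℝ)..1,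
      iteratedFDeriv ℝ k H (join z.1 s, z.2, t) (fun i => (join (v i).1 0, (v i).2, 0))‖ ≤ C := by
    intro s
    simpa using intervalIntegral.norm_integral_le_of_norm_le_const (a := 0) (b := 1)
      (f := fun t => iteratedFDeriv ℝ k H (join z.1 s, z.2, t)
        (fun i => (join (v i).1 0, (v i).2, 0))) (fun t _ => hC s t)
  simpa using intervalIntegral.norm_integral_le_of_norm_le_const (a := 0) (b := 1)
      (fun s _ => h1 s)

end Phase

/-! ### Integer translations and the fundamental cube. -/

section Periodicity

variable {n : ℕ}

/-- The vector with the given integer coordinates. -/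
def intVec (k : Fin n → ℤ) : Vec n := WithLp.toLp 2 (fun i => (k i : ℝ))

@[simp] lemma intVec_apply (k : Fin n → ℤ) (i : Fin n) : intVec k i = k i := rfl

lemma intVec_eq_sum (k : Fin n → ℤ) :
    intVec k = ∑ i, k i • (EuclideanSpace.single i (1 : ℝ) : Vec n) := by
  ext j
  simp [Pi.single_apply]

lemma sameAngle_iff {x y : Vec n} : SameAngle x y ↔ ∃ k : Fin n → ℤ, y = x + intVec k := by
  constructor
  · rintro ⟨k, hk⟩
    exact ⟨k, by ext i; simp [hk]⟩
  · rintro ⟨k, rfl⟩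
    exact ⟨k, fun i => by simp⟩

/-- The subgroup of periods of a function. -/
def periods {E α : Type*} [AddCommGroup E] (f : E → α) : AddSubgroup E where
  carrier := {v | ∀ x, f (x + v) = f x}
  add_mem' := fun {a b} ha hb x => by rw [← add_assoc, hb, ha]
  zero_mem' := fun x => by rw [add_zero]
  neg_mem' := fun {a} ha x => by rw [← ha (x + -a), neg_add_cancel_right]

/-- The unit cube. -/
def cube (n : ℕ) : Set (Vec n) := {x | ∀ i, x i ∈ Icc (0 : ℝ) 1}

lemma isCompact_cube : IsCompact (cube n) := by
  have : cube n = (EuclideanSpace.equiv (Fin n) ℝ).toHomeomorph ⁻¹'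
      (Set.pi univ fun _ => Icc (0 : ℝ) 1) := by
    ext x; exact ⟨fun h i _ => h i, fun h i => h i trivial⟩
  rw [this, Homeomorph.isCompact_preimage]
  exact isCompact_univ_pi fun _ => isCompact_Icc

lemma exists_sub_intVec_mem_cube (x : Vec n) : ∃ k : Fin n → ℤ, x - intVec k ∈ cube n :=
  ⟨fun i => ⌊x i⌋, fun i => ⟨Int.fract_nonneg (x i), (Int.fract_lt_one (x i)).le⟩⟩

end Periodicity

/-! ### The C^r norm on periodic functions. -/

section CrNorm

variable {m : ℕ} {V : Set (Phase m)} {r : ℕ}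

lemma IsPerturbation.add {H K : Phase m → ℝ} (hH : IsPerturbation r H) (hK : IsPerturbation r K) :
    IsPerturbation r (H + K) :=
  ⟨hH.contDiff.add hK.contDiff, fun θ p t i => by
    simp only [Pi.add_apply, hH.periodic_angle, hK.periodic_angle], fun θ p t => by
    simp only [Pi.add_apply, hH.periodic_time, hK.periodic_time]⟩

lemma IsPerturbation.const_smul {H : Phase m → ℝ} (hH : IsPerturbation r H) (c : ℝ) :
    IsPerturbation r (c • H) :=
  ⟨contDiff_const.smul hH.contDiff, fun θ p t i => by
    simp only [Pi.smul_apply, hH.periodic_angle], fun θ p t => by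
    simp only [Pi.smul_apply, hH.periodic_time]⟩

lemma IsPerturbation.sub {H K : Phase m → ℝ} (hH : IsPerturbation r H) (hK : IsPerturbation r K) :
    IsPerturbation r (H - K) := by
  have := hH.add (hK.const_smul (-1))
  rwa [neg_one_smul, ← sub_eq_add_neg] at this

lemma IsPerturbation.periodic {H : Phase m → ℝ} (hH : IsPerturbation r H)
    (k : Fin (m + 1) → ℤ) (l : ℤ) : ((intVec k, 0, (l : ℝ)) : Phase m) ∈ periods H := by
  have h1 : ∀ i, ((EuclideanSpace.single i 1, 0, 0) : Phase m) ∈ periods H := fun i x => by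
    have : x + ((EuclideanSpace.single i 1, 0, 0) : Phase m) =
        (x.1 + EuclideanSpace.single i 1, x.2.1, x.2.2) := by ext <;> simp
    rw [this, hH.periodic_angle]
  have h2 : ((0, 0, 1) : Phase m) ∈ periods H := fun x => by
    have : x + ((0, 0, 1) : Phase m) = (x.1, x.2.1, x.2.2 + 1) := by ext <;> simp
    rw [this, hH.periodic_time]
  have h3 : ((intVec k, 0, (l : ℝ)) : Phase m) =
      (∑ i, k i • ((EuclideanSpace.single i 1, 0, 0) : Phase m)) + l • ((0, 0, 1) : Phase m) := by
    refine Prod.ext ?_ (Prod.ext ?_ ?_)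
    · simp [Prod.fst_sum, intVec_eq_sum]
    · simp [Prod.snd_sum]
    · simp [Prod.snd_sum]
  rw [h3]
  exact add_mem (sum_mem fun i _ => zsmul_mem (h1 i) _) (zsmul_mem h2 _)

/-- Derivatives inherit the periods, and integer translations move any point of `domain` into the
compact product of cube, ball and unit interval. -/
lemma IsPerturbation.exists_bound {H : Phase m → ℝ} (hH : IsPerturbation r H) {k : ℕ}
    (hk : k ≤ r) : ∃ C, 0 ≤ C ∧ ∀ x ∈ domain m, ‖iteratedFDeriv ℝ k H x‖ ≤ C := by
  have hc : Continuous (iteratedFDeriv ℝ k H) :=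
    hH.contDiff.continuous_iteratedFDeriv (by exact_mod_cast hk)
  obtain ⟨C, hC⟩ := (isCompact_cube (n := m + 1)).prod
    ((isCompact_closedBall (0 : Vec (m + 1)) 1).prod (isCompact_Icc (a := (0 : ℝ)) (b := 1)))
    |>.exists_bound_of_continuousOn hc.continuousOn
  refine ⟨max C 0, le_max_right _ _, fun x hx => ?_⟩
  obtain ⟨a, ha⟩ := exists_sub_intVec_mem_cube x.1
  have hper : (fun z => H (z + (intVec a, 0, (⌊x.2.2⌋ : ℝ)))) = H :=
    funext fun z => hH.periodic a ⌊x.2.2⌋ z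
  have h := iteratedFDeriv_comp_add_right (𝕜 := ℝ) (f := H) k (intVec a, 0, (⌊x.2.2⌋ : ℝ))
    (x - (intVec a, 0, (⌊x.2.2⌋ : ℝ)))
  rw [hper, sub_add_cancel] at h
  rw [← h]
  refine (hC _ ⟨ha, ?_, ?_⟩).trans (le_max_left _ _)
  · simpa using hx.2.1
  · exact ⟨Int.fract_nonneg x.2.2, (Int.fract_lt_one x.2.2).le⟩

/-- The supremum of an unbounded set of reals is 0 by convention, so `crNorm` controls derivatives
only once boundedness is known. -/
lemma IsPerturbation.bddAbove (hV : ∀ v ∈ V, ‖v‖ ≤ 1) {H : Phase m → ℝ}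
    (hH : IsPerturbation r H) :
    BddAbove {y | ∃ k ≤ r, ∃ v : Fin k → Phase m, (∀ i, v i ∈ V) ∧
      ∃ x ∈ domain m, y = |iteratedFDeriv ℝ k H x v|} := by
  have : ∀ k, ∃ C, 0 ≤ C ∧ (k ≤ r → ∀ x ∈ domain m, ‖iteratedFDeriv ℝ k H x‖ ≤ C) := fun k => by
    by_cases hk : k ≤ r
    · obtain ⟨C, h0, hC⟩ := hH.exists_bound hk
      exact ⟨C, h0, fun _ => hC⟩
    · exact ⟨0, le_rfl, fun h => absurd h hk⟩
  choose C h0 hC using this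
  refine ⟨∑ k ∈ Finset.range (r + 1), C k, ?_⟩
  rintro y ⟨k, hk, v, hv, x, hx, rfl⟩
  calc |iteratedFDeriv ℝ k H x v| ≤ ‖iteratedFDeriv ℝ k H x‖ * ∏ i, ‖v i‖ :=
        (iteratedFDeriv ℝ k H x).le_opNorm v
    _ ≤ C k * 1 := by
        gcongr
        · exact h0 k
        · exact hC k hk x hx
        · exact Finset.prod_le_one (fun _ _ => norm_nonneg _) fun i _ => hV _ (hv i)
    _ ≤ _ := by
        rw [mul_one]
        exact Finset.single_le_sum (f := C) (fun i _ => h0 i)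
          (Finset.mem_range.2 (Nat.lt_succ_of_le hk))

lemma IsPerturbation.le_crNorm (hV : ∀ v ∈ V, ‖v‖ ≤ 1) {H : Phase m → ℝ}
    (hH : IsPerturbation r H) {k : ℕ} (hk : k ≤ r) {v : Fin k → Phase m} (hv : ∀ i, v i ∈ V)
    {x : Phase m} (hx : x ∈ domain m) : |iteratedFDeriv ℝ k H x v| ≤ crNorm V r H :=
  le_csSup (hH.bddAbove hV) ⟨k, hk, v, hv, x, hx, rfl⟩

lemma crNorm_nonneg (H : Phase m → ℝ) : 0 ≤ crNorm V r H := by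
  refine Real.sSup_nonneg ?_
  rintro y ⟨k, hk, v, hv, x, hx, rfl⟩
  exact abs_nonneg _

lemma crNorm_le {H : Phase m → ℝ} {C : ℝ} (hC : 0 ≤ C)
    (h : ∀ k ≤ r, ∀ v : Fin k → Phase m, (∀ i, v i ∈ V) → ∀ x ∈ domain m,
      |iteratedFDeriv ℝ k H x v| ≤ C) : crNorm V r H ≤ C := by
  refine Real.sSup_le ?_ hC
  rintro y ⟨k, hk, v, hv, x, hx, rfl⟩
  exact h k hk v hv x hx

lemma crNorm_add_le (hV : ∀ v ∈ V, ‖v‖ ≤ 1) {H K : Phase m → ℝ} (hH : IsPerturbation r H)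
    (hK : IsPerturbation r K) : crNorm V r (H + K) ≤ crNorm V r H + crNorm V r K := by
  refine crNorm_le (add_nonneg (crNorm_nonneg _) (crNorm_nonneg _)) fun k hk v hv x hx => ?_
  have hk' : (k : WithTop ℕ∞) ≤ r := by exact_mod_cast hk
  rw [iteratedFDeriv_add_apply (hH.contDiff.of_le hk').contDiffAt
    (hK.contDiff.of_le hk').contDiffAt]
  exact (abs_add_le _ _).trans (add_le_add (hH.le_crNorm hV hk hv hx) (hK.le_crNorm hV hk hv hx))

lemma crNorm_const_smul_le (hV : ∀ v ∈ V, ‖v‖ ≤ 1) {H : Phase m → ℝ} (hH : IsPerturbation r H)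
    (c : ℝ) : crNorm V r (c • H) ≤ |c| * crNorm V r H := by
  refine crNorm_le (mul_nonneg (abs_nonneg _) (crNorm_nonneg _)) fun k hk v hv x hx => ?_
  have hk' : (k : WithTop ℕ∞) ≤ r := by exact_mod_cast hk
  have : iteratedFDeriv ℝ k (c • H) x = c • iteratedFDeriv ℝ k H x :=
    iteratedFDeriv_const_smul_apply (hH.contDiff.of_le hk').contDiffAt
  rw [this, smul_apply, smul_eq_mul, abs_mul]
  exact mul_le_mul_of_nonneg_left (hH.le_crNorm hV hk hv hx) (abs_nonneg _)

lemma crNorm_const_smul (hV : ∀ v ∈ V, ‖v‖ ≤ 1) {H : Phase m → ℝ} (hH : IsPerturbation r H)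
    {c : ℝ} (hc : c ≠ 0) : crNorm V r (c • H) = |c| * crNorm V r H := by
  refine le_antisymm (crNorm_const_smul_le hV hH c) ?_
  have := crNorm_const_smul_le hV (hH.const_smul c) c⁻¹
  rw [inv_smul_smul₀ hc, abs_inv] at this
  rwa [← le_inv_mul_iff₀ (abs_pos.2 hc)]

lemma norm_le_one_of_mem_unitDirs : ∀ v ∈ unitDirs m, ‖v‖ ≤ 1 := by
  intro v hv
  have hv : ‖v.1‖ ^ 2 + ‖v.2.1‖ ^ 2 + v.2.2 ^ 2 = 1 := hv
  refine max_le ?_ (max_le ?_ ?_)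
  · exact abs_le_one_iff_mul_self_le_one.2 (by nlinarith [sq_nonneg ‖v.2.1‖, sq_nonneg v.2.2]) |> (le_abs_self _).trans
  · exact abs_le_one_iff_mul_self_le_one.2 (by nlinarith [sq_nonneg ‖v.1‖, sq_nonneg v.2.2]) |> (le_abs_self _).trans
  · exact abs_le_one_iff_mul_self_le_one.2 (by nlinarith [sq_nonneg ‖v.1‖, sq_nonneg ‖v.2.1‖])

lemma coordDirs_subset_unitDirs : coordDirs m ⊆ unitDirs m := by
  rintro v (⟨i, rfl⟩ | ⟨i, rfl⟩ | rfl) <;> simp [unitDirs]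

lemma norm_le_one_of_mem_coordDirs : ∀ v ∈ coordDirs m, ‖v‖ ≤ 1 :=
  fun v hv => norm_le_one_of_mem_unitDirs v (coordDirs_subset_unitDirs hv)

end CrNorm

/-! ### Hessians as quadratic forms, and of slices of functions on a product. -/

section Hessian

variable {m : ℕ}

lemma hessian_eq (f : Vec m → ℝ) (θ v : Vec m) :
    hessian f θ v = fderiv ℝ (fderiv ℝ f) θ v v := by
  unfold hessian
  rw [iteratedFDeriv_two_apply]
  rfl

lemma hessian_smul (f : Vec m → ℝ) (θ v : Vec m) (c : ℝ) :
    hessian f θ (c • v) = c ^ 2 * hessian f θ v := by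
  simp only [hessian_eq, map_smul, smul_apply, smul_eq_mul]
  ring

lemma iteratedFDeriv_slice {X W : Type*} [NormedAddCommGroup X] [NormedSpace ℝ X]
    [NormedAddCommGroup W] [NormedSpace ℝ W] {Z : X × W → ℝ} {k : ℕ} (hZ : ContDiff ℝ k Z)
    (θ : X) (p : W) (v : Fin k → X) :
    iteratedFDeriv ℝ k (fun x => Z (x, p)) θ v =
      iteratedFDeriv ℝ k Z (θ, p) (fun i => (v i, 0)) := by
  have h1 : (fun x => Z (x, p)) =
      (fun y => Z (y + (0, p))) ∘ ContinuousLinearMap.inl ℝ X W := by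
    funext x; simp
  have h2 : ContDiff ℝ k (fun y => Z (y + (0, p))) := hZ.comp (contDiff_id.add contDiff_const)
  rw [h1, ContinuousLinearMap.iteratedFDeriv_comp_right _ h2 _ le_rfl,
    iteratedFDeriv_comp_add_right]
  simp [ContinuousMultilinearMap.compContinuousLinearMap_apply]

lemma hessian_slice {W : Type*} [NormedAddCommGroup W] [NormedSpace ℝ W] {Z : Vec m × W → ℝ}
    (hZ : ContDiff ℝ 2 Z) (θ v : Vec m) (p : W) :
    hessian (fun x => Z (x, p)) θ v = iteratedFDeriv ℝ 2 Z (θ, p) (fun _ => (v, 0)) := by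
  unfold hessian
  rw [iteratedFDeriv_slice (k := 2) (by exact_mod_cast hZ)]
  congr 1
  funext i
  fin_cases i <;> rfl

lemma vec_eq_sum (v : Vec m) : v = ∑ i, v i • EuclideanSpace.single i (1 : ℝ) := by
  ext j
  simp [Pi.single_apply]

lemma sum_abs_sq_le (v : Vec m) : (∑ i, |v i|) ^ 2 ≤ m * ‖v‖ ^ 2 := by
  have := sq_sum_le_card_mul_sum_sq (s := Finset.univ) (f := fun i => |v i|)
  simpa [EuclideanSpace.norm_sq_eq] using this

lemma abs_bilin_le {v : Vec m} (B : Vec m →L[ℝ] Vec m →L[ℝ] ℝ) {ε : ℝ}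
    (hB : ∀ i j, |B (EuclideanSpace.single i 1) (EuclideanSpace.single j 1)| ≤ ε) :
    |B v v| ≤ ε * (∑ i, |v i|) ^ 2 := by
  have : B v v = ∑ i, ∑ j, v i * v j *
      B (EuclideanSpace.single i 1) (EuclideanSpace.single j 1) := by
    conv_lhs => rw [vec_eq_sum v]
    simp only [map_sum, map_smul, sum_apply, smul_apply,
      smul_eq_mul, Finset.mul_sum]
    rw [Finset.sum_comm]
    exact Finset.sum_congr rfl fun i _ => Finset.sum_congr rfl fun j _ => by ring
  rw [this, sq, Finset.sum_mul_sum, Finset.mul_sum]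
  refine (Finset.abs_sum_le_sum_abs _ _).trans (Finset.sum_le_sum fun i _ => ?_)
  rw [Finset.mul_sum]
  refine (Finset.abs_sum_le_sum_abs _ _).trans (Finset.sum_le_sum fun j _ => ?_)
  rw [abs_mul, abs_mul, mul_comm]
  exact mul_le_mul_of_nonneg_right (hB i j) (by positivity)

end Hessian

/-! ### Derivatives of the resonant average are bounded by the C^r norm. -/

section AverageBounds

variable {m : ℕ} {V : Set (Phase m)} {r : ℕ} {H : Phase m → ℝ}

lemma IsPerturbation.abs_iteratedFDeriv_avg_le (hV : ∀ v ∈ V, ‖v‖ ≤ 1) (hH : IsPerturbation r H)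
    {k : ℕ} (hk : k ≤ r) {v : Fin k → Vec m × Vec (m + 1)}
    (hv : ∀ i, ((join (v i).1 0, (v i).2, 0) : Phase m) ∈ V) {θ : Vec m} {p : Vec (m + 1)}
    (hp : p ∈ Metric.closedBall (0 : Vec (m + 1)) 1) :
    |iteratedFDeriv ℝ k (avg H) (θ, p) v| ≤ crNorm V r H :=
  Resonance.abs_iteratedFDeriv_avg_le (hH.contDiff.of_le (by exact_mod_cast hk)) _ _
    fun _ _ => hH.le_crNorm hV hk hv ⟨trivial, hp, trivial⟩

lemma slow_mem (hV' : coordDirs m ⊆ V) (i : Fin m) :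
    ((join (EuclideanSpace.single i 1) 0, 0, 0) : Phase m) ∈ V :=
  hV' (Or.inl ⟨i.castSucc, by rw [join_single_zero]⟩)

lemma action_mem (hV' : coordDirs m ⊆ V) (i : Fin (m + 1)) :
    ((join 0 0, EuclideanSpace.single i 1, 0) : Phase m) ∈ V :=
  hV' (Or.inr (Or.inl ⟨i, by
    have : join (0 : Vec m) 0 = 0 := map_zero (joinL m)
    rw [this]⟩))

lemma IsPerturbation.abs_avg_le (hV : ∀ v ∈ V, ‖v‖ ≤ 1) (hH : IsPerturbation r H)
    (θ : Vec m) {p : Vec (m + 1)} (hp : p ∈ Metric.closedBall (0 : Vec (m + 1)) 1) :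
    |avg H (θ, p)| ≤ crNorm V r H := by
  have := hH.abs_iteratedFDeriv_avg_le hV (Nat.zero_le r) (v := 0) (fun i => i.elim0)
    (θ := θ) hp
  simpa using this

lemma IsPerturbation.abs_fderiv_avg_le (hV : ∀ v ∈ V, ‖v‖ ≤ 1) (hV' : coordDirs m ⊆ V)
    (hH : IsPerturbation r H) (hr : 1 ≤ r)
    (θ : Vec m) {p : Vec (m + 1)} (hp : p ∈ Metric.closedBall (0 : Vec (m + 1)) 1)
    (w : Vec (m + 1)) :
    |fderiv ℝ (avg H) (θ, p) (0, w)| ≤ crNorm V r H * ∑ i, |w i| := by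
  have h1 : ∀ i, |fderiv ℝ (avg H) (θ, p) (0, EuclideanSpace.single i 1)| ≤ crNorm V r H := by
    intro i
    have := hH.abs_iteratedFDeriv_avg_le hV hr (v := fun _ => (0, EuclideanSpace.single i 1))
      (fun _ => action_mem hV' i) (θ := θ) hp
    rwa [iteratedFDeriv_one_apply] at this
  have h2 : ((0, w) : Vec m × Vec (m + 1)) =
      ∑ i, w i • ((0, EuclideanSpace.single i 1) : Vec m × Vec (m + 1)) := by
    conv_lhs => rw [vec_eq_sum w]
    refine Prod.ext ?_ ?_
    · simp [Prod.fst_sum]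
    · simp [Prod.snd_sum]
  rw [h2, map_sum, Finset.mul_sum]
  refine (Finset.abs_sum_le_sum_abs _ _).trans (Finset.sum_le_sum fun i _ => ?_)
  rw [map_smul, smul_eq_mul, abs_mul, mul_comm]
  exact mul_le_mul_of_nonneg_right (h1 i) (abs_nonneg _)

/-- Second derivatives along coordinates bound the form by (∑ |vᵢ|)², and Cauchy-Schwarz costs a
factor m. This crude bound serves closeness of families; the constant M needs the finer estimates
that follow. -/
lemma IsPerturbation.abs_hessian_avg_le (hV : ∀ v ∈ V, ‖v‖ ≤ 1) (hV' : coordDirs m ⊆ V)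
    (hH : IsPerturbation r H) (hr : 2 ≤ r)
    (θ : Vec m) {p : Vec (m + 1)} (hp : p ∈ Metric.closedBall (0 : Vec (m + 1)) 1) (v : Vec m) :
    |hessian (fun x => avg H (x, p)) θ v| ≤ crNorm V r H * (m * ‖v‖ ^ 2) := by
  have hZ : ContDiff ℝ (2 : ℕ) (avg H) :=
    contDiff_avg (hH.contDiff.of_le (by exact_mod_cast hr))
  rw [hessian_eq]
  refine (abs_bilin_le _ fun i j => ?_).trans
    (mul_le_mul_of_nonneg_left (sum_abs_sq_le v) (crNorm_nonneg _))
  have h1 := iteratedFDeriv_slice hZ θ p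
    ![EuclideanSpace.single i 1, EuclideanSpace.single j 1]
  rw [iteratedFDeriv_two_apply] at h1
  have h2 := hH.abs_iteratedFDeriv_avg_le hV hr (θ := θ)
    (v := fun k => ((![EuclideanSpace.single i 1, EuclideanSpace.single j 1] : Fin 2 → Vec m) k, 0))
    (fun k => by
      refine Fin.cases ?_ (fun k => ?_) k
      · exact slow_mem hV' i
      · have : k = 0 := Subsingleton.elim _ _
        subst this
        exact slow_mem hV' j) hp
  rw [← h1] at h2
  exact h2

end AverageBounds

/-! ### The upper Hessian bound, with constants 1 and m / 4. -/

section UpperBounds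

variable {m : ℕ} {r : ℕ} {H : Phase m → ℝ}

lemma norm_join_zero (v : Vec m) : ‖join v 0‖ = ‖v‖ := by
  rw [EuclideanSpace.norm_eq, EuclideanSpace.norm_eq, Fin.sum_univ_castSucc]
  simp

/-- A slow unit vector, completed by zeros, is itself an element of `unitDirs`; homogeneity does the
rest. -/
lemma IsPerturbation.neg_hessian_avg_le_unitDirs (hH : IsPerturbation r H) (hr : 2 ≤ r)
    (θ : Vec m) {p : Vec (m + 1)} (hp : p ∈ Metric.closedBall (0 : Vec (m + 1)) 1) (v : Vec m) :
    -hessian (fun x => avg H (x, p)) θ v ≤ crNorm (unitDirs m) r H * ‖v‖ ^ 2 := by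
  have hZ : ContDiff ℝ (2 : ℕ) (avg H) :=
    contDiff_avg (hH.contDiff.of_le (by exact_mod_cast hr))
  have key : ∀ u : Vec m, ‖u‖ = 1 →
      -hessian (fun x => avg H (x, p)) θ u ≤ crNorm (unitDirs m) r H := by
    intro u hu
    have := hH.abs_iteratedFDeriv_avg_le norm_le_one_of_mem_unitDirs hr (θ := θ)
      (v := fun _ => (u, 0)) (fun _ => by simp [unitDirs, norm_join_zero, hu]) hp
    rw [← hessian_slice hZ] at this
    exact (neg_le_abs _).trans this
  rcases eq_or_ne v 0 with rfl | hv
  · simp [hessian_eq]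
  · have h0 : ‖v‖ ≠ 0 := norm_ne_zero_iff.2 hv
    have h1 : v = ‖v‖ • (‖v‖⁻¹ • v) := by rw [smul_smul, mul_inv_cancel₀ h0, one_smul]
    have h2 := key (‖v‖⁻¹ • v) (by rw [norm_smul, norm_inv, norm_norm, inv_mul_cancel₀ h0])
    calc -hessian (fun x => avg H (x, p)) θ v
        = ‖v‖ ^ 2 * -hessian (fun x => avg H (x, p)) θ (‖v‖⁻¹ • v) := by
          conv_lhs => rw [h1, hessian_smul]
          ring
      _ ≤ ‖v‖ ^ 2 * crNorm (unitDirs m) r H := mul_le_mul_of_nonneg_left h2 (sq_nonneg _)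
      _ = _ := mul_comm _ _

/-- A `1`-periodic function with vanishing mean and Lipschitz constant `C` is at least `-C / 4`. -/
lemma neg_le_of_periodic_deriv {f g g' : ℝ → ℝ} {C : ℝ}
    (hf : ∀ s, HasDerivAt f (g s) s) (hg : ∀ s, HasDerivAt g (g' s) s)
    (hper : f (1 / 2) = f (-1 / 2)) (hC : ∀ s, |g' s| ≤ C) : -g 0 ≤ C / 4 := by
  have hlip : ∀ s, |g s - g 0| ≤ C * |s| := by
    intro s
    have := Convex.norm_image_sub_le_of_norm_hasDerivWithin_le (f := g) (f' := g') (s := univ)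
      (x := 0) (y := s) (C := C) (fun x _ => (hg x).hasDerivWithinAt) (fun x _ => hC x) convex_univ
      trivial trivial
    simpa using this
  -- Integrating g s ≤ g 0 + C |s| over each half period bounds the increment of f there by g 0 / 2
  -- + C / 8; the two increments sum to 0 by periodicity.
  have h1 : MonotoneOn (fun s => (g 0) * s + C * s ^ 2 / 2 - f s) (Icc 0 (1 / 2)) := by
    refine monotoneOn_of_hasDerivWithinAt_nonneg (convex_Icc _ _)
      (f' := fun s => g 0 + C * s - g s) ?_ ?_ ?_
    · exact fun s _ => ((((continuous_const.mul continuous_id).add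
        ((continuous_const.mul (continuous_id.pow 2)).div_const 2)).continuousAt).sub
        (hf s).continuousAt).continuousWithinAt
    · intro s _
      have := (((hasDerivAt_id s).const_mul (g 0)).add
        ((((hasDerivAt_id s).pow 2).const_mul C).div_const 2)).sub (hf s)
      refine HasDerivAt.hasDerivWithinAt (this.congr_deriv ?_)
      simp; ring
    · intro s hs
      rw [interior_Icc] at hs
      have := (le_abs_self _).trans (hlip s)
      rw [abs_of_pos hs.1] at this
      linarith
  have h2 : MonotoneOn (fun s => (g 0) * s - C * s ^ 2 / 2 - f s) (Icc (-1 / 2) 0) := by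
    refine monotoneOn_of_hasDerivWithinAt_nonneg (convex_Icc _ _)
      (f' := fun s => g 0 - C * s - g s) ?_ ?_ ?_
    · exact fun s _ => ((((continuous_const.mul continuous_id).sub
        ((continuous_const.mul (continuous_id.pow 2)).div_const 2)).continuousAt).sub
        (hf s).continuousAt).continuousWithinAt
    · intro s _
      have := (((hasDerivAt_id s).const_mul (g 0)).sub
        ((((hasDerivAt_id s).pow 2).const_mul C).div_const 2)).sub (hf s)
      refine HasDerivAt.hasDerivWithinAt (this.congr_deriv ?_)
      simp; ring
    · intro s hs
      rw [interior_Icc] at hs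
      have := (le_abs_self _).trans (hlip s)
      rw [abs_of_neg hs.2] at this
      linarith
  have h3 := h1 (left_mem_Icc.2 (by norm_num)) (right_mem_Icc.2 (by norm_num)) (by norm_num)
  have h4 := h2 (left_mem_Icc.2 (by norm_num)) (right_mem_Icc.2 (by norm_num)) (by norm_num)
  norm_num at h3 h4 hper
  linarith

lemma periodic_avg {m : ℕ} {r : ℕ} {H : Phase m → ℝ} (hH : IsPerturbation r H) (i : Fin m) :
    ((EuclideanSpace.single i 1, 0) : Vec m × Vec (m + 1)) ∈ periods (avg H) := by
  rintro ⟨θ, p⟩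
  have : ∀ s, join (θ + EuclideanSpace.single i 1) s =
      join θ s + EuclideanSpace.single i.castSucc 1 := by
    intro s
    rw [← join_single_zero, ← join_add, add_zero]
  simp only [Prod.mk_add_mk, add_zero, avg, unitAverage, Function.comp, phaseL_apply, this,
    hH.periodic_angle]

lemma hasDerivAt_iteratedFDeriv_line {E : Type*} [NormedAddCommGroup E] [NormedSpace ℝ E]
    {Z : E → ℝ} {k : ℕ} (hZ : ContDiff ℝ (k + 1 : ℕ) Z) (z u : E) (s : ℝ) :
    HasDerivAt (fun s : ℝ => iteratedFDeriv ℝ k Z (z + s • u) (fun _ => u))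
      (iteratedFDeriv ℝ (k + 1) Z (z + s • u) (fun _ => u)) s := by
  have hd : Differentiable ℝ (iteratedFDeriv ℝ k Z) :=
    hZ.differentiable_iteratedFDeriv (by exact_mod_cast Nat.lt_succ_self k)
  have h1 := ((hd (z + s • u)).hasFDerivAt.continuousMultilinear_apply_const (fun _ => u))
  have h2 : HasDerivAt (fun s : ℝ => z + s • u) u s := by
    simpa using ((hasDerivAt_id s).smul_const u).const_add z
  exact h1.comp_hasDerivAt s h2

/-- Along the i-th coordinate line the first derivative is periodic and the third is bounded by the
norm, so the second derivative has mean zero and the quarter bound for such functions applies. -/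
lemma IsPerturbation.neg_hessian_avg_single_le {V : Set (Phase m)} (hV : ∀ v ∈ V, ‖v‖ ≤ 1)
    (hV' : coordDirs m ⊆ V) (hH : IsPerturbation r H) (hr : 3 ≤ r)
    (θ : Vec m) {p : Vec (m + 1)} (hp : p ∈ Metric.closedBall (0 : Vec (m + 1)) 1) (i : Fin m) :
    -hessian (fun x => avg H (x, p)) θ (EuclideanSpace.single i 1) ≤ crNorm V r H / 4 := by
  have hZ : ContDiff ℝ (3 : ℕ) (avg H) :=
    contDiff_avg (hH.contDiff.of_le (by exact_mod_cast hr))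
  have hZ2 : ContDiff ℝ (2 : ℕ) (avg H) := hZ.of_le (by norm_num)
  set u : Vec m × Vec (m + 1) := (EuclideanSpace.single i 1, 0) with hu
  have hper : (fun z => avg H (z + u)) = avg H := funext fun z => periodic_avg hH i z
  have := neg_le_of_periodic_deriv (C := crNorm V r H)
    (hasDerivAt_iteratedFDeriv_line (k := 1) hZ2 (θ, p) u)
    (hasDerivAt_iteratedFDeriv_line (k := 2) hZ (θ, p) u) ?_ ?_
  · rw [hessian_slice (by exact_mod_cast hZ2)]
    simpa using this
  · have h := iteratedFDeriv_comp_add_right (𝕜 := ℝ) (f := avg H) 1 u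
      ((θ, p) + (-1 / 2 : ℝ) • u)
    rw [hper] at h
    rw [h]
    congr 2
    rw [add_assoc]
    congr 1
    nth_rewrite 3 [← one_smul ℝ u]
    rw [← add_smul]
    norm_num
  · intro s
    have : (θ, p) + s • u = (θ + s • EuclideanSpace.single i 1, p) := by simp [hu]
    rw [this]
    exact hH.abs_iteratedFDeriv_avg_le hV hr (fun _ => slow_mem hV' i) hp

/-- Semidefiniteness, tested on eᵢ ± eⱼ, bounds every off-diagonal entry by the mean of two diagonal
ones, hence by a quarter of the norm. The factor m is Cauchy-Schwarz. -/
lemma IsPerturbation.neg_hessian_avg_le_coordDirs {V : Set (Phase m)} (hV : ∀ v ∈ V, ‖v‖ ≤ 1)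
    (hV' : coordDirs m ⊆ V) (hH : IsPerturbation r H) (hr : 3 ≤ r)
    (θ : Vec m) {p : Vec (m + 1)} (hp : p ∈ Metric.closedBall (0 : Vec (m + 1)) 1)
    (hneg : ∀ v, hessian (fun x => avg H (x, p)) θ v ≤ 0) (v : Vec m) :
    -hessian (fun x => avg H (x, p)) θ v ≤ crNorm V r H * (m / 4 * ‖v‖ ^ 2) := by
  have hZ : ContDiff ℝ 2 (fun x => avg H (x, p)) :=
    (contDiff_avg (n := 2) (hH.contDiff.of_le (by exact_mod_cast (by omega : 2 ≤ r)))).comp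
      (contDiff_id.prodMk contDiff_const)
  have hsymm : IsSymmSndFDerivAt ℝ (fun x => avg H (x, p)) θ :=
    hZ.contDiffAt.isSymmSndFDerivAt (by simp)
  have hdiag := hH.neg_hessian_avg_single_le hV hV' hr θ hp
  simp only [hessian_eq] at hneg hdiag ⊢
  refine (neg_le_abs _).trans ((abs_bilin_le (ε := crNorm V r H / 4) _ fun i j => ?_).trans ?_)
  · have h1 := hneg (EuclideanSpace.single i 1 + EuclideanSpace.single j 1)
    have h2 := hneg (EuclideanSpace.single i 1 - EuclideanSpace.single j 1)
    have h3 := hsymm (EuclideanSpace.single i 1) (EuclideanSpace.single j 1)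
    have h4 := hdiag i
    have h5 := hdiag j
    simp only [map_add, map_sub, add_apply, sub_apply] at h1 h2
    rw [abs_le]
    constructor <;> linarith
  · have := mul_le_mul_of_nonneg_left (sum_abs_sq_le v)
      (div_nonneg (crNorm_nonneg (V := V) (r := r) H) zero_le_four)
    linarith

end UpperBounds

/-! ### Functions on the torus and their global maxima. -/

section PeriodicFunctions

variable {m : ℕ} {α : Type*}

/-- `f` is a function on the torus. -/
def TorusPeriodic (f : Vec m → α) : Prop := ∀ k : Fin m → ℤ, ∀ x, f (x + intVec k) = f x

lemma torusPeriodic_of_single {f : Vec m → α}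
    (h : ∀ i, EuclideanSpace.single i 1 ∈ periods f) : TorusPeriodic f := fun k => by
  have : intVec k ∈ periods f := by
    rw [intVec_eq_sum]
    exact sum_mem fun i _ => zsmul_mem (h i) _
  exact this

lemma TorusPeriodic.eq_of_sameAngle {f : Vec m → α} (hf : TorusPeriodic f) {x y : Vec m}
    (h : SameAngle x y) : f y = f x := by
  obtain ⟨k, rfl⟩ := sameAngle_iff.1 h
  exact hf k x

lemma intVec_neg (k : Fin m → ℤ) : intVec (-k) = -intVec k := by ext; simp

lemma intVec_add (k l : Fin m → ℤ) : intVec (k + l) = intVec k + intVec l := by ext; simp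

lemma SameAngle.symm {x y : Vec m} (h : SameAngle x y) : SameAngle y x := by
  obtain ⟨k, rfl⟩ := sameAngle_iff.1 h
  exact sameAngle_iff.2 ⟨-k, by rw [intVec_neg]; abel⟩

lemma SameAngle.refl (x : Vec m) : SameAngle x x :=
  sameAngle_iff.2 ⟨0, by ext; simp⟩

lemma SameAngle.trans {x y z : Vec m} (h : SameAngle x y) (h' : SameAngle y z) :
    SameAngle x z := by
  obtain ⟨k, rfl⟩ := sameAngle_iff.1 h
  obtain ⟨l, rfl⟩ := sameAngle_iff.1 h'
  exact sameAngle_iff.2 ⟨k + l, by rw [intVec_add, add_assoc]⟩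

lemma sameAngle_add_intVec (x : Vec m) (k : Fin m → ℤ) : SameAngle x (x + intVec k) :=
  sameAngle_iff.2 ⟨k, rfl⟩

lemma sameAngle_sub_intVec (x : Vec m) (k : Fin m → ℤ) : SameAngle x (x - intVec k) :=
  sameAngle_iff.2 ⟨-k, by rw [intVec_neg, sub_eq_add_neg]⟩

lemma exists_mem_cube (x : Vec m) : ∃ y ∈ cube m, SameAngle x y :=
  let ⟨k, hk⟩ := exists_sub_intVec_mem_cube x
  ⟨_, hk, sameAngle_sub_intVec x k⟩

lemma TorusPeriodic.isGlobalMax {f : Vec m → ℝ} (hf : TorusPeriodic f) {x y : Vec m}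
    (hx : IsGlobalMax f x) (h : SameAngle x y) : IsGlobalMax f y := fun z => by
  rw [hf.eq_of_sameAngle h]; exact hx z

lemma TorusPeriodic.fderiv {E : Type*} [NormedAddCommGroup E] [NormedSpace ℝ E] {f : Vec m → E}
    (hf : TorusPeriodic f) : TorusPeriodic (fderiv ℝ f) := fun k x => by
  have h := fderiv_comp_add_right (𝕜 := ℝ) (f := f) (x := x) (intVec k)
  have h' : (fun x => f (x + intVec k)) = f := funext fun x => hf k x
  rw [h'] at h
  exact h.symm

lemma TorusPeriodic.hessian {f : Vec m → ℝ} (hf : TorusPeriodic f) {x y : Vec m}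
    (h : SameAngle x y) (v : Vec m) : hessian f y v = hessian f x v := by
  rw [hessian_eq, hessian_eq, hf.fderiv.fderiv.eq_of_sameAngle h]

lemma TorusPeriodic.exists_isGlobalMax {f : Vec m → ℝ} (hf : TorusPeriodic f)
    (hc : Continuous f) : ∃ x, IsGlobalMax f x := by
  obtain ⟨x, -, hx⟩ := isCompact_cube.exists_isMaxOn (s := cube m)
    ⟨0, fun i => by simp⟩ hc.continuousOn
  refine ⟨x, fun y => ?_⟩
  obtain ⟨z, hz, hyz⟩ := exists_mem_cube y
  rw [← hf.eq_of_sameAngle hyz]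
  exact hx hz

lemma IsGlobalMax.eq {f : Vec m → ℝ} {x y : Vec m} (hx : IsGlobalMax f x)
    (hy : IsGlobalMax f y) : f x = f y := le_antisymm (hy x) (hx y)

lemma IsGlobalMax.fderiv_eq_zero {f : Vec m → ℝ} {x : Vec m} (hx : IsGlobalMax f x) :
    fderiv ℝ f x = 0 :=
  IsLocalMax.fderiv_eq_zero (Eventually.of_forall hx)

end PeriodicFunctions

/-! ### Stability of nondegenerate maxima of a single function. -/

section StaticStability

variable {m : ℕ}

lemma continuous_hessian {f : Vec m → ℝ} (hf : ContDiff ℝ 2 f) :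
    Continuous fun z : Vec m × Vec m => hessian f z.1 z.2 := by
  simp only [hessian_eq]
  have h1 : Continuous (fderiv ℝ (fderiv ℝ f)) :=
    (hf.fderiv_right (m := 1) (by norm_num)).continuous_fderiv one_ne_zero
  exact ((h1.comp continuous_fst).clm_apply continuous_snd).clm_apply continuous_snd

/-- Quadratic decay away from a critical point in a region of strict concavity. -/
lemma le_sub_of_fderiv_fderiv_le {E : Type*} [NormedAddCommGroup E] [NormedSpace ℝ E] {g : E → ℝ}
    (hg : ContDiff ℝ 2 g) {S : Set E} (hS : Convex ℝ S) {c : ℝ}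
    (hc : ∀ z ∈ S, ∀ v, fderiv ℝ (fderiv ℝ g) z v v ≤ -c * ‖v‖ ^ 2) {x y : E}
    (hx : x ∈ S) (hy : y ∈ S) (hcrit : fderiv ℝ g x = 0) :
    g y ≤ g x - c / 2 * ‖y - x‖ ^ 2 := by
  obtain ⟨v, hv⟩ : ∃ v, v = y - x := ⟨_, rfl⟩
  have hline : ∀ t : ℝ, HasDerivAt (fun t : ℝ => x + t • v) v t := fun t => by
    simpa using ((hasDerivAt_id t).smul_const v).const_add x
  have h1 : ∀ t : ℝ, HasDerivAt (fun t : ℝ => g (x + t • v)) (fderiv ℝ g (x + t • v) v) t :=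
    fun t => ((hg.differentiable two_ne_zero _).hasFDerivAt).comp_hasDerivAt t (hline t)
  have h2 : ∀ t : ℝ, HasDerivAt (fun t : ℝ => fderiv ℝ g (x + t • v) v)
      (fderiv ℝ (fderiv ℝ g) (x + t • v) v v) t := fun t => by
    have := hasDerivAt_iteratedFDeriv_line (k := 1) (by exact_mod_cast hg) x v t
    simp only [iteratedFDeriv_one_apply] at this
    exact this.congr_deriv (iteratedFDeriv_two_apply _ _ _)
  have hmem : ∀ t ∈ Icc (0 : ℝ) 1, x + t • v ∈ S := fun t ht => by
    have := hS hx hy (sub_nonneg.2 ht.2) ht.1 (by ring)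
    convert this using 1
    rw [hv, smul_sub, sub_smul, one_smul]; abel
  -- Two integrations along the segment: first the slope, then the value, is compared with that of
  -- the parabola of curvature -c.
  have h3 : AntitoneOn (fun t : ℝ => fderiv ℝ g (x + t • v) v + c * ‖v‖ ^ 2 * t) (Icc 0 1) := by
    refine antitoneOn_of_hasDerivWithinAt_nonpos (convex_Icc _ _)
      (f' := fun t => fderiv ℝ (fderiv ℝ g) (x + t • v) v v + c * ‖v‖ ^ 2) ?_ ?_ ?_
    · exact fun t _ => ((h2 t).add ((hasDerivAt_id t).const_mul _)).continuousAt.continuousWithinAt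
    · intro t _
      have := (h2 t).add ((hasDerivAt_id t).const_mul (c * ‖v‖ ^ 2))
      rw [mul_one] at this
      exact this.hasDerivWithinAt
    · intro t ht
      have := hc _ (hmem t (interior_subset ht)) v
      linarith
  have h4 : AntitoneOn (fun t : ℝ => g (x + t • v) + c / 2 * ‖v‖ ^ 2 * t ^ 2) (Icc 0 1) := by
    have hd : ∀ t : ℝ, HasDerivAt (fun t : ℝ => g (x + t • v) + c / 2 * ‖v‖ ^ 2 * t ^ 2)
        (fderiv ℝ g (x + t • v) v + c * ‖v‖ ^ 2 * t) t := fun t =>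
      ((h1 t).add (((hasDerivAt_id t).pow 2).const_mul (c / 2 * ‖v‖ ^ 2))).congr_deriv (by
        simp; ring)
    refine antitoneOn_of_hasDerivWithinAt_nonpos (convex_Icc _ _)
      (fun t _ => (hd t).continuousAt.continuousWithinAt)
      (fun t _ => (hd t).hasDerivWithinAt) fun t ht => ?_
    have := h3 (left_mem_Icc.2 zero_le_one) (interior_subset ht) (interior_subset ht).1
    simpa [hcrit] using this
  have h5 := h4 (left_mem_Icc.2 zero_le_one) (right_mem_Icc.2 zero_le_one) zero_le_one
  simp only [one_smul, zero_smul, add_zero, one_pow, mul_one, hv, add_sub_cancel] at h5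
  norm_num at h5
  linarith

lemma le_sub_of_hessian_le {g : Vec m → ℝ} (hg : ContDiff ℝ 2 g) {S : Set (Vec m)}
    (hS : Convex ℝ S) {c : ℝ} (hc : ∀ z ∈ S, ∀ v, hessian g z v ≤ -c * ‖v‖ ^ 2) {x y : Vec m}
    (hx : x ∈ S) (hy : y ∈ S) (hcrit : fderiv ℝ g x = 0) :
    g y ≤ g x - c / 2 * ‖y - x‖ ^ 2 :=
  le_sub_of_fderiv_fderiv_le hg hS (fun z hz v => hessian_eq g z v ▸ hc z hz v) hx hy hcrit

lemma exists_le_neg_near_compact {E : Type*} [PseudoMetricSpace E] [ProperSpace E] {K : Set E}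
    (hK : IsCompact K) {h : E → ℝ} (hh : Continuous h) (hneg : ∀ z ∈ K, h z < 0) :
    ∃ c > 0, ∃ ρ > 0, ∀ z ∈ K, ∀ w, dist w z ≤ ρ → h w ≤ -c := by
  obtain ⟨ρ, hρ, hsub⟩ := hK.exists_cthickening_subset_open (isOpen_lt hh continuous_const) hneg
  obtain ⟨c, hc, hle⟩ := (hK.cthickening (r := ρ)).exists_forall_le' (a := 0)
    hh.neg.continuousOn (fun z hz => neg_pos.2 (hsub hz))
  refine ⟨c, hc, ρ, hρ, fun z hz w hw => ?_⟩
  have := hle w (Metric.mem_cthickening_of_dist_le _ z ρ K hz hw)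
  simp only [Pi.neg_apply] at this
  linarith

/-- `f` and `g` are close together with their Hessians. -/
def C2Close (ε : ℝ) (g f : Vec m → ℝ) : Prop :=
  ∀ x, |g x - f x| ≤ ε ∧ ∀ v, |hessian g x v - hessian f x v| ≤ ε * ‖v‖ ^ 2

lemma C2Close.mono {ε ε' : ℝ} {f g : Vec m → ℝ} (h : C2Close ε g f) (hε : ε ≤ ε') :
    C2Close ε' g f := fun x => ⟨(h x).1.trans hε, fun v => ((h x).2 v).trans (by gcongr)⟩

lemma C2Close.trans {ε ε' : ℝ} {f g h : Vec m → ℝ} (h1 : C2Close ε h g) (h2 : C2Close ε' g f) :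
    C2Close (ε + ε') h f := fun x => by
  refine ⟨(abs_sub_le _ (g x) _).trans (add_le_add (h1 x).1 (h2 x).1), fun v => ?_⟩
  rw [add_mul]
  exact (abs_sub_le _ (hessian g x v) _).trans (add_le_add ((h1 x).2 v) ((h2 x).2 v))

/-- All global maxima of `f` are nondegenerate. -/
def AllMaxNondeg (f : Vec m → ℝ) : Prop := ∀ θ, IsGlobalMax f θ → IsNondegMax f θ

lemma isClosed_isGlobalMax {f : Vec m → ℝ} (hf : Continuous f) :
    IsClosed {x | IsGlobalMax f x} := by
  have : {x | IsGlobalMax f x} = ⋂ y, {x | f y ≤ f x} := by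
    ext x; simp [IsGlobalMax]
  rw [this]
  exact isClosed_iInter fun y => isClosed_le continuous_const hf

set_option maxHeartbeats 1000000 in
-- Maxima in the cube and unit vectors form a compact set on which the Hessian is negative, so it is
-- uniformly negative nearby. Integer translations and homogeneity remove the two normalisations.
lemma exists_hessian_le_near_max {f : Vec m → ℝ} (hf : ContDiff ℝ 2 f) (hp : TorusPeriodic f)
    (hn : AllMaxNondeg f) : ∃ c > 0, ∃ ρ > 0, ∀ y, IsGlobalMax f y → ∀ x, ‖x - y‖ ≤ ρ →
      ∀ v, hessian f x v ≤ -c * ‖v‖ ^ 2 := by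
  have hKc : IsCompact ((cube m ∩ {x | IsGlobalMax f x}) ×ˢ Metric.sphere (0 : Vec m) 1) :=
    (isCompact_cube.inter_right (isClosed_isGlobalMax hf.continuous)).prod (isCompact_sphere _ _)
  obtain ⟨c, hc, ρ, hρ, hle⟩ := exists_le_neg_near_compact hKc (continuous_hessian hf) (by
    rintro ⟨y, v⟩ ⟨⟨_, hy⟩, hv⟩
    exact hn y hy v (norm_ne_zero_iff.1 (by rw [mem_sphere_zero_iff_norm.1 hv]; exact one_ne_zero)))
  refine ⟨c, hc, ρ, hρ, ?_⟩
  have key : ∀ y, IsGlobalMax f y → ∀ x, ‖x - y‖ ≤ ρ → ∀ u : Vec m, ‖u‖ = 1 →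
      hessian f x u ≤ -c := by
    intro y hy x hxy u hu
    obtain ⟨k, hk⟩ := exists_sub_intVec_mem_cube y
    have h2 := hle (y - intVec k, u)
      ⟨⟨hk, hp.isGlobalMax hy (sameAngle_sub_intVec y k)⟩, mem_sphere_zero_iff_norm.2 hu⟩
      (x - intVec k, u) (by
        rw [Prod.dist_eq, dist_self, dist_eq_norm, sub_sub_sub_cancel_right]
        exact max_le hxy hρ.le)
    rwa [hp.hessian (sameAngle_sub_intVec x k)] at h2
  intro y hy x hxy v
  rcases eq_or_ne v 0 with rfl | hv
  · simp [hessian_eq]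
  · have h0 : ‖v‖ ≠ 0 := norm_ne_zero_iff.2 hv
    have h1 : v = ‖v‖ • (‖v‖⁻¹ • v) := by rw [smul_smul, mul_inv_cancel₀ h0, one_smul]
    have h2 := key y hy x hxy (‖v‖⁻¹ • v)
      (by rw [norm_smul, norm_inv, norm_norm, inv_mul_cancel₀ h0])
    calc hessian f x v = ‖v‖ ^ 2 * hessian f x (‖v‖⁻¹ • v) := by
          conv_lhs => rw [h1, hessian_smul]
      _ ≤ ‖v‖ ^ 2 * -c := mul_le_mul_of_nonneg_left h2 (sq_nonneg _)
      _ = _ := mul_comm _ _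

/-- The global maxima of functions close to `f` are close to global maxima of `f`. -/
lemma exists_near_max {f : Vec m → ℝ} (hf : Continuous f) (hp : TorusPeriodic f) {η : ℝ}
    (hη : 0 < η) : ∃ ε > 0, ∀ g : Vec m → ℝ, (∀ x, |g x - f x| ≤ ε) → ∀ x, IsGlobalMax g x →
      ∃ y, IsGlobalMax f y ∧ ‖x - y‖ < η := by
  obtain ⟨y₀, hy₀⟩ := hp.exists_isGlobalMax hf
  have hK : IsCompact (cube m \ Metric.thickening η {x | IsGlobalMax f x}) :=
    isCompact_cube.diff Metric.isOpen_thickening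
  obtain ⟨δ, hδ, hle⟩ := hK.exists_forall_le' (a := 0) (f := fun x => f y₀ - f x)
    (continuous_const.sub hf).continuousOn (by
      intro x hx
      by_contra h
      refine hx.2 (Metric.self_subset_thickening hη _ fun z => ?_)
      have := hy₀ z
      linarith)
  -- Outside the neighbourhood `f` lies at least δ below its maximum, while two errors of δ / 3 can
  -- only make up 2δ / 3.
  refine ⟨δ / 3, by positivity, fun g hg x hx => ?_⟩
  obtain ⟨k, hk⟩ := exists_sub_intVec_mem_cube x
  by_cases h : x - intVec k ∈ Metric.thickening η {x | IsGlobalMax f x}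
  · obtain ⟨z, hz, hd⟩ := Metric.mem_thickening_iff.1 h
    refine ⟨z + intVec k, hp.isGlobalMax hz (sameAngle_add_intVec z k), ?_⟩
    rw [dist_eq_norm] at hd
    rwa [show x - (z + intVec k) = x - intVec k - z by abel]
  · have h1 := hle _ ⟨hk, h⟩
    rw [hp.eq_of_sameAngle (sameAngle_sub_intVec x k)] at h1
    have h2 := abs_le.1 (hg x)
    have h3 := abs_le.1 (hg y₀)
    have h4 := hx y₀
    linarith

/-- Strict concavity on balls around the maxima of `f` survives a C²-small change, and the maxima of
`g` fall into these balls. Two maxima of `g` at small distance share such a ball, where strict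
concavity allows only one critical point of maximal value. -/
lemma exists_stable {f : Vec m → ℝ} (hf : ContDiff ℝ 2 f) (hp : TorusPeriodic f)
    (hn : AllMaxNondeg f) : ∃ ε > 0, ∃ c > 0, ∃ ρ > 0, ∀ g : Vec m → ℝ, ContDiff ℝ 2 g →
      C2Close ε g f → (∀ y, IsGlobalMax f y → ∀ x, ‖x - y‖ ≤ ρ → ∀ v,
        hessian g x v ≤ -c * ‖v‖ ^ 2) ∧
      (∀ x, IsGlobalMax g x → ∀ v, hessian g x v ≤ -c * ‖v‖ ^ 2) ∧
      ∀ x y, IsGlobalMax g x → IsGlobalMax g y → ‖x - y‖ ≤ ρ → x = y := by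
  obtain ⟨c, hc, ρ, hρ, h1⟩ := exists_hessian_le_near_max hf hp hn
  obtain ⟨ε, hε, h2⟩ := exists_near_max hf.continuous hp (half_pos hρ)
  refine ⟨min ε (c / 2), lt_min hε (half_pos hc), c / 2, half_pos hc, ρ / 2, half_pos hρ,
    fun g hg hclose => ?_⟩
  have h3 : ∀ y, IsGlobalMax f y → ∀ x, ‖x - y‖ ≤ ρ → ∀ v,
      hessian g x v ≤ -(c / 2) * ‖v‖ ^ 2 := by
    intro y hy x hx v
    have h4 := h1 y hy x hx v
    have h5 := (le_abs_self _).trans (((hclose.mono (min_le_right _ _)) x).2 v)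
    linarith
  have h4 := h2 g fun x => (hclose x).1.trans (min_le_left _ _)
  refine ⟨fun y hy x hx => h3 y hy x (by linarith), fun x hx => ?_, fun x y hx hy hxy => ?_⟩
  · obtain ⟨y, hy, hlt⟩ := h4 x hx
    exact h3 y hy x (by linarith)
  · obtain ⟨z, hz, hlt⟩ := h4 x hx
    have h5 := le_sub_of_hessian_le hg (convex_closedBall z ρ) (c := c / 2)
      (fun w hw => h3 z hz w (by simpa [dist_eq_norm] using hw)) (x := x) (y := y)
      (by rw [mem_closedBall_iff_norm]; linarith)
      (by
        rw [mem_closedBall_iff_norm]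
        have := norm_sub_le_norm_sub_add_norm_sub y x z
        rw [norm_sub_rev y x] at this
        linarith) hx.fderiv_eq_zero
    rw [hy.eq hx] at h5
    have h6 : ‖y - x‖ ^ 2 ≤ 0 := by
      by_contra h
      push Not at h
      nlinarith
    have h7 : ‖y - x‖ = 0 := by nlinarith [norm_nonneg (y - x)]
    exact (sub_eq_zero.1 (norm_eq_zero.1 h7)).symm

end StaticStability

/-! ### One-parameter families of functions on the torus; openness of goodness. -/

section Families

variable {m : ℕ} {W : Type} [NormedAddCommGroup W] [NormedSpace ℝ W]

/-- A smooth family of functions on the torus, over a curve `P` of parameters. -/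
structure IsFamily (Z : Vec m × W → ℝ) (P : ℝ → W) (a b : ℝ) : Prop where
  contDiff : ContDiff ℝ 4 Z
  periodic : ∀ p, TorusPeriodic fun x => Z (x, p)
  contDiffOn : ContDiffOn ℝ 2 P (Icc a b)
  lt : a < b

/-- The speed at which the value at `θ` moves along the curve. -/
def speed (Z : Vec m × W → ℝ) (P : ℝ → W) (a b : ℝ) (θ : Vec m) (τ : ℝ) : ℝ :=
  fderiv ℝ Z (θ, P τ) (0, derivWithin P (Icc a b) τ)

/-- The global maxima of `F(·, τ)` are nondegenerate, there are at most two of them, and the values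
at two of them move with different speeds. -/
def IsGood (a b : ℝ) (F : Vec m → ℝ → ℝ) (τ : ℝ) : Prop :=
  AllMaxNondeg (F · τ) ∧
  (∀ x y z, IsGlobalMax (F · τ) x → IsGlobalMax (F · τ) y → IsGlobalMax (F · τ) z →
    SameAngle x y ∨ SameAngle x z ∨ SameAngle y z) ∧
  ∀ x y, IsGlobalMax (F · τ) x → IsGlobalMax (F · τ) y → ¬ SameAngle x y →
    derivWithin (F x) (Icc a b) τ ≠ derivWithin (F y) (Icc a b) τ

/-- `IsGood` quantifies over all maxima, with no choice of representatives and no split into regular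
and bifurcation values; this is the form in which openness and transversality are proved. -/
lemma isGood_iff {a b : ℝ} {F : Vec m → ℝ → ℝ} (hF : ∀ τ, TorusPeriodic (F · τ)) {τ : ℝ}
    (hc : Continuous (F · τ)) :
    IsGood a b F τ ↔ IsNondegRegular F τ ∨ IsNondegBifurcation a b F τ := by
  have hsame : ∀ {x y}, SameAngle x y → F y = F x := fun h =>
    funext fun t => (hF t).eq_of_sameAngle h
  have hnd : ∀ {x y}, SameAngle x y → IsNondegMax (F · τ) x → IsNondegMax (F · τ) y :=
    fun h hx v hv => by
      have := hx v hv
      rwa [← (hF τ).hessian h] at this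
  constructor
  · rintro ⟨h1, h2, h3⟩
    obtain ⟨x, hx⟩ := (hF τ).exists_isGlobalMax hc
    by_cases h : ∀ y, IsGlobalMax (F · τ) y → SameAngle x y
    · exact Or.inl ⟨x, hx, h, h1 x hx⟩
    · push Not at h
      obtain ⟨y, hy, hxy⟩ := h
      exact Or.inr ⟨x, y, ⟨hxy, hx, hy, fun z hz => by
        rcases h2 x y z hx hy hz with h | h | h
        · exact absurd h hxy
        · exact Or.inl h
        · exact Or.inr h⟩, h1 x hx, h1 y hy, h3 x y hx hy hxy⟩
  · rintro (⟨x, hx, hu, hd⟩ | ⟨x, y, ⟨hxy, hx, hy, hu⟩, hdx, hdy, hs⟩)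
    · exact ⟨fun z hz => hnd (hu z hz) hd,
        fun z z' _ hz hz' _ => Or.inl ((hu z hz).symm.trans (hu z' hz')),
        fun z z' hz hz' h => absurd ((hu z hz).symm.trans (hu z' hz')) h⟩
    · refine ⟨fun z hz => ?_, fun z z' z'' hz hz' hz'' => ?_, fun z z' hz hz' h => ?_⟩
      · rcases hu z hz with h | h
        · exact hnd h hdx
        · exact hnd h hdy
      · rcases hu z hz with h | h <;> rcases hu z' hz' with h' | h' <;>
          rcases hu z'' hz'' with h'' | h''
        · exact Or.inl (h.symm.trans h')
        · exact Or.inl (h.symm.trans h')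
        · exact Or.inr (Or.inl (h.symm.trans h''))
        · exact Or.inr (Or.inr (h'.symm.trans h''))
        · exact Or.inr (Or.inr (h'.symm.trans h''))
        · exact Or.inr (Or.inl (h.symm.trans h''))
        · exact Or.inl (h.symm.trans h')
        · exact Or.inl (h.symm.trans h')
      · rcases hu z hz with h1 | h1 <;> rcases hu z' hz' with h2 | h2
        · exact absurd (h1.symm.trans h2) h
        · rwa [hsame h1, hsame h2]
        · rw [hsame h1, hsame h2]; exact hs.symm
        · exact absurd (h1.symm.trans h2) h

lemma hasDerivWithinAt_speed {Z : Vec m × W → ℝ} {P : ℝ → W} {a b : ℝ} (hZ : ContDiff ℝ 1 Z)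
    (hP : DifferentiableOn ℝ P (Icc a b)) (θ : Vec m) {τ : ℝ} (hτ : τ ∈ Icc a b) :
    HasDerivWithinAt (fun t => Z (θ, P t)) (speed Z P a b θ τ) (Icc a b) τ := by
  have h1 : HasDerivWithinAt (fun t => (θ, P t)) (0, derivWithin P (Icc a b) τ) (Icc a b) τ :=
    (hasDerivWithinAt_const τ _ θ).prodMk (hP τ hτ).hasDerivWithinAt
  exact ((hZ.differentiable one_ne_zero (θ, P τ)).hasFDerivAt).comp_hasDerivWithinAt τ h1

lemma continuousOn_speed {Z : Vec m × W → ℝ} {P : ℝ → W} {a b : ℝ} (hZ : ContDiff ℝ 1 Z)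
    (hP : ContDiffOn ℝ 1 P (Icc a b)) (hab : a < b) :
    ContinuousOn (fun z : Vec m × ℝ => speed Z P a b z.1 z.2) (univ ×ˢ Icc a b) := by
  unfold speed
  have h1 : ContinuousOn (fun z : Vec m × ℝ => derivWithin P (Icc a b) z.2) (univ ×ˢ Icc a b) :=
    (hP.continuousOn_derivWithin (uniqueDiffOn_Icc hab) le_rfl |>.comp
      continuousOn_snd fun z hz => hz.2)
  have h2 : ContinuousOn (fun z : Vec m × ℝ => P z.2) (univ ×ˢ Icc a b) :=
    hP.continuousOn.comp continuousOn_snd fun z hz => hz.2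
  exact ((hZ.continuous_fderiv one_ne_zero).comp_continuousOn
    (continuousOn_fst.prodMk h2)).clm_apply (continuousOn_const.prodMk h1)

/-- Periodicity replaces ℝᵐ by the compact cube, which gives uniformity in `x`. -/
lemma eventually_norm_sub_le {E : Type*} [SeminormedAddCommGroup E] {G : Vec m × W → E}
    (hG : Continuous G) (hp : ∀ p, TorusPeriodic fun x => G (x, p)) (p₀ : W) {ε : ℝ}
    (hε : 0 < ε) : ∀ᶠ p in 𝓝 p₀, ∀ x, ‖G (x, p) - G (x, p₀)‖ ≤ ε := by
  have h1 : ∀ᶠ p in 𝓝 p₀, ∀ x ∈ cube m, ‖G (x, p) - G (x, p₀)‖ ≤ ε := by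
    refine isCompact_cube.eventually_forall_of_forall_eventually fun x _ => ?_
    have hc : Continuous fun z : W × Vec m => ‖G (z.2, z.1) - G (z.2, p₀)‖ :=
      ((hG.comp (continuous_snd.prodMk continuous_fst)).sub
        (hG.comp (continuous_snd.prodMk continuous_const))).norm
    have := hc.continuousAt.eventually_lt (continuousAt_const (y := ε) (x := (p₀, x)))
      (by simpa using hε)
    exact this.mono fun z hz => hz.le
  filter_upwards [h1] with p hp' x
  obtain ⟨y, hy, hxy⟩ := exists_mem_cube x
  rw [← (hp p).eq_of_sameAngle hxy, ← (hp p₀).eq_of_sameAngle hxy]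
  exact hp' y hy

lemma norm_prod_zero_le {v : Vec m} : ‖((v, 0) : Vec m × W)‖ ≤ ‖v‖ := by
  rw [Prod.norm_def, norm_zero]
  exact max_le le_rfl (norm_nonneg _)

lemma torusPeriodic_iteratedFDeriv {Z : Vec m × W → ℝ} (hp : ∀ p, TorusPeriodic fun x => Z (x, p))
    (k : ℕ) (p : W) : TorusPeriodic fun x => iteratedFDeriv ℝ k Z (x, p) := fun l x => by
  have h := iteratedFDeriv_comp_add_right (𝕜 := ℝ) (f := Z) k (intVec l, 0) (x, p)
  have h' : (fun z => Z (z + (intVec l, 0))) = Z := funext fun z => by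
    have := hp z.2 l z.1
    simpa [Prod.add_def] using this
  rw [h'] at h
  simpa using h.symm

lemma IsFamily.contDiff_slice {Z : Vec m × W → ℝ} {P : ℝ → W} {a b : ℝ} (h : IsFamily Z P a b)
    (p : W) : ContDiff ℝ 4 fun x => Z (x, p) :=
  h.contDiff.comp (contDiff_id.prodMk contDiff_const)

lemma IsFamily.eventually_c2Close {Z : Vec m × W → ℝ} {P : ℝ → W} {a b : ℝ}
    (h : IsFamily Z P a b) (p₀ : W) {ε : ℝ} (hε : 0 < ε) :
    ∀ᶠ p in 𝓝 p₀, C2Close ε (fun x => Z (x, p)) (fun x => Z (x, p₀)) := by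
  have hZ : ContDiff ℝ 2 Z := h.contDiff.of_le (by norm_num)
  filter_upwards [eventually_norm_sub_le h.contDiff.continuous h.periodic p₀ hε,
    eventually_norm_sub_le (hZ.continuous_iteratedFDeriv (m := 2) le_rfl)
      (torusPeriodic_iteratedFDeriv h.periodic 2) p₀ hε] with p h1 h2 x
  refine ⟨h1 x, fun v => ?_⟩
  rw [hessian_slice hZ, hessian_slice hZ]
  refine (ContinuousMultilinearMap.le_opNorm (iteratedFDeriv ℝ 2 Z (x, p) -
    iteratedFDeriv ℝ 2 Z (x, p₀)) (fun _ => (v, 0))).trans ?_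
  refine mul_le_mul (h2 x) ?_ (by positivity) hε.le
  rw [Fin.prod_univ_two, ← sq]
  exact pow_le_pow_left₀ (norm_nonneg _) norm_prod_zero_le 2

/-- Closeness of two families. -/
def FamilyClose (P : ℝ → W) (a b ε : ℝ) (Z' Z : Vec m × W → ℝ) : Prop :=
  ∀ τ ∈ Icc a b, C2Close ε (fun x => Z' (x, P τ)) (fun x => Z (x, P τ)) ∧
    ∀ x, |speed Z' P a b x τ - speed Z P a b x τ| ≤ ε

lemma SameAngle.exists_shift {x y : Vec m} (h : SameAngle x y) (z : Vec m) :
    ∃ z', SameAngle z z' ∧ z' - y = z - x := by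
  obtain ⟨k, rfl⟩ := sameAngle_iff.1 h
  exact ⟨z + intVec k, sameAngle_add_intVec z k, by abel⟩

lemma IsFamily.derivWithin_eq {Z : Vec m × W → ℝ} {P : ℝ → W} {a b : ℝ} (h : IsFamily Z P a b)
    (x : Vec m) {τ : ℝ} (hτ : τ ∈ Icc a b) :
    derivWithin (fun t => Z (x, P t)) (Icc a b) τ = speed Z P a b x τ :=
  (hasDerivWithinAt_speed (h.contDiff.of_le (by norm_num))
    (h.contDiffOn.differentiableOn (by norm_num)) x hτ).derivWithin
    (uniqueDiffOn_Icc h.lt τ hτ)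

lemma IsFamily.speed_eq_of_sameAngle {Z : Vec m × W → ℝ} {P : ℝ → W} {a b : ℝ}
    (h : IsFamily Z P a b) {x y : Vec m} (hxy : SameAngle x y) {τ : ℝ} (hτ : τ ∈ Icc a b) :
    speed Z P a b y τ = speed Z P a b x τ := by
  rw [← h.derivWithin_eq y hτ, ← h.derivWithin_eq x hτ]
  congr 1
  funext t
  exact (h.periodic (P t)).eq_of_sameAngle hxy

/-- Maxima of a nearby function are close to maxima at `τ₀`, and `exists_stable` allows one class of
them near each. With one class at `τ₀` there remains one class nearby; with two there are at most
two, and their speeds stay apart by continuity. -/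
lemma IsFamily.isGood_nhds {Z : Vec m × W → ℝ} {P : ℝ → W} {a b : ℝ}
    (h : IsFamily Z P a b) {τ₀ : ℝ} (hτ₀ : τ₀ ∈ Icc a b)
    (hgood : IsGood a b (fun x t => Z (x, P t)) τ₀) :
    ∃ ε > 0, ∀ᶠ τ in 𝓝[Icc a b] τ₀, ∀ Z' : Vec m × W → ℝ, IsFamily Z' P a b →
      FamilyClose P a b ε Z' Z → IsGood a b (fun x t => Z' (x, P t)) τ := by
  obtain ⟨hnd, h3, hsp⟩ := hgood
  have hf : ContDiff ℝ 2 (fun x => Z (x, P τ₀)) := (h.contDiff_slice _).of_le (by norm_num)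
  obtain ⟨ε₁, hε₁, c, hc, ρ, hρ, hstab⟩ := exists_stable hf (h.periodic _) hnd
  obtain ⟨y₁, hy₁⟩ := (h.periodic (P τ₀)).exists_isGlobalMax hf.continuous
  have hcont : Tendsto P (𝓝[Icc a b] τ₀) (𝓝 (P τ₀)) := h.contDiffOn.continuousOn τ₀ hτ₀
  have hself : ∀ᶠ τ in 𝓝[Icc a b] τ₀, τ ∈ Icc a b := self_mem_nhdsWithin
  -- two maxima close to equivalent points are equivalent
  have hpair : ∀ g : Vec m → ℝ, ContDiff ℝ 2 g → TorusPeriodic g →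
      C2Close ε₁ g (fun x => Z (x, P τ₀)) → ∀ x x' y y', IsGlobalMax g x → IsGlobalMax g x' →
      SameAngle y y' → ‖x - y‖ < ρ / 2 → ‖x' - y'‖ < ρ / 2 → SameAngle x x' := by
    intro g hg hgp hgc x x' y y' hx hx' hyy h1 h2
    obtain ⟨z, hz, hz'⟩ := hyy.exists_shift x
    have h3 := (hstab g hg hgc).2.2 z x' (hgp.isGlobalMax hx hz) hx' (by
      have : z - x' = (z - y') - (x' - y') := by abel
      rw [this]
      refine (norm_sub_le _ _).trans ?_
      rw [hz']
      linarith)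
    rwa [h3] at hz
  have hconc : ∀ ε : ℝ, 0 < ε → ∀ᶠ τ in 𝓝[Icc a b] τ₀, ∀ Z' : Vec m × W → ℝ,
      FamilyClose P a b (ε / 2) Z' Z →
      C2Close ε (fun x => Z' (x, P τ)) (fun x => Z (x, P τ₀)) := by
    intro ε hε
    filter_upwards [hcont.eventually (h.eventually_c2Close (P τ₀) (half_pos hε)), hself]
      with τ h1 hτ Z' hZ'
    have := (hZ' τ hτ).1.trans h1
    rwa [add_halves] at this
  by_cases hall : ∀ y, IsGlobalMax (fun x => Z (x, P τ₀)) y → SameAngle y₁ y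
  · obtain ⟨ε₂, hε₂, hnear⟩ := exists_near_max hf.continuous (h.periodic (P τ₀)) (half_pos hρ)
    refine ⟨min ε₁ ε₂ / 2, by positivity, ?_⟩
    filter_upwards [hconc (min ε₁ ε₂) (lt_min hε₁ hε₂)] with τ h1 Z' hZ' hclose
    have h1 := h1 Z' hclose
    have hg : ContDiff ℝ 2 (fun x => Z' (x, P τ)) := (hZ'.contDiff_slice _).of_le (by norm_num)
    have hstab' := hstab _ hg (h1.mono (min_le_left _ _))
    have hsame : ∀ x y, IsGlobalMax (fun x => Z' (x, P τ)) x →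
        IsGlobalMax (fun x => Z' (x, P τ)) y → SameAngle x y := by
      intro x y hx hy
      obtain ⟨x', hx', hxx'⟩ := hnear _ (fun z => (h1 z).1.trans (min_le_right _ _)) x hx
      obtain ⟨y', hy', hyy'⟩ := hnear _ (fun z => (h1 z).1.trans (min_le_right _ _)) y hy
      exact hpair _ hg (hZ'.periodic _) (h1.mono (min_le_left _ _)) x y x' y' hx hy
        ((hall _ hx').symm.trans (hall _ hy')) hxx' hyy'
    refine ⟨fun x hx v hv => ?_, fun x y z hx hy hz => Or.inl (hsame x y hx hy),
      fun x y hx hy hxy => absurd (hsame x y hx hy) hxy⟩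
    have h2 := hstab'.2.1 x hx v
    have h3 : 0 < c * ‖v‖ ^ 2 := by have := norm_pos_iff.2 hv; positivity
    linarith
  · push Not at hall
    obtain ⟨y₂, hy₂, hy₁₂⟩ := hall
    have hne := hsp y₁ y₂ hy₁ hy₂ hy₁₂
    rw [h.derivWithin_eq _ hτ₀, h.derivWithin_eq _ hτ₀] at hne
    obtain ⟨γ, hγ, hγdef⟩ : ∃ γ > 0, γ = |speed Z P a b y₁ τ₀ - speed Z P a b y₂ τ₀| :=
      ⟨_, abs_pos.2 (sub_ne_zero.2 hne), rfl⟩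
    have hspc : ∀ y, ∃ η > 0, ∀ᶠ τ in 𝓝[Icc a b] τ₀, ∀ x, ‖x - y‖ < η →
        |speed Z P a b x τ - speed Z P a b y τ₀| < γ / 4 := by
      intro y
      have h1 := continuousOn_speed (h.contDiff.of_le (by norm_num))
        (h.contDiffOn.of_le (by norm_num)) h.lt (y, τ₀) ⟨trivial, hτ₀⟩
      rw [ContinuousWithinAt, nhdsWithin_prod_eq, nhdsWithin_univ] at h1
      have h2 := h1 (Metric.ball_mem_nhds _ (show 0 < γ / 4 by positivity))
      rw [mem_map, mem_prod_iff] at h2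
      obtain ⟨s, hs, t, ht, hst⟩ := h2
      obtain ⟨η, hη, hηs⟩ := Metric.mem_nhds_iff.1 hs
      refine ⟨η, hη, ?_⟩
      filter_upwards [ht] with τ hτ x hx
      have := hst (show (x, τ) ∈ s ×ˢ t from ⟨hηs (by simpa [dist_eq_norm] using hx), hτ⟩)
      simpa [Real.dist_eq] using this
    obtain ⟨η₁, hη₁, hs₁⟩ := hspc y₁
    obtain ⟨η₂, hη₂, hs₂⟩ := hspc y₂
    have hη : 0 < min (ρ / 2) (min η₁ η₂) := lt_min (half_pos hρ) (lt_min hη₁ hη₂)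
    obtain ⟨ε₂, hε₂, hnear⟩ := exists_near_max hf.continuous (h.periodic (P τ₀)) hη
    -- Each speed moves by less than γ / 4 with the point and with τ, and by at most γ / 8 with the
    -- family: in total less than 3γ / 4, below the initial gap γ. The half of the first term leaves
    -- room for the motion of τ.
    refine ⟨min (min ε₁ ε₂ / 2) (γ / 8), by positivity, ?_⟩
    filter_upwards [hconc (min ε₁ ε₂) (lt_min hε₁ hε₂), hs₁, hs₂, hself]
      with τ h1 hs₁ hs₂ hτ Z' hZ' hclose
    have h1 := h1 Z' (fun t ht => ⟨(hclose t ht).1.mono (min_le_left _ _), fun x =>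
      ((hclose t ht).2 x).trans (min_le_left _ _)⟩)
    have hg : ContDiff ℝ 2 (fun x => Z' (x, P τ)) := (hZ'.contDiff_slice _).of_le (by norm_num)
    have hstab' := hstab _ hg (h1.mono (min_le_left _ _))
    -- every maximum is equivalent to one close to `y₁` or `y₂`
    have hcls : ∀ x, IsGlobalMax (fun x => Z' (x, P τ)) x → ∃ x', SameAngle x x' ∧
        IsGlobalMax (fun x => Z' (x, P τ)) x' ∧
        (‖x' - y₁‖ < min (ρ / 2) (min η₁ η₂) ∨ ‖x' - y₂‖ < min (ρ / 2) (min η₁ η₂)) := by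
      intro x hx
      obtain ⟨y, hy, hxy⟩ := hnear _ (fun z => (h1 z).1.trans (min_le_right _ _)) x hx
      rcases h3 y₁ y₂ y hy₁ hy₂ hy with h | h | h
      · exact absurd h hy₁₂
      · obtain ⟨z, hz, hzy⟩ := h.symm.exists_shift x
        exact ⟨z, hz, (hZ'.periodic _).isGlobalMax hx hz, Or.inl (hzy ▸ hxy)⟩
      · obtain ⟨z, hz, hzy⟩ := h.symm.exists_shift x
        exact ⟨z, hz, (hZ'.periodic _).isGlobalMax hx hz, Or.inr (hzy ▸ hxy)⟩
    have hsm : ∀ x x' y, IsGlobalMax (fun x => Z' (x, P τ)) x →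
        IsGlobalMax (fun x => Z' (x, P τ)) x' → ‖x - y‖ < min (ρ / 2) (min η₁ η₂) →
        ‖x' - y‖ < min (ρ / 2) (min η₁ η₂) → SameAngle x x' := fun x x' y hx hx' hxy hxy' =>
      hpair _ hg (hZ'.periodic _) (h1.mono (min_le_left _ _)) x x' y y hx hx' (SameAngle.refl y)
        (hxy.trans_le (min_le_left _ _)) (hxy'.trans_le (min_le_left _ _))
    have hspd : ∀ x y, ‖x - y₁‖ < min (ρ / 2) (min η₁ η₂) →
        ‖y - y₂‖ < min (ρ / 2) (min η₁ η₂) → speed Z' P a b x τ ≠ speed Z' P a b y τ := by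
      intro x y hx hy heq
      have e1 := abs_lt.1 (hs₁ x (hx.trans_le ((min_le_right _ _).trans (min_le_left _ _))))
      have e2 := abs_lt.1 (hs₂ y (hy.trans_le ((min_le_right _ _).trans (min_le_right _ _))))
      have e3 := abs_le.1 (((hclose τ hτ).2 x).trans (min_le_right _ _))
      have e4 := abs_le.1 (((hclose τ hτ).2 y).trans (min_le_right _ _))
      have e5 : |speed Z P a b y₁ τ₀ - speed Z P a b y₂ τ₀| < γ :=
        abs_lt.2 ⟨by linarith, by linarith⟩
      exact absurd hγdef e5.ne'
    refine ⟨fun x hx v hv => ?_, fun x y z hx hy hz => ?_, fun x y hx hy hxy => ?_⟩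
    · have h2 := hstab'.2.1 x hx v
      have h3 : 0 < c * ‖v‖ ^ 2 := by have := norm_pos_iff.2 hv; positivity
      linarith
    · obtain ⟨x', hxx, hx', h4⟩ := hcls x hx
      obtain ⟨y', hyy, hy', h5⟩ := hcls y hy
      obtain ⟨z', hzz, hz', h6⟩ := hcls z hz
      have cxy : SameAngle x' y' → SameAngle x y := fun h => hxx.trans (h.trans hyy.symm)
      have cxz : SameAngle x' z' → SameAngle x z := fun h => hxx.trans (h.trans hzz.symm)
      have cyz : SameAngle y' z' → SameAngle y z := fun h => hyy.trans (h.trans hzz.symm)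
      rcases h4 with h4 | h4 <;> rcases h5 with h5 | h5 <;> rcases h6 with h6 | h6
      · exact Or.inl (cxy (hsm _ _ _ hx' hy' h4 h5))
      · exact Or.inl (cxy (hsm _ _ _ hx' hy' h4 h5))
      · exact Or.inr (Or.inl (cxz (hsm _ _ _ hx' hz' h4 h6)))
      · exact Or.inr (Or.inr (cyz (hsm _ _ _ hy' hz' h5 h6)))
      · exact Or.inr (Or.inr (cyz (hsm _ _ _ hy' hz' h5 h6)))
      · exact Or.inr (Or.inl (cxz (hsm _ _ _ hx' hz' h4 h6)))
      · exact Or.inl (cxy (hsm _ _ _ hx' hy' h4 h5))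
      · exact Or.inl (cxy (hsm _ _ _ hx' hy' h4 h5))
    · rw [hZ'.derivWithin_eq _ hτ, hZ'.derivWithin_eq _ hτ]
      obtain ⟨x', hxx, hx', h4⟩ := hcls x hx
      obtain ⟨y', hyy, hy', h5⟩ := hcls y hy
      rw [← hZ'.speed_eq_of_sameAngle hxx hτ, ← hZ'.speed_eq_of_sameAngle hyy hτ]
      rcases h4 with h4 | h4 <;> rcases h5 with h5 | h5
      · exact absurd (hxx.trans ((hsm _ _ _ hx' hy' h4 h5).trans hyy.symm)) hxy
      · exact hspd _ _ h4 h5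
      · exact (hspd _ _ h5 h4).symm
      · exact absurd (hxx.trans ((hsm _ _ _ hx' hy' h4 h5).trans hyy.symm)) hxy

/-- A locally uniform statement over a compact interval holds with a uniform constant. -/
lemma exists_uniform_of_nhdsWithin {a b : ℝ} {Q : ℝ → ℝ → Prop}
    (hmono : ∀ τ ε ε', ε' ≤ ε → Q ε τ → Q ε' τ)
    (h : ∀ τ₀ ∈ Icc a b, ∃ ε > 0, ∀ᶠ τ in 𝓝[Icc a b] τ₀, Q ε τ) :
    ∃ ε > 0, ∀ τ ∈ Icc a b, Q ε τ := by
  have := isCompact_Icc.induction_on (s := Icc a b)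
    (p := fun S => ∃ ε > 0, ∀ τ ∈ S, Q ε τ) ⟨1, one_pos, fun _ h => h.elim⟩
    (fun s t hst ⟨ε, hε, H⟩ => ⟨ε, hε, fun τ hτ => H τ (hst hτ)⟩)
    (fun s t ⟨ε, hε, H⟩ ⟨ε', hε', H'⟩ => ⟨min ε ε', lt_min hε hε', fun τ hτ =>
      hτ.elim (fun h => hmono _ _ _ (min_le_left _ _) (H τ h))
        (fun h => hmono _ _ _ (min_le_right _ _) (H' τ h))⟩)
    (fun τ₀ hτ₀ => by
      obtain ⟨ε, hε, H⟩ := h τ₀ hτ₀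
      exact ⟨_, H, ε, hε, fun τ hτ => hτ⟩)
  exact this

lemma IsFamily.isGood_of_close {Z : Vec m × W → ℝ} {P : ℝ → W} {a b : ℝ}
    (h : IsFamily Z P a b) (hgood : ∀ τ ∈ Icc a b, IsGood a b (fun x t => Z (x, P t)) τ) :
    ∃ ε > 0, ∀ Z' : Vec m × W → ℝ, IsFamily Z' P a b → FamilyClose P a b ε Z' Z →
      ∀ τ ∈ Icc a b, IsGood a b (fun x t => Z' (x, P t)) τ := by
  obtain ⟨ε, hε, H⟩ := exists_uniform_of_nhdsWithin (a := a) (b := b)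
    (Q := fun ε τ => ∀ Z' : Vec m × W → ℝ, IsFamily Z' P a b → FamilyClose P a b ε Z' Z →
      IsGood a b (fun x t => Z' (x, P t)) τ)
    (fun τ ε ε' hle hQ Z' hZ' hcl => hQ Z' hZ' fun t ht =>
      ⟨(hcl t ht).1.mono hle, fun x => ((hcl t ht).2 x).trans hle⟩)
    (fun τ₀ hτ₀ => h.isGood_nhds hτ₀ (hgood τ₀ hτ₀))
  exact ⟨ε, hε, fun Z' hZ' hcl τ hτ => H τ hτ Z' hZ' hcl⟩

end Families

/-! ### Avoiding zeros of affine families of maps by a dimension count. -/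

section Transversality

variable {E F : Type} [NormedAddCommGroup E] [NormedSpace ℝ E] [FiniteDimensional ℝ E]
  [NormedAddCommGroup F] [NormedSpace ℝ F] [FiniteDimensional ℝ F]
  {ι : Type} [Fintype ι]

/-- The linear combination `ξ ↦ ∑ k, ξ k • y k`, as a continuous linear map. -/
def combL (y : ι → F) : (ι → ℝ) →L[ℝ] F :=
  ∑ k, (ContinuousLinearMap.proj (R := ℝ) (φ := fun _ : ι => ℝ) k).smulRight (y k)

lemma combL_apply (y : ι → F) (ξ : ι → ℝ) : combL y ξ = ∑ k, ξ k • y k := by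
  simp [combL, sum_apply]

lemma range_combL (y : ι → F) : (combL y : (ι → ℝ) →ₗ[ℝ] F).range = Submodule.span ℝ (range y) := by
  rw [← Fintype.range_linearCombination]
  congr 1
  ext ξ
  simp [combL_apply, Fintype.linearCombination_apply]

lemma contDiffOn_combL {J : ι → E → F} {S : Set E} (hJ : ∀ k, ContDiffOn ℝ 1 (J k) S) :
    ContDiffOn ℝ 1 (fun z => combL fun k => J k z) S := by
  unfold combL
  exact ContDiffOn.sum fun k _ => contDiffOn_const.smulRight (hJ k)

lemma continuousOn_combL {J : ι → E → F} {S : Set E} (hJ : ∀ k, ContinuousOn (J k) S) :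
    ContinuousOn (fun z => combL fun k => J k z) S := by
  unfold combL
  refine continuousOn_finsetSum _ fun k _ => ?_
  exact ((ContinuousLinearMap.smulRightL ℝ (ι → ℝ) F
    (ContinuousLinearMap.proj (R := ℝ) (φ := fun _ : ι => ℝ) k)).continuous).comp_continuousOn (hJ k)

/-- Near a point where the `J k` span, a fixed right inverse makes the combination invertible. -/
lemma exists_isUnit_comp_combL {J : ι → E → F} {S : Set E} (hJ : ∀ k, ContinuousOn (J k) S)
    {z₀ : E} (hz₀ : z₀ ∈ S) (hspan : Submodule.span ℝ (range fun k => J k z₀) = ⊤) :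
    ∃ B : F →L[ℝ] (ι → ℝ), ∃ r > 0, ∀ z ∈ S ∩ Metric.ball z₀ r,
      IsUnit ((combL fun k => J k z).comp B) := by
  obtain ⟨B, hB⟩ := ContinuousLinearMap.exists_rightInverse_of_surjective
    (combL fun k => J k z₀) (by rw [range_combL, hspan])
  have hc : ContinuousOn (fun z => (combL fun k => J k z).comp B) S :=
    (continuousOn_combL hJ).clm_comp continuousOn_const
  have h1 : ∀ᶠ z in 𝓝[S] z₀, IsUnit ((combL fun k => J k z).comp B) := by
    refine (hc z₀ hz₀).eventually (Units.isOpen.mem_nhds ?_)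
    beta_reduce
    rw [hB]
    exact isUnit_one
  obtain ⟨r, hr, h2⟩ := Metric.mem_nhdsWithin_iff.1 h1
  exact ⟨B, r, hr, fun z hz => h2 ⟨hz.2, hz.1⟩⟩

/-- Write A(z) for the combination map and ξ = ξ₀ + B η. Since A(z) B is invertible, a zero at `z`
forces η = -(A(z) B)⁻¹ (L₀(z) + A(z) ξ₀), a C¹ function of `z`. Its image has dense complement as
dim E < dim F, so arbitrarily small η avoid it; no Sard theorem is needed. -/
lemma dense_forall_ne_zero_ball {J : ι → E → F} {L₀ : E → F} {S : Set E} (hS : Convex ℝ S)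
    (hL : ContDiffOn ℝ 1 L₀ S) (hJ : ∀ k, ContDiffOn ℝ 1 (J k) S)
    (hdim : finrank ℝ E < finrank ℝ F) {z₀ : E} (hz₀ : z₀ ∈ S)
    (hspan : Submodule.span ℝ (range fun k => J k z₀) = ⊤) :
    ∃ r > 0, Dense {ξ : ι → ℝ | ∀ z ∈ S ∩ Metric.ball z₀ r, L₀ z + ∑ k, ξ k • J k z ≠ 0} := by
  obtain ⟨B, r, hr, hunit⟩ := exists_isUnit_comp_combL (fun k => (hJ k).continuousOn) hz₀ hspan
  refine ⟨r, hr, ?_⟩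
  rw [dense_iff_inter_open]
  rintro U hU ⟨ξ₀, hξ₀⟩
  have hA := contDiffOn_combL hJ
  -- The map from a point `z` to the only η for which `z` can be a zero.
  have hh : ContDiffOn ℝ 1 (fun z => -(Ring.inverse ((combL fun k => J k z).comp B))
      (L₀ z + combL (fun k => J k z) ξ₀)) (S ∩ Metric.ball z₀ r) := by
    refine ContDiffOn.clm_apply (ContDiffOn.neg ?_) ((hL.add (hA.clm_apply contDiffOn_const)).mono
      inter_subset_left)
    intro z hz
    obtain ⟨u, hu⟩ := hunit z hz
    have h1 : ContDiffAt ℝ 1 (Ring.inverse : (F →L[ℝ] F) → (F →L[ℝ] F))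
        ((combL fun k => J k z).comp B) := by
      rw [← hu]
      exact contDiffAt_ringInverse ℝ u
    exact h1.comp_contDiffWithinAt z (((hA.clm_comp contDiffOn_const).mono inter_subset_left) z hz)
  have hdense := hh.dense_compl_image_of_dimH_lt_finrank (hS.inter (convex_ball z₀ r)) le_rfl
    (((dimH_mono (subset_univ _)).trans (Real.dimH_univ_eq_finrank E).le).trans_lt
      (Nat.cast_lt.2 hdim))
  have hV : IsOpen {η : F | ξ₀ + B η ∈ U} :=
    hU.preimage (continuous_const.add B.continuous)
  obtain ⟨η, hηU, hη⟩ := hdense.inter_open_nonempty _ hV ⟨0, by simpa using hξ₀⟩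
  refine ⟨ξ₀ + B η, hηU, fun z hz hzero => hη ⟨z, hz, ?_⟩⟩
  obtain ⟨u, hu⟩ := hunit z hz
  rw [← combL_apply, map_add, ← add_assoc] at hzero
  have h1 : L₀ z + combL (fun k => J k z) ξ₀ = -((combL fun k => J k z).comp B) η :=
    eq_neg_of_add_eq_zero_left hzero
  have h2 : Ring.inverse ((combL fun k => J k z).comp B) (((combL fun k => J k z).comp B) η) = η :=
    congrArg (fun T : F →L[ℝ] F => T η) (Ring.inverse_mul_cancel _ (hunit z hz))
  beta_reduce
  rw [h1, map_neg, neg_neg, h2]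

/-- The bad parameters are the projection, along the compact `K`, of a closed set. -/
lemma isOpen_forall_ne_zero {J : ι → E → F} {L₀ : E → F} {K : Set E} (hK : IsCompact K)
    (hL : ContinuousOn L₀ K) (hJ : ∀ k, ContinuousOn (J k) K) :
    IsOpen {ξ : ι → ℝ | ∀ z ∈ K, L₀ z + ∑ k, ξ k • J k z ≠ 0} := by
  have : CompactSpace K := isCompact_iff_compactSpace.1 hK
  have hcl : IsClosed {q : (ι → ℝ) × K | L₀ q.2 + ∑ k, q.1 k • J k q.2 = 0} := by
    refine isClosed_eq ?_ continuous_const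
    refine (hL.domRestrict.comp continuous_snd).add (continuous_finsetSum _ fun k _ => ?_)
    exact ((continuous_apply k).comp continuous_fst).smul
      ((hJ k).domRestrict.comp continuous_snd)
  have h2 := isClosedMap_fst_of_compactSpace (X := ι → ℝ) (Y := K) _ hcl
  convert h2.isOpen_compl using 1
  ext ξ
  constructor
  · rintro h ⟨⟨ξ', z⟩, hz, rfl⟩
    exact h z z.2 hz
  · intro h z hz h0
    exact h ⟨(ξ, ⟨z, hz⟩), h0, rfl⟩

/-- Generic transversality to zero for affine families of maps. -/
lemma isOpen_and_dense_forall_ne_zero {J : ι → E → F} {L₀ : E → F} {S : Set E} (hS : Convex ℝ S)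
    (hL : ContDiffOn ℝ 1 L₀ S) (hJ : ∀ k, ContDiffOn ℝ 1 (J k) S)
    (hdim : finrank ℝ E < finrank ℝ F) {K : Set E} (hK : IsCompact K) (hKS : K ⊆ S)
    (hspan : ∀ z ∈ K, Submodule.span ℝ (range fun k => J k z) = ⊤) :
    IsOpen {ξ : ι → ℝ | ∀ z ∈ K, L₀ z + ∑ k, ξ k • J k z ≠ 0} ∧
      Dense {ξ : ι → ℝ | ∀ z ∈ K, L₀ z + ∑ k, ξ k • J k z ≠ 0} := by
  refine ⟨isOpen_forall_ne_zero hK (hL.continuousOn.mono hKS)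
    fun k => (hJ k).continuousOn.mono hKS, ?_⟩
  have : ∀ z₀ : E, ∃ r > 0, z₀ ∈ K → Dense {ξ : ι → ℝ | ∀ z ∈ S ∩ Metric.ball z₀ r,
      L₀ z + ∑ k, ξ k • J k z ≠ 0} := fun z₀ => by
    by_cases h : z₀ ∈ K
    · obtain ⟨r, hr, hd⟩ := dense_forall_ne_zero_ball hS hL hJ hdim (hKS h) (hspan z₀ h)
      exact ⟨r, hr, fun _ => hd⟩
    · exact ⟨1, one_pos, fun h' => absurd h' h⟩
  choose r hr hd using this
  -- Closed balls of half the radius make the pieces compact, so each good set is open as well as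
  -- dense and finitely many can be intersected.
  obtain ⟨t, htK, hcov⟩ := hK.elim_nhds_subcover (fun z => Metric.closedBall z (r z / 2))
    fun z _ => Metric.closedBall_mem_nhds z (half_pos (hr z))
  have hsub : ∀ z, K ∩ Metric.closedBall z (r z / 2) ⊆ S ∩ Metric.ball z (r z) := fun z =>
    inter_subset_inter hKS (Metric.closedBall_subset_ball (half_lt_self (hr z)))
  have hfin : Dense (⋂ z₀ ∈ (t : Set E), {ξ : ι → ℝ | ∀ z ∈ K ∩ Metric.closedBall z₀ (r z₀ / 2),
      L₀ z + ∑ k, ξ k • J k z ≠ 0}) := by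
    refine dense_biInter_of_isOpen (fun z₀ hz₀ => ?_) t.countable_toSet fun z₀ hz₀ => ?_
    · exact isOpen_forall_ne_zero (hK.inter_right Metric.isClosed_closedBall)
        (hL.continuousOn.mono (inter_subset_left.trans hKS))
        fun k => (hJ k).continuousOn.mono (inter_subset_left.trans hKS)
    · exact (hd z₀ (htK z₀ hz₀)).mono fun ξ (hξ : ∀ z ∈ _, _) z hz => hξ z (hsub z₀ hz)
  refine hfin.mono fun ξ hξ z hz => ?_
  obtain ⟨z₀, hz₀, hz'⟩ := mem_iUnion₂.1 (hcov hz)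
  exact mem_iInter₂.1 hξ z₀ hz₀ z ⟨hz, hz'⟩

/-- If arbitrary values can be prescribed at every point of a compact set, then finitely many
functions suffice to span at all points. -/
lemma exists_finset_span_eq_top {T : Type} {J : T → E → F} {K : Set E} (hK : IsCompact K)
    (hJ : ∀ t, ContinuousOn (J t) K) (hsurj : ∀ z ∈ K, ∀ y, ∃ t, J t z = y) :
    ∃ s : Finset T, ∀ s' : Finset T, s ⊆ s' → ∀ z ∈ K,
      Submodule.span ℝ (range fun k : s' => J k z) = ⊤ := by
  classical
  have hmono : ∀ s s' : Finset T, s ⊆ s' → ∀ z, Submodule.span ℝ (range fun k : s => J k z) = ⊤ →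
      Submodule.span ℝ (range fun k : s' => J k z) = ⊤ := by
    intro s s' hss z h
    refine top_le_iff.1 (h ▸ Submodule.span_mono ?_)
    rintro _ ⟨k, rfl⟩
    exact ⟨⟨k, hss k.2⟩, rfl⟩
  have key := hK.induction_on (p := fun A => ∃ s : Finset T, ∀ z ∈ A ∩ K,
      Submodule.span ℝ (range fun k : s => J k z) = ⊤) ⟨∅, fun _ h => h.1.elim⟩
    (fun A A' hAA ⟨s, hs⟩ => ⟨s, fun z hz => hs z ⟨hAA hz.1, hz.2⟩⟩)
    (fun A A' ⟨s, hs⟩ ⟨s', hs'⟩ => ⟨s ∪ s', fun z hz => hz.1.elim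
      (fun h => hmono s _ Finset.subset_union_left z (hs z ⟨h, hz.2⟩))
      (fun h => hmono s' _ Finset.subset_union_right z (hs' z ⟨h, hz.2⟩))⟩)
    (fun z₀ hz₀ => by
      choose t ht using hsurj z₀ hz₀
      set b := finBasis ℝ F
      set s : Finset T := Finset.univ.image fun i => t (b i) with hs
      have hspan : Submodule.span ℝ (range fun k : s => J k z₀) = ⊤ := by
        refine top_le_iff.1 (b.span_eq ▸ Submodule.span_mono ?_)
        rintro _ ⟨i, rfl⟩
        exact ⟨⟨t (b i), Finset.mem_image_of_mem _ (Finset.mem_univ i)⟩, ht _⟩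
      obtain ⟨B, r, hr, hunit⟩ := exists_isUnit_comp_combL (J := fun k : s => J k)
        (fun k => hJ k) hz₀ hspan
      refine ⟨Metric.ball z₀ r, mem_nhdsWithin_of_mem_nhds (Metric.ball_mem_nhds z₀ hr), s,
        fun z hz => ?_⟩
      rw [← range_combL, LinearMap.range_eq_top]
      intro y
      have h1 : ((combL fun k : s => J k z).comp B) (Ring.inverse ((combL fun k : s => J k z).comp B) y)
          = y :=
        congrArg (fun T : F →L[ℝ] F => T y) (Ring.mul_inverse_cancel _ (hunit z ⟨hz.2, hz.1⟩))
      exact ⟨_, h1⟩)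
  obtain ⟨s, hs⟩ := key
  exact ⟨s, fun s' hss z hz => hmono s s' hss z (hs z ⟨hz, hz⟩)⟩

end Transversality

/-! ### Periodic smooth functions with prescribed germs. -/

section Germs

/-- A smooth cutoff, equal to `1` for `s ≤ 1` and to `0` for `s ≥ 2`. -/
def cutoff (s : ℝ) : ℝ := Real.smoothTransition (2 - s)

lemma contDiff_cutoff : ContDiff ℝ ∞ cutoff :=
  Real.smoothTransition.contDiff.comp (contDiff_const.sub contDiff_id)

lemma cutoff_eq_one {s : ℝ} (h : s ≤ 1) : cutoff s = 1 :=
  Real.smoothTransition.one_of_one_le (by linarith)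

lemma cutoff_eq_zero {s : ℝ} (h : 2 ≤ s) : cutoff s = 0 :=
  Real.smoothTransition.zero_of_nonpos (by linarith)

/-- A smooth `1`-periodic function that agrees with the identity near `0`. -/
def periodicId (y : ℝ) : ℝ :=
  cutoff (4 * (1 - Real.cos (2 * Real.pi * y))) *
    (Real.arcsin (Real.sin (2 * Real.pi * y)) / (2 * Real.pi))

lemma periodicId_add_int (y : ℝ) (k : ℤ) : periodicId (y + k) = periodicId y := by
  unfold periodicId
  have : 2 * Real.pi * (y + k) = 2 * Real.pi * y + k * (2 * Real.pi) := by ring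
  rw [this, Real.cos_add_int_mul_two_pi, Real.sin_add_int_mul_two_pi]

lemma periodicId_eventuallyEq : periodicId =ᶠ[𝓝 0] id := by
  have h1 : ∀ᶠ y : ℝ in 𝓝 0, 4 * (1 - Real.cos (2 * Real.pi * y)) < 1 :=
    (by fun_prop : Continuous fun y : ℝ => 4 * (1 - Real.cos (2 * Real.pi * y))).continuousAt.eventually_lt
      continuousAt_const (by simp)
  have h2 : ∀ᶠ y : ℝ in 𝓝 0, 2 * Real.pi * y < Real.pi / 2 :=
    (by fun_prop : Continuous fun y : ℝ => 2 * Real.pi * y).continuousAt.eventually_lt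
      continuousAt_const (by simp [Real.pi_pos])
  have h3 : ∀ᶠ y : ℝ in 𝓝 0, -(Real.pi / 2) < 2 * Real.pi * y :=
    continuousAt_const.eventually_lt
      (by fun_prop : Continuous fun y : ℝ => 2 * Real.pi * y).continuousAt (by simp [Real.pi_pos])
  filter_upwards [h1, h2, h3] with y h1 h2 h3
  unfold periodicId
  rw [cutoff_eq_one h1.le, Real.arcsin_sin h3.le h2.le]
  have := Real.pi_pos.ne'
  simp only [id]
  field_simp

lemma contDiff_periodicId : ContDiff ℝ ∞ periodicId := by
  rw [contDiff_iff_contDiffAt]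
  intro y
  -- If the cosine is below 1/2 the cutoff argument exceeds 2 and the function vanishes nearby;
  -- otherwise the sine is not ±1, where arcsin fails to be smooth.
  by_cases h : Real.cos (2 * Real.pi * y) < 1 / 2
  · have h1 : ∀ᶠ z in 𝓝 y, Real.cos (2 * Real.pi * z) < 1 / 2 :=
      (by fun_prop : Continuous fun z : ℝ => Real.cos (2 * Real.pi * z)).continuousAt.eventually_lt
        continuousAt_const h
    have h2 : periodicId =ᶠ[𝓝 y] fun _ => 0 := by
      filter_upwards [h1] with z hz
      unfold periodicId
      rw [cutoff_eq_zero (by linarith), zero_mul]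
    exact contDiffAt_const.congr_of_eventuallyEq h2
  · have hs := Real.sin_sq_add_cos_sq (2 * Real.pi * y)
    unfold periodicId
    have h1 : ContDiffAt ℝ ∞ Real.arcsin (Real.sin (2 * Real.pi * y)) :=
      Real.contDiffAt_arcsin (fun h0 => by rw [h0] at hs; nlinarith)
        (fun h0 => by rw [h0] at hs; nlinarith)
    have h2 : ContDiffAt ℝ ∞ (fun y : ℝ => 2 * Real.pi * y) y :=
      contDiffAt_const.mul contDiffAt_id
    refine ContDiffAt.mul ?_ ((h1.comp y (Real.contDiff_sin.contDiffAt.comp y h2)).div_const _)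
    exact contDiff_cutoff.contDiffAt.comp y
      (contDiffAt_const.mul (contDiffAt_const.sub (Real.contDiff_cos.contDiffAt.comp y h2)))

variable {m : ℕ}

/-- A smooth periodic measure of the distance to the lattice. -/
def latticeDist (x : Vec m) : ℝ := ∑ i, (1 - Real.cos (2 * Real.pi * x i))

lemma contDiff_coord {m : ℕ} (i : Fin m) : ContDiff ℝ ∞ (fun x : Vec m => x i) :=
  (EuclideanSpace.proj (𝕜 := ℝ) i).contDiff

lemma contDiff_latticeDist : ContDiff ℝ ∞ (latticeDist (m := m)) := by
  unfold latticeDist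
  exact ContDiff.sum fun i _ => contDiff_const.sub
    (Real.contDiff_cos.comp (contDiff_const.mul (contDiff_coord i)))

lemma latticeDist_add_intVec (x : Vec m) (k : Fin m → ℤ) :
    latticeDist (x + intVec k) = latticeDist x := by
  unfold latticeDist
  refine Finset.sum_congr rfl fun i _ => ?_
  have : 2 * Real.pi * (x + intVec k) i = 2 * Real.pi * x i + k i * (2 * Real.pi) := by
    simp; ring
  rw [this, Real.cos_add_int_mul_two_pi]

lemma latticeDist_nonneg (x : Vec m) : 0 ≤ latticeDist x :=
  Finset.sum_nonneg fun _ _ => sub_nonneg.2 (Real.cos_le_one _)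

lemma latticeDist_pos {x y : Vec m} (h : ¬ SameAngle y x) : 0 < latticeDist (x - y) := by
  refine lt_of_le_of_ne (latticeDist_nonneg _) fun h0 => h ?_
  have h1 := (Finset.sum_eq_zero_iff_of_nonneg
    (fun i _ => sub_nonneg.2 (Real.cos_le_one (2 * Real.pi * (x - y) i)))).1 h0.symm
  have h2 : ∀ i, ∃ k : ℤ, x i = y i + k := fun i => by
    obtain ⟨k, hk⟩ := (Real.cos_eq_one_iff _).1 (sub_eq_zero.1 (h1 i (Finset.mem_univ i))).symm
    refine ⟨k, ?_⟩
    have hpi := Real.pi_pos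
    have h3 : (2 * Real.pi) * (x i - y i - k) = 0 := by
      have : (x - y) i = x i - y i := rfl
      rw [this] at hk
      linarith
    rcases mul_eq_zero.1 h3 with h3 | h3
    · linarith
    · linarith
  choose k hk using h2
  exact ⟨k, hk⟩

lemma latticeDist_zero : latticeDist (0 : Vec m) = 0 := by simp [latticeDist]

/-- Periodic smooth functions. -/
structure IsTorusSmooth (φ : Vec m → ℝ) : Prop where
  contDiff : ContDiff ℝ ∞ φ
  periodic : TorusPeriodic φ

lemma IsTorusSmooth.add {φ ψ : Vec m → ℝ} (hφ : IsTorusSmooth φ) (hψ : IsTorusSmooth ψ) :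
    IsTorusSmooth (fun x => φ x + ψ x) :=
  ⟨hφ.contDiff.add hψ.contDiff, fun k x => by rw [hφ.periodic k, hψ.periodic k]⟩

lemma isTorusSmooth_const (c : ℝ) : IsTorusSmooth (fun _ : Vec m => c) :=
  ⟨contDiff_const, fun _ _ => rfl⟩

/-- Every germ of a smooth function is the germ of a periodic smooth function that vanishes near
finitely many given other points of the torus. -/
lemma exists_isTorusSmooth_germ {g : Vec m → ℝ} (hg : ContDiff ℝ ∞ g) (x : Vec m)
    (s : Finset (Vec m)) (hs : ∀ y ∈ s, ¬ SameAngle x y) :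
    ∃ φ, IsTorusSmooth φ ∧ φ =ᶠ[𝓝 x] g ∧ ∀ y ∈ s, φ =ᶠ[𝓝 y] 0 := by
  -- The factor 2 is the threshold past which `cutoff` vanishes, so the bump dies near every point
  -- of `s`.
  obtain ⟨η, hη, hηs⟩ : ∃ η > 0, ∀ y ∈ s, 2 * η < latticeDist (y - x) := by
    induction s using Finset.induction_on with
    | empty => exact ⟨1, one_pos, by simp⟩
    | insert a s _ ih =>
      obtain ⟨η, hη, h⟩ := ih fun y hy => hs y (Finset.mem_insert_of_mem hy)
      have ha := latticeDist_pos (hs a (Finset.mem_insert_self a s))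
      refine ⟨min η (latticeDist (a - x) / 4), lt_min hη (by positivity), fun y hy => ?_⟩
      rcases Finset.mem_insert.1 hy with rfl | hy
      · have := min_le_right η (latticeDist (y - x) / 4)
        linarith
      · have := min_le_left η (latticeDist (a - x) / 4)
        have := h y hy
        linarith
  have hper : ContDiff ℝ ∞ (fun z : Vec m => (WithLp.toLp 2 fun i => periodicId ((z - x) i) : Vec m)) := by
    rw [contDiff_euclidean]
    exact fun i => contDiff_periodicId.comp ((contDiff_coord i).comp (contDiff_id.sub contDiff_const))
  have hdist : ContDiff ℝ ∞ (fun z : Vec m => latticeDist (z - x) / η) :=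
    (contDiff_latticeDist.comp (contDiff_id.sub contDiff_const)).div_const _
  -- Replacing z - x by its periodised coordinates makes g periodic without changing it near `x`;
  -- the cutoff then localises it.
  refine ⟨fun z => cutoff (latticeDist (z - x) / η) *
    g (x + WithLp.toLp 2 fun i => periodicId ((z - x) i)), ⟨?_, fun k z => ?_⟩, ?_, fun y hy => ?_⟩
  · exact (contDiff_cutoff.comp hdist).mul (hg.comp (contDiff_const.add hper))
  · have h1 : z + intVec k - x = (z - x) + intVec k := by abel
    have h2 : ∀ i, periodicId (((z - x) + intVec k) i) = periodicId ((z - x) i) := fun i => by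
      rw [PiLp.add_apply, intVec_apply, periodicId_add_int]
    simp only [h1, latticeDist_add_intVec, h2]
  · have h1 : ∀ᶠ z in 𝓝 x, latticeDist (z - x) / η < 1 :=
      hdist.continuous.continuousAt.eventually_lt continuousAt_const
        (by simp [latticeDist_zero])
    have h2 : ∀ᶠ z in 𝓝 x, ∀ i, periodicId ((z - x) i) = (z - x) i := by
      rw [eventually_all]
      intro i
      have : Tendsto (fun z : Vec m => (z - x) i) (𝓝 x) (𝓝 0) := by
        have := ((contDiff_coord i).continuous.comp (continuous_id.sub continuous_const)).tendsto
          (f := fun z : Vec m => (z - x) i) x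
        simpa using this
      exact this.eventually periodicId_eventuallyEq
    filter_upwards [h1, h2] with z h1 h2
    have h3 : (WithLp.toLp 2 fun i => periodicId ((z - x) i) : Vec m) = z - x := by
      ext i; exact h2 i
    rw [cutoff_eq_one h1.le, one_mul, h3, add_sub_cancel]
  · have h1 : ∀ᶠ z in 𝓝 y, 2 < latticeDist (z - x) / η :=
      continuousAt_const.eventually_lt hdist.continuous.continuousAt
        (by rw [lt_div_iff₀ hη]; exact hηs y hy)
    filter_upwards [h1] with z h1
    rw [cutoff_eq_zero h1.le, zero_mul]
    rfl

end Germs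

/-! ### Necessary conditions up to third order at a maximum. -/

section HigherOrderMaxima

lemma eventually_pos_of_hasDerivAt {g : ℝ → ℝ} {c : ℝ} (h0 : g 0 = 0) (hg : HasDerivAt g c 0)
    (hc : 0 < c) : ∀ᶠ t in 𝓝[>] (0 : ℝ), 0 < g t := by
  have h1 := (hasDerivAt_iff_tendsto_slope.1 hg).eventually (lt_mem_nhds hc)
  have h2 : ∀ᶠ t in 𝓝[>] (0 : ℝ), 0 < slope g 0 t :=
    h1.filter_mono (nhdsWithin_mono _ fun t ht => ne_of_gt ht)
  filter_upwards [h2, self_mem_nhdsWithin] with t ht ht0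
  rw [slope_def_field, h0, sub_zero, sub_zero] at ht
  exact (div_pos_iff_of_pos_right ht0).1 ht

/-- This lifts positivity to the right of 0 by one order of differentiation; iterated, it lets a
positive higher derivative contradict maximality. -/
lemma eventually_pos_of_deriv_pos {g g' : ℝ → ℝ} (h0 : g 0 = 0) (hg : ∀ t, HasDerivAt g (g' t) t)
    (hg' : ∀ᶠ t in 𝓝[>] (0 : ℝ), 0 < g' t) : ∀ᶠ t in 𝓝[>] (0 : ℝ), 0 < g t := by
  obtain ⟨δ, hδ, h⟩ := mem_nhdsGT_iff_exists_Ioo_subset.1 hg'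
  filter_upwards [Ioo_mem_nhdsGT hδ] with t ht
  have hmono : StrictMonoOn g (Icc 0 t) := by
    refine strictMonoOn_of_deriv_pos (convex_Icc _ _)
      (fun s _ => (hg s).continuousAt.continuousWithinAt) fun s hs => ?_
    rw [interior_Icc] at hs
    rw [(hg s).deriv]
    exact h ⟨hs.1, hs.2.trans ht.2⟩
  have := hmono (left_mem_Icc.2 ht.1.le) (right_mem_Icc.2 ht.1.le) ht.1
  rwa [h0] at this

variable {X E : Type*} [NormedAddCommGroup X] [NormedSpace ℝ X]
  [NormedAddCommGroup E] [NormedSpace ℝ E]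

lemma hasDerivAt_comp_line {F : Type*} [NormedAddCommGroup F] [NormedSpace ℝ F] {G : E → F}
    (hG : Differentiable ℝ G) (z u : E) (t : ℝ) :
    HasDerivAt (fun t : ℝ => G (z + t • u)) (fderiv ℝ G (z + t • u) u) t := by
  have h2 : HasDerivAt (fun s : ℝ => z + s • u) u t := by
    simpa using ((hasDerivAt_id t).smul_const u).const_add z
  exact (hG (z + t • u)).hasFDerivAt.comp_hasDerivAt t h2

lemma hasDerivAt_apply_line {F : Type*} [NormedAddCommGroup F] [NormedSpace ℝ F]
    {G : E → E →L[ℝ] F} (hG : Differentiable ℝ G) (z u : E) (t : ℝ) :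
    HasDerivAt (fun t : ℝ => G (z + t • u) u) (fderiv ℝ G (z + t • u) u u) t :=
  (ContinuousLinearMap.apply ℝ F u).hasFDerivAt.comp_hasDerivAt t (hasDerivAt_comp_line hG z u t)

/-- First, second and third order conditions at a maximum along an affine subspace. -/
lemma max_conditions {Z : E → ℝ} (hZ : ContDiff ℝ 3 Z) (ι : X →L[ℝ] E) {z : E}
    (hmax : ∀ x, Z (z + ι x) ≤ Z z) :
    (∀ x, fderiv ℝ Z z (ι x) = 0) ∧ (∀ x, fderiv ℝ (fderiv ℝ Z) z (ι x) (ι x) ≤ 0) ∧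
    ∀ v, 0 ≤ fderiv ℝ (fderiv ℝ Z) z (ι v) (ι v) →
      (∀ x, fderiv ℝ (fderiv ℝ Z) z (ι v) (ι x) = 0) ∧
      fderiv ℝ (fderiv ℝ (fderiv ℝ Z)) z (ι v) (ι v) (ι v) = 0 := by
  have hd0 : Differentiable ℝ Z := hZ.differentiable (by norm_num)
  have hC1 : ContDiff ℝ 2 (fderiv ℝ Z) := hZ.fderiv_right (by norm_num)
  have hd1 : Differentiable ℝ (fderiv ℝ Z) := hC1.differentiable (by norm_num)
  have hC2 : ContDiff ℝ 1 (fderiv ℝ (fderiv ℝ Z)) := hC1.fderiv_right (by norm_num)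
  have hd2 : Differentiable ℝ (fderiv ℝ (fderiv ℝ Z)) := hC2.differentiable (by norm_num)
  have hline : ∀ (x : X) (t : ℝ), Z (z + t • ι x) - Z z ≤ 0 := fun x t => by
    rw [← map_smul]
    exact sub_nonpos.2 (hmax _)
  have h1 : ∀ x, fderiv ℝ Z z (ι x) = 0 := fun x => by
    have hm : IsLocalMax (fun t : ℝ => Z (z + t • ι x)) 0 :=
      Eventually.of_forall fun t => by simpa using hline x t
    simpa using hm.hasDerivAt_eq_zero (hasDerivAt_comp_line hd0 z (ι x) 0)
  have hpos : ∀ x, ¬ ∀ᶠ t in 𝓝[>] (0 : ℝ), 0 < fderiv ℝ Z (z + t • ι x) (ι x) := fun x h => by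
    have h2 := eventually_pos_of_deriv_pos (g := fun t : ℝ => Z (z + t • ι x) - Z z) (by simp)
      (fun t => (hasDerivAt_comp_line hd0 z (ι x) t).sub_const _) h
    obtain ⟨t, ht⟩ := h2.exists
    exact absurd (hline x t) (not_le.2 ht)
  have h2 : ∀ x, fderiv ℝ (fderiv ℝ Z) z (ι x) (ι x) ≤ 0 := fun x => by
    by_contra hc
    push Not at hc
    refine hpos x (eventually_pos_of_hasDerivAt (by simpa using h1 x) ?_ hc)
    simpa using hasDerivAt_apply_line hd1 z (ι x) 0
  refine ⟨h1, h2, fun v hv => ?_⟩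
  have hv0 : fderiv ℝ (fderiv ℝ Z) z (ι v) (ι v) = 0 := le_antisymm (h2 v) hv
  have hsymm : IsSymmSndFDerivAt ℝ Z z := hZ.contDiffAt.isSymmSndFDerivAt (by
    simp only [minSmoothness_of_isRCLikeNormedField]; norm_num)
  constructor
  · intro x
    by_contra hb
    set b := fderiv ℝ (fderiv ℝ Z) z (ι v) (ι x) with hbdef
    -- On t v + x the form equals 2 t b plus its value at x, since it vanishes at v; this t makes it
    -- equal to 1, against semidefiniteness.
    have h3 := h2 (((-fderiv ℝ (fderiv ℝ Z) z (ι x) (ι x) + 1) / (2 * b)) • v + x)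
    simp only [map_add, map_smul, add_apply, smul_apply, smul_eq_mul, hv0] at h3
    rw [hsymm (ι x) (ι v), ← hbdef] at h3
    have h4 : (-fderiv ℝ (fderiv ℝ Z) z (ι x) (ι x) + 1) / (2 * b) * b =
        (-fderiv ℝ (fderiv ℝ Z) z (ι x) (ι x) + 1) / 2 := by field_simp
    linarith
  -- A positive third derivative would make the second, then the first, derivative positive to the
  -- right of 0. The third derivative is odd, so applying this to v and to -v gives equality.
  · have key : ∀ x, fderiv ℝ (fderiv ℝ Z) z (ι x) (ι x) = 0 →
        fderiv ℝ (fderiv ℝ (fderiv ℝ Z)) z (ι x) (ι x) (ι x) ≤ 0 := fun x hx => by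
      by_contra hc
      push Not at hc
      have h3 : ∀ᶠ t in 𝓝[>] (0 : ℝ), 0 < fderiv ℝ (fderiv ℝ Z) (z + t • ι x) (ι x) (ι x) := by
        refine eventually_pos_of_hasDerivAt (by simpa using hx) ?_ hc
        have h4 := (ContinuousLinearMap.apply ℝ ℝ (ι x)).hasFDerivAt.comp_hasDerivAt (0 : ℝ)
          (hasDerivAt_apply_line hd2 z (ι x) 0)
        rw [zero_smul, add_zero] at h4
        exact h4
      exact hpos x (eventually_pos_of_deriv_pos (by simpa using h1 x)
        (fun t => hasDerivAt_apply_line hd1 z (ι x) t) h3)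
    refine le_antisymm (key v hv0) ?_
    have h3 := key (-v) (by simpa using hv0)
    simpa using h3

end HigherOrderMaxima

/-! ### Derivatives of a cubic model polynomial. -/

section PolynomialJets

variable {E : Type*} [NormedAddCommGroup E] [NormedSpace ℝ E]

/-- A cubic polynomial with prescribed derivatives at `z₀`. -/
def cubic (α β l : E →L[ℝ] ℝ) (c γ : ℝ) (z₀ z : E) : ℝ :=
  α (z - z₀) + l (z - z₀) * β (z - z₀) - c / 2 * l (z - z₀) ^ 2 + γ / 6 * l (z - z₀) ^ 3

lemma hasFDerivAt_apply_sub {F : Type*} [NormedAddCommGroup F] [NormedSpace ℝ F]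
    (a : E →L[ℝ] F) (z₀ z : E) : HasFDerivAt (fun z => a (z - z₀)) a z :=
  a.hasFDerivAt.comp z ((hasFDerivAt_id z).sub_const z₀)

variable (α β l : E →L[ℝ] ℝ) (c γ : ℝ) (z₀ : E)

lemma contDiff_cubic {n : WithTop ℕ∞} : ContDiff ℝ n (cubic α β l c γ z₀) := by
  unfold cubic
  fun_prop

lemma fderiv_cubic : fderiv ℝ (cubic α β l c γ z₀) = fun z => α + l (z - z₀) • β + β (z - z₀) • l -
    (c * l (z - z₀)) • l + (γ / 2 * l (z - z₀) ^ 2) • l := by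
  funext z
  have hs : ∀ a : E →L[ℝ] ℝ, HasFDerivAt (fun z => a (z - z₀)) a z := fun a =>
    hasFDerivAt_apply_sub a z₀ z
  have h := (((hs α).add ((hs l).mul (hs β))).sub (((hs l).pow 2).const_mul (c / 2))).add
    (((hs l).pow 3).const_mul (γ / 6))
  refine HasFDerivAt.fderiv (h.congr_fderiv ?_)
  ext w
  simp
  ring

lemma fderiv_fderiv_cubic : fderiv ℝ (fderiv ℝ (cubic α β l c γ z₀)) = fun z =>
    l.smulRight β + β.smulRight l - c • l.smulRight l + (γ * l (z - z₀)) • l.smulRight l := by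
  rw [fderiv_cubic]
  funext z
  have hs : ∀ a : E →L[ℝ] ℝ, HasFDerivAt (fun z => a (z - z₀)) a z := fun a =>
    hasFDerivAt_apply_sub a z₀ z
  have h := (((((hs l).smul_const β).const_add α).add ((hs β).smul_const l)).sub
    (((hs l).const_mul c).smul_const l)).add ((((hs l).pow 2).const_mul (γ / 2)).smul_const l)
  refine HasFDerivAt.fderiv (h.congr_fderiv ?_)
  ext w w'
  simp
  ring

lemma fderiv_fderiv_fderiv_cubic : fderiv ℝ (fderiv ℝ (fderiv ℝ (cubic α β l c γ z₀))) = fun _ =>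
    γ • l.smulRight (l.smulRight l) := by
  rw [fderiv_fderiv_cubic]
  funext z
  exact HasFDerivAt.fderiv ((hasFDerivAt_apply_sub (γ • l.smulRight (l.smulRight l)) z₀ z).const_add
    (l.smulRight β + β.smulRight l - c • l.smulRight l) |>.congr_of_eventuallyEq
      (Eventually.of_forall fun y => by
        ext w w'
        simp
        ring))

end PolynomialJets

/-! ### Finite-dimensional perturbations of a family. -/

section Perturbations

variable {m : ℕ} {W : Type} [NormedAddCommGroup W] [NormedSpace ℝ W]

/-- Pairs of smooth functions on the torus. -/
abbrev TorusPair (m : ℕ) : Type :=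
  {q : (Vec m → ℝ) × (Vec m → ℝ) // IsTorusSmooth q.1 ∧ IsTorusSmooth q.2}

/-- The perturbation `q₁(θ) + ℓ(p) q₂(θ)`. -/
def pert (ℓ : W →L[ℝ] ℝ) (q : (Vec m → ℝ) × (Vec m → ℝ)) (z : Vec m × W) : ℝ :=
  q.1 z.1 + ℓ z.2 * q.2 z.1

lemma contDiff_pert (ℓ : W →L[ℝ] ℝ) (q : TorusPair m) (n : ℕ) :
    ContDiff ℝ n (pert ℓ q.1) := by
  have h : ContDiff ℝ ∞ (pert ℓ q.1) := (q.2.1.contDiff.comp contDiff_fst).add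
    ((ℓ.contDiff.comp contDiff_snd).mul (q.2.2.contDiff.comp contDiff_fst))
  exact h.of_le (by exact_mod_cast le_top)

/-- The family perturbed by finitely many functions. -/
def perturbed (Z : Vec m × W → ℝ) (ℓ : W →L[ℝ] ℝ) (s : Finset (TorusPair m)) (ξ : s → ℝ)
    (z : Vec m × W) : ℝ := Z z + ∑ k, ξ k • pert ℓ k.1.1 z

lemma contDiff_perturbed {Z : Vec m × W → ℝ} {n : ℕ} (hZ : ContDiff ℝ n Z) (ℓ : W →L[ℝ] ℝ)
    (s : Finset (TorusPair m)) (ξ : s → ℝ) : ContDiff ℝ n (perturbed Z ℓ s ξ) :=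
  hZ.add (ContDiff.sum fun k _ => (contDiff_pert ℓ k.1 n).const_smul (ξ k))

lemma IsFamily.perturbed {Z : Vec m × W → ℝ} {P : ℝ → W} {a b : ℝ} (h : IsFamily Z P a b)
    (ℓ : W →L[ℝ] ℝ) (s : Finset (TorusPair m)) (ξ : s → ℝ) :
    IsFamily (perturbed Z ℓ s ξ) P a b where
  contDiff := contDiff_perturbed (n := 4) h.contDiff ℓ s ξ
  periodic p k x := by
    simp only [Resonance.perturbed, pert]
    rw [show Z (x + intVec k, p) = Z (x, p) from h.periodic p k x]
    congr 1
    refine Finset.sum_congr rfl fun j _ => ?_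
    rw [j.1.2.1.periodic k x, j.1.2.2.periodic k x]
  contDiffOn := h.contDiffOn
  lt := h.lt

lemma fderiv_add_sum {E G ι : Type*} [NormedAddCommGroup E] [NormedSpace ℝ E]
    [NormedAddCommGroup G] [NormedSpace ℝ G] [Fintype ι] {f : E → G} {g : ι → E → G}
    (hf : Differentiable ℝ f) (hg : ∀ k, Differentiable ℝ (g k)) (ξ : ι → ℝ) :
    fderiv ℝ (fun z => f z + ∑ k, ξ k • g k z) = fun z => fderiv ℝ f z + ∑ k, ξ k • fderiv ℝ (g k) z :=
  funext fun z => ((hf z).hasFDerivAt.add (HasFDerivAt.fun_sum fun k _ =>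
    (hg k z).hasFDerivAt.const_smul (ξ k))).fderiv

lemma contDiff_fderiv_fderiv_fderiv {E G : Type*} [NormedAddCommGroup E] [NormedSpace ℝ E]
    [NormedAddCommGroup G] [NormedSpace ℝ G] {f : E → G} (hf : ContDiff ℝ 4 f) :
    ContDiff ℝ 1 (fderiv ℝ (fderiv ℝ (fderiv ℝ f))) := by
  have h1 : ContDiff ℝ 3 (fderiv ℝ f) := hf.fderiv_right (by norm_num)
  have h2 : ContDiff ℝ 2 (fderiv ℝ (fderiv ℝ f)) := h1.fderiv_right (by norm_num)
  exact h2.fderiv_right (by norm_num)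

/-! ### The jets whose zeros are the bad events, and their smoothness. -/

section Jets

variable (P : ℝ → W)

/-- The components of the gradient in `θ`. -/
def gradJet (Z : Vec m × W → ℝ) (x : Vec m) (τ : ℝ) : Fin m → ℝ :=
  fun j => fderiv ℝ Z (x, P τ) (EuclideanSpace.single j 1, 0)

/-- The jet that vanishes at degenerate maxima; the kernel direction is `eᵢ + w` with `w ⊥ eᵢ`. -/
def degenerateJet (i : Fin m) (Z : Vec m × W → ℝ)
    (z : Vec m × ℝ × (ℝ ∙ (EuclideanSpace.single i (1 : ℝ) : Vec m))ᗮ) :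
    (Fin m → ℝ) × (Fin m → ℝ) × ℝ :=
  (gradJet P Z z.1 z.2.1,
    fun j => fderiv ℝ (fderiv ℝ Z) (z.1, P z.2.1) (EuclideanSpace.single i 1 + (z.2.2 : Vec m), 0)
      (EuclideanSpace.single j 1, 0),
    fderiv ℝ (fderiv ℝ (fderiv ℝ Z)) (z.1, P z.2.1) (EuclideanSpace.single i 1 + (z.2.2 : Vec m), 0)
      (EuclideanSpace.single i 1 + (z.2.2 : Vec m), 0)
      (EuclideanSpace.single i 1 + (z.2.2 : Vec m), 0))

/-- The jet that vanishes at triples of critical points with equal values. -/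
def tripleJet (Z : Vec m × W → ℝ) (z : Vec m × Vec m × Vec m × ℝ) :
    (Fin m → ℝ) × (Fin m → ℝ) × (Fin m → ℝ) × ℝ × ℝ :=
  (gradJet P Z z.1 z.2.2.2, gradJet P Z z.2.1 z.2.2.2, gradJet P Z z.2.2.1 z.2.2.2,
    Z (z.1, P z.2.2.2) - Z (z.2.1, P z.2.2.2), Z (z.1, P z.2.2.2) - Z (z.2.2.1, P z.2.2.2))

/-- The jet that vanishes at pairs of critical points with equal values and equal speeds. -/
def pairJet (a b : ℝ) (Z : Vec m × W → ℝ) (z : Vec m × Vec m × ℝ) :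
    (Fin m → ℝ) × (Fin m → ℝ) × ℝ × ℝ :=
  (gradJet P Z z.1 z.2.2, gradJet P Z z.2.1 z.2.2,
    Z (z.1, P z.2.2) - Z (z.2.1, P z.2.2), speed Z P a b z.1 z.2.2 - speed Z P a b z.2.1 z.2.2)

variable {P} {Z : Vec m × W → ℝ} (hZ : ContDiff ℝ 4 Z)

include hZ in
lemma gradJet_perturbed (ℓ : W →L[ℝ] ℝ) (s : Finset (TorusPair m)) (ξ : s → ℝ) (x : Vec m)
    (τ : ℝ) : gradJet P (perturbed Z ℓ s ξ) x τ =
      gradJet P Z x τ + ∑ k, ξ k • gradJet P (pert ℓ k.1.1) x τ := by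
  unfold perturbed gradJet
  rw [fderiv_add_sum (g := fun k : s => pert ℓ k.1.1) (hZ.differentiable (by norm_num))
    fun k => (contDiff_pert ℓ k.1 1).differentiable (by norm_num)]
  ext j
  simp [sum_apply]

include hZ in
lemma speed_perturbed {a b : ℝ} (ℓ : W →L[ℝ] ℝ) (s : Finset (TorusPair m)) (ξ : s → ℝ) (x : Vec m)
    (τ : ℝ) : speed (perturbed Z ℓ s ξ) P a b x τ =
      speed Z P a b x τ + ∑ k, ξ k • speed (pert ℓ k.1.1) P a b x τ := by
  unfold perturbed speed
  rw [fderiv_add_sum (g := fun k : s => pert ℓ k.1.1) (hZ.differentiable (by norm_num))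
    fun k => (contDiff_pert ℓ k.1 1).differentiable (by norm_num)]
  simp [sum_apply]

include hZ in
-- The jet is affine in the perturbation because the kernel direction is an independent variable
-- instead of being determined by `Z`.
lemma degenerateJet_perturbed (i : Fin m) (ℓ : W →L[ℝ] ℝ) (s : Finset (TorusPair m)) (ξ : s → ℝ)
    (z : Vec m × ℝ × (ℝ ∙ (EuclideanSpace.single i (1 : ℝ) : Vec m))ᗮ) :
    degenerateJet P i (perturbed Z ℓ s ξ) z =
      degenerateJet P i Z z + ∑ k, ξ k • degenerateJet P i (pert ℓ k.1.1) z := by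
  have h1 : ∀ k : s, ContDiff ℝ 4 (pert ℓ k.1.1) := fun k => contDiff_pert ℓ k.1 4
  have e1 := fderiv_add_sum (hZ.differentiable (by norm_num))
    (fun k => (h1 k).differentiable (by norm_num)) ξ
  have e2 := fderiv_add_sum ((hZ.fderiv_right (m := 3) (by norm_num)).differentiable (by norm_num))
    (fun k => ((h1 k).fderiv_right (m := 3) (by norm_num)).differentiable (by norm_num)) ξ
  have e3 := fderiv_add_sum (((hZ.fderiv_right (m := 3) (by norm_num)).fderiv_right (m := 2)
      (by norm_num)).differentiable (by norm_num))
    (fun k => (((h1 k).fderiv_right (m := 3) (by norm_num)).fderiv_right (m := 2)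
      (by norm_num)).differentiable (by norm_num)) ξ
  rw [← e1] at e2
  rw [← e2] at e3
  have h2 : perturbed Z ℓ s ξ = fun z => Z z + ∑ k, ξ k • pert ℓ k.1.1 z := rfl
  refine Prod.ext ?_ (Prod.ext ?_ ?_)
  · simp only [degenerateJet, Prod.fst_add, Prod.fst_sum, Prod.smul_fst]
    exact gradJet_perturbed hZ ℓ s ξ _ _
  · simp only [degenerateJet, Prod.fst_add, Prod.snd_add, Prod.fst_sum, Prod.snd_sum,
      Prod.smul_fst, Prod.smul_snd]
    rw [h2, e2]
    ext j
    simp [sum_apply]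
  · simp only [degenerateJet, Prod.snd_add, Prod.snd_sum, Prod.smul_snd]
    rw [h2, e3]
    simp [sum_apply]

include hZ in
lemma tripleJet_perturbed (ℓ : W →L[ℝ] ℝ) (s : Finset (TorusPair m)) (ξ : s → ℝ)
    (z : Vec m × Vec m × Vec m × ℝ) : tripleJet P (perturbed Z ℓ s ξ) z =
      tripleJet P Z z + ∑ k, ξ k • tripleJet P (pert ℓ k.1.1) z := by
  refine Prod.ext ?_ (Prod.ext ?_ (Prod.ext ?_ (Prod.ext ?_ ?_)))
  · simp only [tripleJet, Prod.fst_add, Prod.fst_sum, Prod.smul_fst]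
    exact gradJet_perturbed hZ ℓ s ξ _ _
  · simp only [tripleJet, Prod.fst_add, Prod.snd_add, Prod.fst_sum, Prod.snd_sum,
      Prod.smul_fst, Prod.smul_snd]
    exact gradJet_perturbed hZ ℓ s ξ _ _
  · simp only [tripleJet, Prod.fst_add, Prod.snd_add, Prod.fst_sum, Prod.snd_sum,
      Prod.smul_fst, Prod.smul_snd]
    exact gradJet_perturbed hZ ℓ s ξ _ _
  · simp only [tripleJet, Prod.fst_add, Prod.snd_add, Prod.fst_sum, Prod.snd_sum,
      Prod.smul_fst, Prod.smul_snd, perturbed, smul_sub, Finset.sum_sub_distrib]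
    ring
  · simp only [tripleJet, Prod.snd_add, Prod.snd_sum, Prod.smul_snd, perturbed,
      smul_sub, Finset.sum_sub_distrib]
    ring

include hZ in
lemma pairJet_perturbed {a b : ℝ} (ℓ : W →L[ℝ] ℝ) (s : Finset (TorusPair m)) (ξ : s → ℝ)
    (z : Vec m × Vec m × ℝ) : pairJet P a b (perturbed Z ℓ s ξ) z =
      pairJet P a b Z z + ∑ k, ξ k • pairJet P a b (pert ℓ k.1.1) z := by
  refine Prod.ext ?_ (Prod.ext ?_ (Prod.ext ?_ ?_))
  · simp only [pairJet, Prod.fst_add, Prod.fst_sum, Prod.smul_fst]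
    exact gradJet_perturbed hZ ℓ s ξ _ _
  · simp only [pairJet, Prod.fst_add, Prod.snd_add, Prod.fst_sum, Prod.snd_sum,
      Prod.smul_fst, Prod.smul_snd]
    exact gradJet_perturbed hZ ℓ s ξ _ _
  · simp only [pairJet, Prod.fst_add, Prod.snd_add, Prod.fst_sum, Prod.snd_sum,
      Prod.smul_fst, Prod.smul_snd, perturbed, smul_sub, Finset.sum_sub_distrib]
    ring
  · simp only [pairJet, Prod.snd_add, Prod.snd_sum, Prod.smul_snd,
      speed_perturbed hZ, smul_sub, Finset.sum_sub_distrib]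
    ring

section Smoothness

variable {E : Type} [NormedAddCommGroup E] [NormedSpace ℝ E] {S : Set E} {a b : ℝ}
  (hP : ContDiffOn ℝ 2 P (Icc a b)) {x : E → Vec m} (hx : ContDiff ℝ 1 x)
  {t : E → ℝ} (ht : ContDiff ℝ 1 t) (hS : ∀ z ∈ S, t z ∈ Icc a b)

include hP hx ht hS in
lemma contDiffOn_base : ContDiffOn ℝ 1 (fun z => (x z, P (t z))) S :=
  hx.contDiffOn.prodMk ((hP.of_le (by norm_num)).comp ht.contDiffOn hS)

include hZ hP hx ht hS in
lemma contDiffOn_gradJet : ContDiffOn ℝ 1 (fun z => gradJet P Z (x z) (t z)) S := by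
  refine contDiffOn_pi.2 fun j => ?_
  exact (((hZ.fderiv_right (m := 1) (by norm_num))).comp_contDiffOn
    (contDiffOn_base hP hx ht hS)).clm_apply contDiffOn_const

include hZ hP hx ht hS in
lemma contDiffOn_value : ContDiffOn ℝ 1 (fun z => Z (x z, P (t z))) S :=
  (hZ.of_le (by norm_num)).comp_contDiffOn (contDiffOn_base hP hx ht hS)

include hZ hP hx ht hS in
-- The speed contains the derivative of `P`, which is why families require `P` of class C².
lemma contDiffOn_speed (hab : a < b) :
    ContDiffOn ℝ 1 (fun z => speed Z P a b (x z) (t z)) S := by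
  have h1 : ContDiffOn ℝ 1 (derivWithin P (Icc a b)) (Icc a b) :=
    hP.derivWithin (uniqueDiffOn_Icc hab) (by norm_num)
  exact (((hZ.fderiv_right (m := 1) (by norm_num))).comp_contDiffOn
    (contDiffOn_base hP hx ht hS)).clm_apply
    (contDiffOn_const.prodMk (h1.comp ht.contDiffOn hS))

end Smoothness

include hZ in
-- Third derivatives of a C⁴ function are C¹, the regularity that the dimension count uses.
lemma contDiffOn_degenerateJet {a b : ℝ} (hP : ContDiffOn ℝ 2 P (Icc a b)) (i : Fin m) :
    ContDiffOn ℝ 1 (degenerateJet P i Z) (univ ×ˢ (Icc a b ×ˢ univ)) := by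
  have hbase := contDiffOn_base (S := (univ : Set (Vec m)) ×ˢ (Icc a b ×ˢ
    (univ : Set (ℝ ∙ (EuclideanSpace.single i (1 : ℝ) : Vec m))ᗮ))) hP (x := fun z => z.1)
    contDiff_fst (t := fun z => z.2.1) (contDiff_fst.comp contDiff_snd) fun z hz => hz.2.1
  have hv : ContDiff ℝ 1 (fun z : Vec m × ℝ × (ℝ ∙ (EuclideanSpace.single i (1 : ℝ) : Vec m))ᗮ =>
      ((EuclideanSpace.single i (1 : ℝ) + (z.2.2 : Vec m), 0) : Vec m × W)) :=
    (contDiff_const.add (((ℝ ∙ (EuclideanSpace.single i (1 : ℝ) : Vec m))ᗮ.subtypeL).contDiff.comp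
      (contDiff_snd.comp contDiff_snd))).prodMk contDiff_const
  have h2 : ContDiff ℝ 1 (fderiv ℝ (fderiv ℝ Z)) :=
    (hZ.fderiv_right (m := 2) (by norm_num)).fderiv_right (by norm_num)
  have h3 := contDiff_fderiv_fderiv_fderiv hZ
  refine ContDiffOn.prodMk ?_ (ContDiffOn.prodMk (contDiffOn_pi.2 fun j => ?_) ?_)
  · exact contDiffOn_gradJet hZ hP contDiff_fst (contDiff_fst.comp contDiff_snd) fun z hz => hz.2.1
  · exact ((h2.comp_contDiffOn hbase).clm_apply hv.contDiffOn).clm_apply contDiffOn_const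
  · exact (((h3.comp_contDiffOn hbase).clm_apply hv.contDiffOn).clm_apply
      hv.contDiffOn).clm_apply hv.contDiffOn

include hZ in
lemma contDiffOn_tripleJet {a b : ℝ} (hP : ContDiffOn ℝ 2 P (Icc a b)) :
    ContDiffOn ℝ 1 (tripleJet P Z) (univ ×ˢ (univ ×ˢ (univ ×ˢ Icc a b))) := by
  have ht : ContDiff ℝ 1 (fun z : Vec m × Vec m × Vec m × ℝ => z.2.2.2) :=
    contDiff_snd.comp (contDiff_snd.comp contDiff_snd)
  have h1 : ContDiff ℝ 1 (fun z : Vec m × Vec m × Vec m × ℝ => z.1) := contDiff_fst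
  have h2 : ContDiff ℝ 1 (fun z : Vec m × Vec m × Vec m × ℝ => z.2.1) :=
    contDiff_fst.comp contDiff_snd
  have h3 : ContDiff ℝ 1 (fun z : Vec m × Vec m × Vec m × ℝ => z.2.2.1) :=
    contDiff_fst.comp (contDiff_snd.comp contDiff_snd)
  have hS : ∀ z ∈ (univ : Set (Vec m)) ×ˢ ((univ : Set (Vec m)) ×ˢ ((univ : Set (Vec m)) ×ˢ
    Icc a b)), z.2.2.2 ∈ Icc a b := fun z hz => hz.2.2.2
  exact (contDiffOn_gradJet hZ hP h1 ht hS).prodMk ((contDiffOn_gradJet hZ hP h2 ht hS).prodMk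
    ((contDiffOn_gradJet hZ hP h3 ht hS).prodMk
      (((contDiffOn_value hZ hP h1 ht hS).sub (contDiffOn_value hZ hP h2 ht hS)).prodMk
        ((contDiffOn_value hZ hP h1 ht hS).sub (contDiffOn_value hZ hP h3 ht hS)))))

include hZ in
lemma contDiffOn_pairJet {a b : ℝ} (hP : ContDiffOn ℝ 2 P (Icc a b)) (hab : a < b) :
    ContDiffOn ℝ 1 (pairJet P a b Z) (univ ×ˢ (univ ×ˢ Icc a b)) := by
  have ht : ContDiff ℝ 1 (fun z : Vec m × Vec m × ℝ => z.2.2) := contDiff_snd.comp contDiff_snd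
  have h1 : ContDiff ℝ 1 (fun z : Vec m × Vec m × ℝ => z.1) := contDiff_fst
  have h2 : ContDiff ℝ 1 (fun z : Vec m × Vec m × ℝ => z.2.1) := contDiff_fst.comp contDiff_snd
  have hS : ∀ z ∈ (univ : Set (Vec m)) ×ˢ ((univ : Set (Vec m)) ×ˢ Icc a b),
    z.2.2 ∈ Icc a b := fun z hz => hz.2.2
  exact (contDiffOn_gradJet hZ hP h1 ht hS).prodMk ((contDiffOn_gradJet hZ hP h2 ht hS).prodMk
    (((contDiffOn_value hZ hP h1 ht hS).sub (contDiffOn_value hZ hP h2 ht hS)).prodMk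
      ((contDiffOn_speed hZ hP h1 ht hS hab).sub (contDiffOn_speed hZ hP h2 ht hS hab))))

end Jets

end Perturbations

/-! ### Perturbations realise every value of each jet. -/

section Surjectivity

variable {m : ℕ} {W : Type} [NormedAddCommGroup W] [NormedSpace ℝ W]

/-- The linear form with given coefficients. -/
def linForm (α : Fin m → ℝ) : Vec m →L[ℝ] ℝ := ∑ j, α j • EuclideanSpace.proj (𝕜 := ℝ) j

lemma linForm_single (α : Fin m → ℝ) (j : Fin m) : linForm α (EuclideanSpace.single j 1) = α j := by
  simp [linForm, sum_apply]

lemma hasFDerivAt_pert {ℓ : W →L[ℝ] ℝ} {q : (Vec m → ℝ) × (Vec m → ℝ)} {x : Vec m}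
    {α : Vec m →L[ℝ] ℝ} {c c' : ℝ} (h1 : q.1 =ᶠ[𝓝 x] fun y => α (y - x) + c)
    (h2 : q.2 =ᶠ[𝓝 x] fun _ => c') (p : W) :
    HasFDerivAt (pert ℓ q) (α.comp (ContinuousLinearMap.fst ℝ _ _) +
      c' • ℓ.comp (ContinuousLinearMap.snd ℝ _ _)) (x, p) := by
  have hev : pert ℓ q =ᶠ[𝓝 (x, p)] fun z => α.comp (ContinuousLinearMap.fst ℝ _ _) (z - (x, p)) + c +
      (ℓ.comp (ContinuousLinearMap.snd ℝ (Vec m) W)) z * c' := by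
    have hfst : Tendsto (Prod.fst : Vec m × W → Vec m) (𝓝 (x, p)) (𝓝 x) := continuousAt_fst
    filter_upwards [hfst.eventually h1, hfst.eventually h2] with z h1 h2
    simp [pert, h1, h2]
  refine HasFDerivAt.congr_of_eventuallyEq ?_ hev
  exact ((hasFDerivAt_apply_sub _ _ _).add_const c).add
    ((ContinuousLinearMap.hasFDerivAt _).mul_const c')

lemma gradJet_pert {P : ℝ → W} {ℓ : W →L[ℝ] ℝ} {q : (Vec m → ℝ) × (Vec m → ℝ)} {x : Vec m}
    {α : Fin m → ℝ} {c c' : ℝ} (h1 : q.1 =ᶠ[𝓝 x] fun y => linForm α (y - x) + c)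
    (h2 : q.2 =ᶠ[𝓝 x] fun _ => c') (τ : ℝ) : gradJet P (pert ℓ q) x τ = α := by
  funext j
  rw [gradJet, (hasFDerivAt_pert h1 h2 (P τ)).fderiv]
  simp [linForm_single]

lemma speed_pert {P : ℝ → W} {a b : ℝ} {ℓ : W →L[ℝ] ℝ} {q : (Vec m → ℝ) × (Vec m → ℝ)} {x : Vec m}
    {α : Fin m → ℝ} {c c' : ℝ} (h1 : q.1 =ᶠ[𝓝 x] fun y => linForm α (y - x) + c)
    (h2 : q.2 =ᶠ[𝓝 x] fun _ => c') (τ : ℝ) :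
    speed (pert ℓ q) P a b x τ = c' * ℓ (derivWithin P (Icc a b) τ) := by
  rw [speed, (hasFDerivAt_pert h1 h2 (P τ)).fderiv]
  simp

lemma pert_apply_of_germ {ℓ : W →L[ℝ] ℝ} {q : (Vec m → ℝ) × (Vec m → ℝ)} {x : Vec m}
    {α : Fin m → ℝ} {c c' : ℝ} (h1 : q.1 =ᶠ[𝓝 x] fun y => linForm α (y - x) + c)
    (h2 : q.2 =ᶠ[𝓝 x] fun _ => c') (p : W) : pert ℓ q (x, p) = c + ℓ p * c' := by
  rw [pert, h1.eq_of_nhds, h2.eq_of_nhds]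
  simp

lemma contDiff_affineGerm (α : Fin m → ℝ) (x : Vec m) (c : ℝ) :
    ContDiff ℝ ∞ (fun y => linForm α (y - x) + c) :=
  ((linForm α).contDiff.comp (contDiff_id.sub contDiff_const)).add contDiff_const

lemma exists_degenerateJet_pert_eq {P : ℝ → W} (ℓ : W →L[ℝ] ℝ) (i : Fin m)
    (z : Vec m × ℝ × (ℝ ∙ (EuclideanSpace.single i (1 : ℝ) : Vec m))ᗮ)
    (y : (Fin m → ℝ) × (Fin m → ℝ) × ℝ) :
    ∃ q : TorusPair m, degenerateJet P i (pert ℓ q.1) z = y := by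
  obtain ⟨x, τ, w⟩ := z
  obtain ⟨α, β, γ⟩ := y
  have hw : (w : Vec m) i = 0 := by
    have := Submodule.mem_orthogonal_singleton_iff_inner_right.1 w.2
    simpa [EuclideanSpace.inner_single_left] using this
  set v : Vec m := EuclideanSpace.single i 1 + (w : Vec m) with hv
  have hvi : v i = 1 := by simp [hv, hw]
  set l : Vec m →L[ℝ] ℝ := EuclideanSpace.proj (𝕜 := ℝ) i
  -- As l v = 1, the Hessian of the cubic paired with v is β + (β(v) - c) l; the choice c = β(v)
  -- leaves exactly β, and the third derivative along v is γ.
  obtain ⟨φ, hφ, hgerm, -⟩ := exists_isTorusSmooth_germ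
    (contDiff_cubic (linForm α) (linForm β) l (linForm β v) γ x (n := ∞)) x ∅ (by simp)
  refine ⟨⟨(φ, fun _ => 0), hφ, isTorusSmooth_const 0⟩, ?_⟩
  set f : Vec m × W →L[ℝ] Vec m := ContinuousLinearMap.fst ℝ _ _ with hf
  have hev : pert ℓ (φ, fun _ => 0) =ᶠ[𝓝 (x, P τ)]
      cubic ((linForm α).comp f) ((linForm β).comp f) (l.comp f) (linForm β v) γ (x, P τ) := by
    have hfst : Tendsto (Prod.fst : Vec m × W → Vec m) (𝓝 (x, P τ)) (𝓝 x) := continuousAt_fst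
    filter_upwards [hfst.eventually hgerm] with z hz
    simp [pert, hz, cubic, hf]
  have e1 := hev.fderiv (𝕜 := ℝ)
  have e2 := e1.fderiv (𝕜 := ℝ)
  have e3 := e2.fderiv (𝕜 := ℝ)
  refine Prod.ext ?_ (Prod.ext ?_ ?_)
  · funext j
    simp only [degenerateJet, gradJet]
    rw [e1.eq_of_nhds, fderiv_cubic]
    simp [hf, linForm_single]
  · funext j
    simp only [degenerateJet]
    rw [e2.eq_of_nhds, fderiv_fderiv_cubic, ← hv]
    simp [hf, linForm_single, l, hvi]
  · simp only [degenerateJet]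
    rw [e3.eq_of_nhds, fderiv_fderiv_fderiv_cubic, ← hv]
    simp [hf, l, hvi]

/-- Bumps at three inequivalent points are independent. Only differences of values enter, so the
value at the first point is normalised to 0. -/
lemma exists_tripleJet_pert_eq {P : ℝ → W} (ℓ : W →L[ℝ] ℝ) {z : Vec m × Vec m × Vec m × ℝ}
    (h12 : ¬ SameAngle z.1 z.2.1) (h13 : ¬ SameAngle z.1 z.2.2.1)
    (h23 : ¬ SameAngle z.2.1 z.2.2.1)
    (y : (Fin m → ℝ) × (Fin m → ℝ) × (Fin m → ℝ) × ℝ × ℝ) :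
    ∃ q : TorusPair m, tripleJet P (pert ℓ q.1) z = y := by
  classical
  obtain ⟨x₁, x₂, x₃, τ⟩ := z
  obtain ⟨α₁, α₂, α₃, c₂, c₃⟩ := y
  simp only at h12 h13 h23
  obtain ⟨φ₁, s₁, g₁, o₁⟩ := exists_isTorusSmooth_germ (contDiff_affineGerm α₁ x₁ 0) x₁ {x₂, x₃}
    (by simp [h12, h13])
  obtain ⟨φ₂, s₂, g₂, o₂⟩ := exists_isTorusSmooth_germ (contDiff_affineGerm α₂ x₂ (-c₂)) x₂ {x₁, x₃}
    (by simpa using ⟨fun h => h12 h.symm, h23⟩)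
  obtain ⟨φ₃, s₃, g₃, o₃⟩ := exists_isTorusSmooth_germ (contDiff_affineGerm α₃ x₃ (-c₃)) x₃ {x₁, x₂}
    (by simpa using ⟨fun h => h13 h.symm, fun h => h23 h.symm⟩)
  refine ⟨⟨(fun x => φ₁ x + φ₂ x + φ₃ x, fun _ => 0), (s₁.add s₂).add s₃,
    isTorusSmooth_const 0⟩, ?_⟩
  have hzero : ∀ x : Vec m, (fun _ : Vec m => (0 : ℝ)) =ᶠ[𝓝 x] fun _ => (0 : ℝ) := fun x =>
    EventuallyEq.rfl
  have e₁ : (fun x => φ₁ x + φ₂ x + φ₃ x) =ᶠ[𝓝 x₁] fun y => linForm α₁ (y - x₁) + 0 := by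
    filter_upwards [g₁, o₂ x₁ (by simp), o₃ x₁ (by simp)] with y h1 h2 h3
    simp [h1, h2, h3]
  have e₂ : (fun x => φ₁ x + φ₂ x + φ₃ x) =ᶠ[𝓝 x₂] fun y => linForm α₂ (y - x₂) + -c₂ := by
    filter_upwards [g₂, o₁ x₂ (by simp), o₃ x₂ (by simp)] with y h1 h2 h3
    simp [h1, h2, h3]
  have e₃ : (fun x => φ₁ x + φ₂ x + φ₃ x) =ᶠ[𝓝 x₃] fun y => linForm α₃ (y - x₃) + -c₃ := by
    filter_upwards [g₃, o₁ x₃ (by simp), o₂ x₃ (by simp)] with y h1 h2 h3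
    simp [h1, h2, h3]
  simp only [tripleJet]
  rw [gradJet_pert e₁ (hzero _), gradJet_pert e₂ (hzero _), gradJet_pert e₃ (hzero _),
    pert_apply_of_germ e₁ (hzero _), pert_apply_of_germ e₂ (hzero _),
    pert_apply_of_germ e₃ (hzero _)]
  simp

lemma exists_pairJet_pert_eq {P : ℝ → W} {a b : ℝ} (ℓ : W →L[ℝ] ℝ) {z : Vec m × Vec m × ℝ}
    (h12 : ¬ SameAngle z.1 z.2.1) (hℓ : ℓ (P z.2.2) = z.2.2)
    (hℓ' : ℓ (derivWithin P (Icc a b) z.2.2) = 1)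
    (y : (Fin m → ℝ) × (Fin m → ℝ) × ℝ × ℝ) :
    ∃ q : TorusPair m, pairJet P a b (pert ℓ q.1) z = y := by
  classical
  obtain ⟨x₁, x₂, τ⟩ := z
  obtain ⟨α₁, α₂, c, d⟩ := y
  simp only at h12 hℓ hℓ'
  obtain ⟨φ₁, s₁, g₁, o₁⟩ := exists_isTorusSmooth_germ (contDiff_affineGerm α₁ x₁ 0) x₁ {x₂}
    (by simp [h12])
  -- The term with ψ = -d near x₂ prescribes the speed there and shifts the value by -τ d; the
  -- offset τ d restores the value -c.
  obtain ⟨φ₂, s₂, g₂, o₂⟩ := exists_isTorusSmooth_germ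
    (contDiff_affineGerm α₂ x₂ (-c + τ * d)) x₂ {x₁} (by simpa using fun h => h12 h.symm)
  obtain ⟨ψ, sψ, gψ, oψ⟩ := exists_isTorusSmooth_germ
    (contDiff_const (c := -d)) x₂ {x₁} (by simpa using fun h => h12 h.symm)
  refine ⟨⟨(fun x => φ₁ x + φ₂ x, ψ), s₁.add s₂, sψ⟩, ?_⟩
  have e₁ : (fun x => φ₁ x + φ₂ x) =ᶠ[𝓝 x₁] fun y => linForm α₁ (y - x₁) + 0 := by
    filter_upwards [g₁, o₂ x₁ (by simp)] with y h1 h2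
    simp [h1, h2]
  have e₂ : (fun x => φ₁ x + φ₂ x) =ᶠ[𝓝 x₂] fun y => linForm α₂ (y - x₂) + (-c + τ * d) := by
    filter_upwards [g₂, o₁ x₂ (by simp)] with y h1 h2
    simp [h1, h2]
  have eψ : ψ =ᶠ[𝓝 x₁] fun _ => 0 := oψ x₁ (by simp)
  simp only [pairJet]
  rw [gradJet_pert e₁ eψ, gradJet_pert e₂ gψ, pert_apply_of_germ e₁ eψ, pert_apply_of_germ e₂ gψ,
    speed_pert e₁ eψ, speed_pert e₂ gψ, hℓ, hℓ']
  refine Prod.ext rfl (Prod.ext rfl (Prod.ext ?_ ?_))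
  · simp
  · simp

end Surjectivity

/-! ### Removing degenerate maxima, then triple and tangential double ones. -/

section Density

variable {m : ℕ} {W : Type} [NormedAddCommGroup W] [NormedSpace ℝ W]
  {Z : Vec m × W → ℝ} {P : ℝ → W} {a b : ℝ}

lemma C2Close.symm {ε : ℝ} {f g : Vec m → ℝ} (h : C2Close ε g f) : C2Close ε f g := fun x =>
  ⟨by rw [abs_sub_comm]; exact (h x).1, fun v => by rw [abs_sub_comm]; exact (h x).2 v⟩

lemma IsFamily.gradJet_eq_zero (h : IsFamily Z P a b) {x : Vec m} {τ : ℝ}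
    (hx : IsGlobalMax (fun x => Z (x, P τ)) x) : gradJet P Z x τ = 0 := by
  have := (max_conditions (h.contDiff.of_le (by norm_num))
    (ContinuousLinearMap.inl ℝ (Vec m) W) (z := (x, P τ)) fun y => by simpa using hx (x + y)).1
  funext j
  have h1 := this (EuclideanSpace.single j 1)
  rw [ContinuousLinearMap.inl_apply] at h1
  exact h1

/-- A compact set of points and kernel directions that detects degenerate maxima. -/
def degenerateDomain (a b : ℝ) (i : Fin m) :
    Set (Vec m × ℝ × (ℝ ∙ (EuclideanSpace.single i (1 : ℝ) : Vec m))ᗮ) :=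
  cube m ×ˢ (Icc a b ×ˢ Metric.closedBall 0 m)

lemma isCompact_degenerateDomain (a b : ℝ) (i : Fin m) : IsCompact (degenerateDomain a b i) :=
  isCompact_cube.prod (isCompact_Icc.prod (isCompact_closedBall _ _))

/-- At a maximum, a direction with nonnegative second derivative lies in the kernel of the Hessian
and has vanishing third derivative; this third-order equation is what wins the dimension count. -/
lemma exists_degenerateJet_eq_zero (h : IsFamily Z P a b) {τ : ℝ} (hτ : τ ∈ Icc a b)
    (hdeg : ¬ AllMaxNondeg fun x => Z (x, P τ)) :
    ∃ i, ∃ z ∈ degenerateDomain a b i, degenerateJet P i Z z = 0 := by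
  simp only [AllMaxNondeg, IsNondegMax] at hdeg
  push Not at hdeg
  obtain ⟨θ, hθ, v, hv, hH⟩ := hdeg
  obtain ⟨x, hx, hθx⟩ := exists_mem_cube θ
  rw [← (h.periodic (P τ)).hessian hθx, hessian_slice (h.contDiff.of_le (by norm_num)),
    iteratedFDeriv_two_apply] at hH
  have hxmax := (h.periodic (P τ)).isGlobalMax hθ hθx
  have hne : Nonempty (Fin m) := by
    by_contra hc
    rw [not_nonempty_iff] at hc
    exact hv (Subsingleton.elim _ _)
  -- Dividing by the largest coordinate puts the kernel direction in the chart eᵢ + w and bounds w,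
  -- so that compact domains suffice.
  obtain ⟨i, hi⟩ := Finite.exists_max fun j => |v j|
  have hvi : v i ≠ 0 := fun h0 => hv (by
    ext j
    have := hi j
    rw [h0, abs_zero] at this
    simpa using abs_nonpos_iff.1 this)
  have hwmem : (v i)⁻¹ • v - EuclideanSpace.single i 1 ∈
      (ℝ ∙ (EuclideanSpace.single i (1 : ℝ) : Vec m))ᗮ := by
    rw [Submodule.mem_orthogonal_singleton_iff_inner_right]
    simp [EuclideanSpace.inner_single_left, hvi]
  -- Every coordinate has size at most 1, so the squared norm is at most m, and m ≤ m².
  have hnorm : ‖(v i)⁻¹ • v - EuclideanSpace.single i 1‖ ≤ (m : ℝ) := by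
    have h1 : ‖(v i)⁻¹ • v - EuclideanSpace.single i 1‖ ^ 2 ≤ (m : ℝ) := by
      rw [EuclideanSpace.norm_sq_eq]
      refine (Finset.sum_le_card_nsmul _ _ 1 fun j _ => ?_).trans (by simp)
      rw [Real.norm_eq_abs, sq_abs, sq_le_one_iff_abs_le_one]
      by_cases hj : j = i
      · subst hj; simp [hvi]
      · have : |(v i)⁻¹ * v j| ≤ 1 := by
          rw [abs_mul, abs_inv, inv_mul_le_iff₀ (abs_pos.2 hvi), mul_one]
          exact hi j
        simpa [hj] using this
    have h2 : (1 : ℝ) ≤ m := by exact_mod_cast Fin.pos_iff_nonempty.2 hne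
    exact abs_le_of_sq_le_sq' (h1.trans (by nlinarith)) (by linarith) |>.2
  obtain ⟨h1, h2, h3⟩ := max_conditions (h.contDiff.of_le (by norm_num))
    (ContinuousLinearMap.inl ℝ (Vec m) W) (z := (x, P τ)) fun y => by simpa using hxmax (x + y)
  have hsum : EuclideanSpace.single i 1 + ((v i)⁻¹ • v - EuclideanSpace.single i 1) =
    (v i)⁻¹ • v := by abel
  have h4 := h3 ((v i)⁻¹ • v) (by
    simp only [map_smul, smul_apply, smul_eq_mul]
    have := mul_nonneg (mul_self_nonneg (v i)⁻¹) hH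
    simp only [ContinuousLinearMap.inl_apply]
    simpa [mul_assoc] using this)
  refine ⟨i, (x, τ, ⟨_, hwmem⟩), ⟨hx, hτ, by simpa using hnorm⟩, ?_⟩
  refine Prod.ext (h.gradJet_eq_zero hxmax) (Prod.ext ?_ ?_)
  · funext j
    have := h4.1 (EuclideanSpace.single j 1)
    simp only [degenerateJet, hsum]
    simpa using this
  · have := h4.2
    simp only [degenerateJet, hsum]
    simpa using this

lemma exists_finset_span_degenerateJet (hP : ContDiffOn ℝ 2 P (Icc a b)) (ℓ : W →L[ℝ] ℝ)
    (i : Fin m) : ∃ s : Finset (TorusPair m), ∀ s' : Finset (TorusPair m), s ⊆ s' →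
      ∀ z ∈ degenerateDomain a b i,
        Submodule.span ℝ (range fun k : s' => degenerateJet P i (pert ℓ k.1.1) z) = ⊤ :=
  exists_finset_span_eq_top (J := fun q : TorusPair m => degenerateJet P i (pert ℓ q.1))
    (isCompact_degenerateDomain a b i)
    (fun q => (contDiffOn_degenerateJet (contDiff_pert ℓ q 4) hP i).continuousOn.mono
      fun _ hz => ⟨trivial, hz.2.1, trivial⟩)
    fun z _ y => exists_degenerateJet_pert_eq ℓ i z y

/-- Unknowns m + 1 + (m - 1) = 2m, equations 2m + 1. -/
lemma finrank_degenerateDomain_lt (i : Fin m) :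
    finrank ℝ (Vec m × ℝ × (ℝ ∙ (EuclideanSpace.single i (1 : ℝ) : Vec m))ᗮ) <
      finrank ℝ ((Fin m → ℝ) × (Fin m → ℝ) × ℝ) := by
  have h1 := Submodule.finrank_add_finrank_orthogonal
    (ℝ ∙ (EuclideanSpace.single i (1 : ℝ) : Vec m))
  rw [finrank_span_singleton (by simp), finrank_euclideanSpace_fin] at h1
  simp only [finrank_prod, finrank_euclideanSpace_fin, finrank_self, finrank_fin_fun]
  omega

lemma isOpen_and_dense_degenerateJet (h : IsFamily Z P a b) (ℓ : W →L[ℝ] ℝ) (i : Fin m)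
    (s : Finset (TorusPair m)) (hs : ∀ z ∈ degenerateDomain a b i,
      Submodule.span ℝ (range fun k : s => degenerateJet P i (pert ℓ k.1.1) z) = ⊤) :
    IsOpen {ξ : s → ℝ | ∀ z ∈ degenerateDomain a b i,
      degenerateJet P i Z z + ∑ k, ξ k • degenerateJet P i (pert ℓ k.1.1) z ≠ 0} ∧
    Dense {ξ : s → ℝ | ∀ z ∈ degenerateDomain a b i,
      degenerateJet P i Z z + ∑ k, ξ k • degenerateJet P i (pert ℓ k.1.1) z ≠ 0} :=
  isOpen_and_dense_forall_ne_zero (J := fun k : s => degenerateJet P i (pert ℓ k.1.1))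
    (convex_univ.prod ((convex_Icc a b).prod convex_univ))
    (contDiffOn_degenerateJet h.contDiff h.contDiffOn i)
    (fun k => contDiffOn_degenerateJet (contDiff_pert ℓ k.1 4) h.contDiffOn i)
    (finrank_degenerateDomain_lt i) (isCompact_degenerateDomain a b i)
    (fun _ hz => ⟨trivial, hz.2.1, trivial⟩) hs

/-- Arbitrarily small perturbations in finitely many directions remove all degenerate maxima. -/
lemma IsFamily.exists_perturbed_allMaxNondeg (h : IsFamily Z P a b) (ℓ : W →L[ℝ] ℝ) :
    ∃ s : Finset (TorusPair m), ∀ U ∈ 𝓝 (0 : s → ℝ), ∃ ξ ∈ U, ∀ τ ∈ Icc a b,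
      AllMaxNondeg fun x => Resonance.perturbed Z ℓ s ξ (x, P τ) := by
  classical
  choose s hs using exists_finset_span_degenerateJet (m := m) h.contDiffOn ℓ
  -- Spanning passes to larger sets of directions, so one finite set serves all m charts.
  refine ⟨Finset.univ.biUnion s, fun U hU => ?_⟩
  have hod := fun i : Fin m => isOpen_and_dense_degenerateJet h ℓ i (Finset.univ.biUnion s)
    (hs i _ (Finset.subset_biUnion_of_mem s (Finset.mem_univ i)))
  obtain ⟨ξ, hξ, hξU⟩ := (dense_iInter_of_isOpen (fun i => (hod i).1)
    fun i => (hod i).2).inter_nhds_nonempty hU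
  refine ⟨ξ, hξU, fun τ hτ => ?_⟩
  by_contra hdeg
  obtain ⟨i, z, hz, h0⟩ := exists_degenerateJet_eq_zero (h.perturbed ℓ _ ξ) hτ hdeg
  rw [degenerateJet_perturbed h.contDiff] at h0
  exact mem_iInter.1 hξ i z hz h0

lemma IsFamily.exists_perturbed_c2Close (h : IsFamily Z P a b) (ℓ : W →L[ℝ] ℝ)
    (s : Finset (TorusPair m)) {ε : ℝ} (hε : 0 < ε) :
    ∀ᶠ ξ in 𝓝 (0 : s → ℝ), ∀ τ ∈ Icc a b,
      C2Close ε (fun x => Resonance.perturbed Z ℓ s ξ (x, P τ)) (fun x => Z (x, P τ)) := by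
  -- Regarding ξ as a further parameter turns the smallness of the perturbation into continuity of a
  -- single family.
  let Z' : Vec m × (W × (s → ℝ)) → ℝ := fun z => Resonance.perturbed Z ℓ s z.2.2 (z.1, z.2.1)
  have hZ' : IsFamily Z' (fun τ => (P τ, 0)) a b :=
    { contDiff := by
        have h1 : ContDiff ℝ 4 fun z : Vec m × (W × (s → ℝ)) => (z.1, z.2.1) :=
          contDiff_fst.prodMk (contDiff_fst.comp contDiff_snd)
        refine (h.contDiff.comp h1).add (ContDiff.sum fun k _ => ContDiff.mul ?_ ?_)
        · exact (contDiff_apply ℝ ℝ k).comp (contDiff_snd.comp contDiff_snd)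
        · exact (contDiff_pert ℓ k.1 4).comp h1
      periodic := fun p => (h.perturbed ℓ s p.2).periodic p.1
      contDiffOn := h.contDiffOn.prodMk contDiffOn_const
      lt := h.lt }
  have h0 : ∀ p : W, (fun x => Z' (x, (p, 0))) = fun x => Z (x, p) := fun p => by
    funext x
    simp [Z', Resonance.perturbed]
  obtain ⟨δ, hδ, H⟩ := exists_uniform_of_nhdsWithin (a := a) (b := b)
    (Q := fun δ τ => ∀ ξ : s → ℝ, ‖ξ‖ < δ →
      C2Close ε (fun x => Resonance.perturbed Z ℓ s ξ (x, P τ)) (fun x => Z (x, P τ)))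
    (fun τ ε ε' hle hQ ξ hξ => hQ ξ (hξ.trans_le hle))
    (fun τ₀ hτ₀ => by
      have h1 := hZ'.eventually_c2Close (P τ₀, 0) (half_pos hε)
      rw [nhds_prod_eq] at h1
      obtain ⟨pa, hpa, pb, hpb, hab⟩ := eventually_prod_iff.1 h1
      obtain ⟨δ, hδ, hδb⟩ := Metric.eventually_nhds_iff.1 hpb
      refine ⟨δ, hδ, ?_⟩
      filter_upwards [(h.contDiffOn.continuousOn τ₀ hτ₀).eventually hpa] with τ hτ ξ hξ
      have e1 := hab hτ (hδb (y := ξ) (by simpa using hξ))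
      have e2 := hab hτ (hδb (y := 0) (by simpa using hδ))
      rw [h0 (P τ)] at e2
      have := e1.trans e2.symm
      rwa [add_halves] at this)
  filter_upwards [Metric.ball_mem_nhds (0 : s → ℝ) hδ] with ξ hξ τ hτ
  exact H τ hτ ξ (by simpa using hξ)

/-- By compactness the smooth function `latticeDist`, which vanishes only on the lattice, controls
the true distance to it. -/
lemma exists_latticeDist_lt {ρ : ℝ} (hρ : 0 < ρ) :
    ∃ κ > 0, ∀ u : Vec m, latticeDist u < κ → ∃ k, ‖u - intVec k‖ ≤ ρ := by
  have hK : IsCompact (cube m ∩ {y | ∀ k : Fin m → ℤ, ρ ≤ ‖y - intVec k‖}) := by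
    refine isCompact_cube.inter_right ?_
    simp only [ofPred_forall]
    exact isClosed_iInter fun k => isClosed_le continuous_const (by fun_prop)
  obtain ⟨κ, hκ, hle⟩ := hK.exists_forall_le' (a := 0) (f := latticeDist)
    contDiff_latticeDist.continuous.continuousOn (fun y hy => by
      have := latticeDist_pos (x := y) (y := 0) (fun hs => by
        obtain ⟨k, hk⟩ := sameAngle_iff.1 hs
        have := hy.2 k
        rw [hk] at this
        simp at this
        linarith)
      simpa using this)
  refine ⟨κ, hκ, fun u hu => ?_⟩
  by_contra! hc
  obtain ⟨k, hk⟩ := exists_sub_intVec_mem_cube u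
  have h1 := hle (u - intVec k) ⟨hk, fun l => by
    have := hc (k + l)
    rw [intVec_add] at this
    rw [sub_sub]
    exact this.le⟩
  rw [sub_eq_add_neg, ← intVec_neg, latticeDist_add_intVec] at h1
  linarith

lemma latticeDist_eq_zero {x y : Vec m} (h : SameAngle x y) : latticeDist (y - x) = 0 := by
  obtain ⟨k, rfl⟩ := sameAngle_iff.1 h
  have := latticeDist_add_intVec (0 : Vec m) k
  rwa [zero_add, latticeDist_zero, ← add_sub_cancel_left x (intVec k)] at this

/-- The constants of `exists_stable` made uniform along the curve: distinct maxima of all nearby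
functions keep a common minimal distance. -/
lemma IsFamily.exists_uniform_stability (h : IsFamily Z P a b)
    (hnd : ∀ τ ∈ Icc a b, AllMaxNondeg fun x => Z (x, P τ)) :
    ∃ ε > 0, ∀ τ ∈ Icc a b, ∀ g : Vec m → ℝ, ContDiff ℝ 2 g →
      C2Close ε g (fun x => Z (x, P τ)) → AllMaxNondeg g ∧
        ∀ x y, IsGlobalMax g x → IsGlobalMax g y → ‖x - y‖ ≤ ε → x = y := by
  refine exists_uniform_of_nhdsWithin (Q := fun ε τ => ∀ g : Vec m → ℝ, ContDiff ℝ 2 g →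
      C2Close ε g (fun x => Z (x, P τ)) → AllMaxNondeg g ∧
        ∀ x y, IsGlobalMax g x → IsGlobalMax g y → ‖x - y‖ ≤ ε → x = y)
    (fun τ ε ε' hle hQ g hg hgc => ?_) (fun τ₀ hτ₀ => ?_)
  · obtain ⟨h1, h2⟩ := hQ g hg (hgc.mono hle)
    exact ⟨h1, fun x y hx hy hxy => h2 x y hx hy (hxy.trans hle)⟩
  · obtain ⟨ε, hε, c, hc, ρ, hρ, hst⟩ := exists_stable
      ((h.contDiff_slice (P τ₀)).of_le (by norm_num)) (h.periodic _) (hnd τ₀ hτ₀)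
    refine ⟨min (ε / 2) ρ, by positivity, ?_⟩
    filter_upwards [(h.contDiffOn.continuousOn τ₀ hτ₀).eventually
      (h.eventually_c2Close (P τ₀) (half_pos hε))] with τ hτ g hg hgc
    have h1 := (hgc.mono (min_le_left _ _)).trans hτ
    rw [add_halves] at h1
    obtain ⟨-, h2, h3⟩ := hst g hg h1
    refine ⟨fun x hx v hv => ?_, fun x y hx hy hxy => h3 x y hx hy (hxy.trans (min_le_right _ _))⟩
    have h4 := h2 x hx v
    have h5 : 0 < c * ‖v‖ ^ 2 := by have := norm_pos_iff.2 hv; positivity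
    linarith

/-- Triples of points at mutual distance at least `κ` on the torus. -/
def tripleDomain (m : ℕ) (a b κ : ℝ) : Set (Vec m × Vec m × Vec m × ℝ) :=
  (cube m ×ˢ (cube m ×ˢ (cube m ×ˢ Icc a b))) ∩ {z | κ ≤ latticeDist (z.2.1 - z.1) ∧
    κ ≤ latticeDist (z.2.2.1 - z.1) ∧ κ ≤ latticeDist (z.2.2.1 - z.2.1)}

/-- Pairs of points at distance at least `κ` on the torus. -/
def pairDomain (m : ℕ) (a b κ : ℝ) : Set (Vec m × Vec m × ℝ) :=
  (cube m ×ˢ (cube m ×ˢ Icc a b)) ∩ {z | κ ≤ latticeDist (z.2.1 - z.1)}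

lemma isCompact_tripleDomain (m : ℕ) (a b κ : ℝ) : IsCompact (tripleDomain m a b κ) := by
  have hc := (contDiff_latticeDist (m := m)).continuous
  refine (isCompact_cube.prod (isCompact_cube.prod (isCompact_cube.prod
    isCompact_Icc))).inter_right ?_
  exact (isClosed_le continuous_const (hc.comp (by fun_prop))).inter
    ((isClosed_le continuous_const (hc.comp (by fun_prop))).inter
      (isClosed_le continuous_const (hc.comp (by fun_prop))))

lemma isCompact_pairDomain (m : ℕ) (a b κ : ℝ) : IsCompact (pairDomain m a b κ) := by
  have hc := (contDiff_latticeDist (m := m)).continuous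
  refine (isCompact_cube.prod (isCompact_cube.prod isCompact_Icc)).inter_right ?_
  exact isClosed_le continuous_const (hc.comp (by fun_prop))

/-- If all maxima are nondegenerate, arbitrarily small perturbations in finitely many directions
remove triple maxima and make double maxima transversal. -/
lemma IsFamily.exists_perturbed_isGood (h : IsFamily Z P a b) (ℓ : W →L[ℝ] ℝ)
    (hℓ : ∀ τ ∈ Icc a b, ℓ (P τ) = τ) (hnd : ∀ τ ∈ Icc a b, AllMaxNondeg fun x => Z (x, P τ)) :
    ∃ s : Finset (TorusPair m), ∀ U ∈ 𝓝 (0 : s → ℝ), ∃ ξ ∈ U, ∀ τ ∈ Icc a b,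
      IsGood a b (fun x t => Resonance.perturbed Z ℓ s ξ (x, P t)) τ := by
  classical
  obtain ⟨ε, hε, hst⟩ := h.exists_uniform_stability hnd
  obtain ⟨κ, hκ, hlat⟩ := exists_latticeDist_lt (m := m) hε
  have hnot : ∀ {x y : Vec m}, κ ≤ latticeDist (y - x) → ¬ SameAngle x y := fun h1 h2 => by
    rw [latticeDist_eq_zero h2] at h1
    linarith
  -- Differentiating ℓ (P τ) = τ; this is what lets q₂ prescribe the speeds.
  have hℓ' : ∀ τ ∈ Icc a b, ℓ (derivWithin P (Icc a b) τ) = 1 := fun τ hτ => by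
    have h1 := (h.contDiffOn.differentiableOn (by norm_num) τ hτ).hasDerivWithinAt
    have h2 := ℓ.hasFDerivAt.comp_hasDerivWithinAt τ h1
    have h3 : HasDerivWithinAt (ℓ ∘ P) 1 (Icc a b) τ :=
      (hasDerivWithinAt_id τ _).congr (fun t ht => hℓ t ht) (hℓ τ hτ)
    exact (uniqueDiffOn_Icc h.lt τ hτ).eq_deriv _ h2 h3
  have hsub3 : tripleDomain m a b κ ⊆ univ ×ˢ (univ ×ˢ (univ ×ˢ Icc a b)) :=
    fun z hz => ⟨trivial, trivial, trivial, hz.1.2.2.2⟩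
  have hsub2 : pairDomain m a b κ ⊆ univ ×ˢ (univ ×ˢ Icc a b) :=
    fun z hz => ⟨trivial, trivial, hz.1.2.2⟩
  have hcd3 : ∀ q : TorusPair m, ContDiffOn ℝ 1 (tripleJet P (pert ℓ q.1))
      (univ ×ˢ (univ ×ˢ (univ ×ˢ Icc a b))) := fun q =>
    contDiffOn_tripleJet (contDiff_pert ℓ q 4) h.contDiffOn
  have hcd2 : ∀ q : TorusPair m, ContDiffOn ℝ 1 (pairJet P a b (pert ℓ q.1))
      (univ ×ˢ (univ ×ˢ Icc a b)) := fun q =>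
    contDiffOn_pairJet (contDiff_pert ℓ q 4) h.contDiffOn h.lt
  obtain ⟨s₃, hs₃⟩ := exists_finset_span_eq_top (isCompact_tripleDomain m a b κ)
    (fun q => (hcd3 q).continuousOn.mono hsub3) fun z hz y =>
      exists_tripleJet_pert_eq ℓ (hnot hz.2.1) (hnot hz.2.2.1) (hnot hz.2.2.2) y
  obtain ⟨s₂, hs₂⟩ := exists_finset_span_eq_top (isCompact_pairDomain m a b κ)
    (fun q => (hcd2 q).continuousOn.mono hsub2) fun z hz y =>
      exists_pairJet_pert_eq ℓ (hnot hz.2) (hℓ _ hz.1.2.2) (hℓ' _ hz.1.2.2) y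
  refine ⟨s₃ ∪ s₂, fun U hU => ?_⟩
  -- Three points and τ give 3m + 1 unknowns, against 3m gradient components and two differences of
  -- values.
  have hod3 := isOpen_and_dense_forall_ne_zero (ι := (s₃ ∪ s₂ : Finset (TorusPair m)))
    (convex_univ.prod (convex_univ.prod (convex_univ.prod (convex_Icc a b))))
    (contDiffOn_tripleJet h.contDiff h.contDiffOn) (fun k => hcd3 k.1) (by
      simp only [finrank_prod, finrank_euclideanSpace_fin, finrank_self, finrank_fin_fun]
      omega) (isCompact_tripleDomain m a b κ) hsub3 (hs₃ _ Finset.subset_union_left)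
  -- Two points and τ give 2m + 1 unknowns, against 2m gradient components, one difference of values
  -- and one of speeds.
  have hod2 := isOpen_and_dense_forall_ne_zero (ι := (s₃ ∪ s₂ : Finset (TorusPair m)))
    (convex_univ.prod (convex_univ.prod (convex_Icc a b)))
    (contDiffOn_pairJet h.contDiff h.contDiffOn h.lt) (fun k => hcd2 k.1) (by
      simp only [finrank_prod, finrank_euclideanSpace_fin, finrank_self, finrank_fin_fun]
      omega) (isCompact_pairDomain m a b κ) hsub2 (hs₂ _ Finset.subset_union_right)
  obtain ⟨ξ, ⟨hξ3, hξ2⟩, hξU, hξc⟩ := (hod3.2.inter_of_isOpen_left hod2.2 hod3.1).inter_nhds_nonempty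
    (inter_mem hU (h.exists_perturbed_c2Close ℓ (s₃ ∪ s₂) hε))
  have hfam := h.perturbed ℓ (s₃ ∪ s₂) ξ
  refine ⟨ξ, hξU, fun τ hτ => ?_⟩
  obtain ⟨hnd', hsep⟩ := hst τ hτ _ ((hfam.contDiff_slice (P τ)).of_le (by norm_num)) (hξc τ hτ)
  -- Inequivalent maxima stay κ-far apart, hence in the compact domains on which the jets span.
  have hfar : ∀ x y, IsGlobalMax (fun x => Resonance.perturbed Z ℓ (s₃ ∪ s₂) ξ (x, P τ)) x →
      IsGlobalMax (fun x => Resonance.perturbed Z ℓ (s₃ ∪ s₂) ξ (x, P τ)) y →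
      ¬ SameAngle x y → κ ≤ latticeDist (y - x) := fun x y hx hy hxy => by
    by_contra! hlt
    obtain ⟨k, hk⟩ := hlat _ hlt
    have h1 := hsep y (x + intVec k) hy
      ((hfam.periodic (P τ)).isGlobalMax hx (sameAngle_add_intVec x k)) (by rwa [← sub_sub])
    exact hxy (h1 ▸ sameAngle_add_intVec x k)
  refine ⟨hnd', fun x y z hx hy hz => ?_, fun x y hx hy hxy => ?_⟩
  · by_contra! hc
    obtain ⟨x', hx', hxx⟩ := exists_mem_cube x
    obtain ⟨y', hy', hyy⟩ := exists_mem_cube y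
    obtain ⟨z', hz', hzz⟩ := exists_mem_cube z
    have mx := (hfam.periodic (P τ)).isGlobalMax hx hxx
    have my := (hfam.periodic (P τ)).isGlobalMax hy hyy
    have mz := (hfam.periodic (P τ)).isGlobalMax hz hzz
    refine hξ3 (x', y', z', τ) ⟨⟨hx', hy', hz', hτ⟩,
      hfar _ _ mx my fun h' => hc.1 (hxx.trans (h'.trans hyy.symm)),
      hfar _ _ mx mz fun h' => hc.2.1 (hxx.trans (h'.trans hzz.symm)),
      hfar _ _ my mz fun h' => hc.2.2 (hyy.trans (h'.trans hzz.symm))⟩ ?_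
    rw [← tripleJet_perturbed h.contDiff]
    exact Prod.ext (hfam.gradJet_eq_zero mx) (Prod.ext (hfam.gradJet_eq_zero my)
      (Prod.ext (hfam.gradJet_eq_zero mz) (Prod.ext (sub_eq_zero.2 (mx.eq my))
        (sub_eq_zero.2 (mx.eq mz)))))
  · rw [hfam.derivWithin_eq x hτ, hfam.derivWithin_eq y hτ]
    intro hsp
    obtain ⟨x', hx', hxx⟩ := exists_mem_cube x
    obtain ⟨y', hy', hyy⟩ := exists_mem_cube y
    have mx := (hfam.periodic (P τ)).isGlobalMax hx hxx
    have my := (hfam.periodic (P τ)).isGlobalMax hy hyy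
    refine hξ2 (x', y', τ) ⟨⟨hx', hy', hτ⟩,
      hfar _ _ mx my fun h' => hxy (hxx.trans (h'.trans hyy.symm))⟩ ?_
    rw [← pairJet_perturbed h.contDiff]
    refine Prod.ext (hfam.gradJet_eq_zero mx) (Prod.ext (hfam.gradJet_eq_zero my)
      (Prod.ext (sub_eq_zero.2 (mx.eq my)) (sub_eq_zero.2 ?_)))
    change speed _ P a b x' τ = speed _ P a b y' τ
    rw [hfam.speed_eq_of_sameAngle hxx hτ, hfam.speed_eq_of_sameAngle hyy hτ, hsp]

end Density

/-! ### Smoothness of continuous solutions of implicit equations. -/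

section ImplicitFunctions

/-- A continuous solution of an implicit equation is as smooth as the equation. -/
lemma contDiffWithinAt_of_implicit {X E₁ E₂ F : Type*} [NormedAddCommGroup X] [NormedSpace ℝ X]
    [NormedAddCommGroup E₁] [NormedSpace ℝ E₁] [CompleteSpace E₁]
    [NormedAddCommGroup E₂] [NormedSpace ℝ E₂] [CompleteSpace E₂]
    [NormedAddCommGroup F] [NormedSpace ℝ F] [CompleteSpace F]
    {S : Set X} {t₀ : X} (ht₀ : t₀ ∈ S) {u : X → E₁} {x : X → E₂} {f : E₁ × E₂ → F} {n : ℕ}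
    (hn : n ≠ 0) (hf : ContDiffAt ℝ n f (u t₀, x t₀))
    (hinv : (fderiv ℝ f (u t₀, x t₀) ∘L .inr ℝ E₁ E₂).IsInvertible)
    (hu : ContDiffWithinAt ℝ n u S t₀) (hx : ContinuousWithinAt x S t₀)
    (h0 : ∀ t ∈ S, f (u t, x t) = 0) : ContDiffWithinAt ℝ n x S t₀ := by
  have hn' : (n : WithTop ℕ∞) ≠ 0 := by exact_mod_cast hn
  have h1 : Tendsto (fun t => (u t, x t)) (𝓝[S] t₀) (𝓝 (u t₀, x t₀)) :=
    hu.continuousWithinAt.prodMk_nhds hx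
  have h2 := h1.eventually (hf.eventually_apply_eq_iff_implicitFunction hn' hinv)
  have h3 : ContDiffWithinAt ℝ n (fun t => hf.implicitFunction hn' hinv (u t)) S t₀ :=
    (hf.contDiffAt_implicitFunction hn' hinv).comp_contDiffWithinAt t₀ hu
  refine h3.congr_of_eventuallyEq ?_ (hf.implicitFunction_apply_self hn' hinv).symm
  filter_upwards [h2, self_mem_nhdsWithin] with t ht htS
  exact (ht.1 (by rw [h0 t htS, h0 t₀ ht₀])).symm

lemma isInvertible_of_apply_self_ne_zero {m : ℕ} {A : Vec m →L[ℝ] Vec m →L[ℝ] ℝ}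
    (h : ∀ v, v ≠ 0 → A v v ≠ 0) : A.IsInvertible := by
  have hinj : Function.Injective (A : Vec m →ₗ[ℝ] Vec m →L[ℝ] ℝ) := by
    rw [injective_iff_map_eq_zero]
    intro v hv
    by_contra hne
    refine h v hne ?_
    have hv' : A v = 0 := hv
    rw [hv']; rfl
  have hdim : finrank ℝ (Vec m) = finrank ℝ (Vec m →L[ℝ] ℝ) := by
    rw [← (LinearMap.toContinuousLinearMap (𝕜 := ℝ) (E := Vec m) (F' := ℝ)).finrank_eq,
      Module.finrank_linearMap_self]
  refine ⟨(LinearEquiv.ofInjectiveOfFinrankEq _ hinj hdim).toContinuousLinearEquiv, ?_⟩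
  ext v w
  rfl

/-- The partial derivative in θ of the critical point equation is the Hessian, and a definite form
is invertible. Working within `S` covers the ends of the interval. -/
lemma contDiffWithinAt_branch {m : ℕ} {W : Type} [NormedAddCommGroup W] [NormedSpace ℝ W]
    [CompleteSpace W] {Z : Vec m × W → ℝ} {P : ℝ → W} {n : ℕ} (hn : n ≠ 0)
    (hZ : ContDiff ℝ (n + 1) Z) {S : Set ℝ} {τ₀ : ℝ} (hτ₀ : τ₀ ∈ S)
    (hP : ContDiffWithinAt ℝ n P S τ₀) {θ : ℝ → Vec m} (hθ : ContinuousWithinAt θ S τ₀)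
    (hcrit : ∀ τ ∈ S, fderiv ℝ (fun x => Z (x, P τ)) (θ τ) = 0)
    (hnd : IsNondegMax (fun x => Z (x, P τ₀)) (θ τ₀)) : ContDiffWithinAt ℝ n θ S τ₀ := by
  have hd : Differentiable ℝ Z := hZ.differentiable (by positivity)
  have h1 : ContDiff ℝ n (fderiv ℝ Z) := hZ.fderiv_right le_rfl
  have hswap : ContDiff ℝ n (fun z : W × Vec m => (z.2, z.1)) := contDiff_snd.prodMk contDiff_fst
  have h2 : ContDiff ℝ n (fun z : W × Vec m =>
      (fderiv ℝ Z (z.2, z.1)).comp (ContinuousLinearMap.inl ℝ (Vec m) W)) :=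
    (h1.comp hswap).clm_comp contDiff_const
  have hgrad : ∀ x p, fderiv ℝ (fun x => Z (x, p)) x =
      (fderiv ℝ Z (x, p)).comp (ContinuousLinearMap.inl ℝ (Vec m) W) := fun x p =>
    ((hd (x, p)).hasFDerivAt.comp x (hasFDerivAt_prodMk_left x p)).fderiv
  have hn' : (n : WithTop ℕ∞) ≠ 0 := by exact_mod_cast hn
  refine contDiffWithinAt_of_implicit (u := P) (x := θ) hτ₀ hn h2.contDiffAt ?_ hP hθ
    fun τ hτ => (hgrad _ _).symm.trans (hcrit τ hτ)
  refine isInvertible_of_apply_self_ne_zero fun v hv => ?_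
  have h3 : (fderiv ℝ (fun z : W × Vec m => (fderiv ℝ Z (z.2, z.1)).comp
      (ContinuousLinearMap.inl ℝ (Vec m) W)) (P τ₀, θ τ₀) ∘L .inr ℝ W (Vec m)) =
      fderiv ℝ (fderiv ℝ (fun x => Z (x, P τ₀))) (θ τ₀) := by
    rw [funext fun x => hgrad x (P τ₀)]
    exact ((h2.differentiable hn' (P τ₀, θ τ₀)).hasFDerivAt.comp (θ τ₀)
      (hasFDerivAt_prodMk_right (P τ₀) (θ τ₀))).fderiv.symm
  rw [h3, ← hessian_eq]
  exact (hnd v hv).ne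

end ImplicitFunctions

/-! ### Smoothness of the resonance curve. -/

section ResonanceCurve

variable {m : ℕ}

/-- The slow part of a vector. -/
def slowL (m : ℕ) : Vec (m + 1) →L[ℝ] Vec m :=
  ((EuclideanSpace.equiv (Fin m) ℝ).symm : (Fin m → ℝ) →L[ℝ] Vec m).comp
    (ContinuousLinearMap.pi fun i : Fin m => EuclideanSpace.proj (𝕜 := ℝ) (i.castSucc))

lemma slowL_apply (p : Vec (m + 1)) (i : Fin m) : slowL m p i = p i.castSucc := rfl

/-- The last coordinate of a vector. -/
def lastL (m : ℕ) : Vec (m + 1) →L[ℝ] ℝ := EuclideanSpace.proj (𝕜 := ℝ) (Fin.last m)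

@[simp] lemma slowL_join (x : Vec m) (y : ℝ) : slowL m (join x y) = x := by
  ext i; rw [slowL_apply, join_castSucc]

@[simp] lemma lastL_join (x : Vec m) (y : ℝ) : lastL m (join x y) = y := join_last x y

variable {q : ℕ} {O : Set (Vec (m + 1))} {H₀ : Vec (m + 1) → ℝ} {amin amax : ℝ}
  {pstar : ℝ → Vec m}

lemma isCompact_resonance (hq : 1 ≤ q) (hO : IsOpen O)
    (hBO : Metric.closedBall (0 : Vec (m + 1)) 1 ⊆ O) (hH₀ : ContDiffOn ℝ q H₀ O) :
    IsCompact (resonance H₀) := by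
  have hc : ContinuousOn (fderiv ℝ H₀) (Metric.closedBall 0 1) :=
    (hH₀.continuousOn_fderiv_of_isOpen hO (by exact_mod_cast hq)).mono hBO
  have h1 : IsClosed (Metric.closedBall (0 : Vec (m + 1)) 1 ∩
      (fun p => fun i : Fin m => fderiv ℝ H₀ p (EuclideanSpace.single i.castSucc 1)) ⁻¹' {0}) :=
    (continuousOn_pi.2 fun i => hc.clm_apply continuousOn_const).preimage_isClosed_of_isClosed
      Metric.isClosed_closedBall isClosed_singleton
  refine ((isCompact_closedBall (0 : Vec (m + 1)) 1).inter_left h1).of_isClosed_subset ?_ ?_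
  · convert! h1 using 1
    exact Subset.antisymm (fun p hp => ⟨hp.1, funext hp.2⟩)
      fun p hp => ⟨hp.1, fun i => congrFun hp.2 i⟩
  · rintro p ⟨hp, hp'⟩
    exact ⟨⟨hp, funext hp'⟩, hp⟩

lemma join_mem_resonance (hΓ : resonance H₀ = (fun τ => join (pstar τ) τ) '' Icc amin amax)
    {τ : ℝ} (hτ : τ ∈ Icc amin amax) : join (pstar τ) τ ∈ resonance H₀ :=
  hΓ ▸ mem_image_of_mem _ hτ

/-- No regularity of `pstar` is given: the resonance is a compact graph over τ, so the preimage of a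
closed set is the projection of a compact set. -/
lemma continuousOn_pstar (hK : IsCompact (resonance H₀))
    (hΓ : resonance H₀ = (fun τ => join (pstar τ) τ) '' Icc amin amax) :
    ContinuousOn pstar (Icc amin amax) := by
  rw [continuousOn_iff_isClosed]
  intro C hC
  refine ⟨lastL m '' (resonance H₀ ∩ slowL m ⁻¹' C),
    ((hK.inter_right (hC.preimage (slowL m).continuous)).image (lastL m).continuous).isClosed, ?_⟩
  ext τ
  constructor
  · rintro ⟨h1, h2⟩
    exact ⟨⟨_, ⟨join_mem_resonance hΓ h2, by simpa using h1⟩, lastL_join _ _⟩, h2⟩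
  · rintro ⟨⟨p, ⟨hp, hpC⟩, rfl⟩, h2⟩
    rw [hΓ] at hp
    obtain ⟨τ', -, rfl⟩ := hp
    simp only [lastL_join, mem_preimage, slowL_join] at hpC ⊢
    exact ⟨hpC, by simpa using h2⟩

/-- The Hessian of `H₀` restricted to slow directions stays positive definite, so the resonance
equation can be solved for the slow action, with the regularity of the gradient of `H₀`. -/
lemma contDiffOn_pstar (hq : 2 ≤ q) (hO : IsOpen O)
    (hBO : Metric.closedBall (0 : Vec (m + 1)) 1 ⊆ O) (hH₀ : ContDiffOn ℝ q H₀ O)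
    (hconvex : ∀ p ∈ Metric.closedBall (0 : Vec (m + 1)) 1, ∀ v, v ≠ 0 → 0 < hessian H₀ p v)
    (hΓ : resonance H₀ = (fun τ => join (pstar τ) τ) '' Icc amin amax) :
    ContDiffOn ℝ (q - 1 : ℕ) pstar (Icc amin amax) := by
  intro τ hτ
  have hpt := join_mem_resonance hΓ hτ
  have hcd : ContDiffAt ℝ q H₀ (join (pstar τ) τ) :=
    hH₀.contDiffAt (hO.mem_nhds (hBO hpt.1))
  have hcd1 : ContDiffAt ℝ (q - 1 : ℕ) (fderiv ℝ H₀) (join (pstar τ) τ) :=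
    hcd.fderiv_right (by norm_cast; omega)
  let J : ℝ × Vec m →L[ℝ] Vec (m + 1) :=
    (joinL m).comp ((ContinuousLinearMap.snd ℝ ℝ (Vec m)).prod (ContinuousLinearMap.fst ℝ ℝ (Vec m)))
  have hJ : ∀ y x, J (y, x) = join x y := fun y x => joinL_apply x y
  let I : Vec m →L[ℝ] Vec (m + 1) := J.comp (ContinuousLinearMap.inr ℝ ℝ (Vec m))
  have hI : ∀ x, I x = join x 0 := fun x => hJ 0 x
  have hf : ContDiffAt ℝ (q - 1 : ℕ) (fun z : ℝ × Vec m => (fderiv ℝ H₀ (J z)).comp I)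
      (τ, pstar τ) := by
    refine ContDiffAt.clm_comp (ContDiffAt.comp (τ, pstar τ) ?_ J.contDiff.contDiffAt)
      contDiffAt_const
    rwa [hJ]
  have hq1 : q - 1 ≠ 0 := by omega
  refine contDiffWithinAt_of_implicit (u := fun t : ℝ => t) hτ hq1 hf ?_ contDiffWithinAt_id
    (continuousOn_pstar (isCompact_resonance (by omega) hO hBO hH₀) hΓ τ hτ) fun t ht => ?_
  · refine isInvertible_of_apply_self_ne_zero fun v hv => ?_
    have h1 : HasFDerivAt (fun z : ℝ × Vec m => fderiv ℝ H₀ (J z))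
        ((fderiv ℝ (fderiv ℝ H₀) (join (pstar τ) τ)).comp J) (τ, pstar τ) := by
      refine HasFDerivAt.comp (τ, pstar τ) ?_ J.hasFDerivAt
      rw [hJ]
      exact (hcd1.differentiableAt (by exact_mod_cast hq1)).hasFDerivAt
    have h2 : HasFDerivAt (fun z : ℝ × Vec m => (fderiv ℝ H₀ (J z)).comp I)
        (((ContinuousLinearMap.compL ℝ (Vec m) (Vec (m + 1)) ℝ).flip I).comp
          ((fderiv ℝ (fderiv ℝ H₀) (join (pstar τ) τ)).comp J)) (τ, pstar τ) :=
      ((ContinuousLinearMap.compL ℝ (Vec m) (Vec (m + 1)) ℝ).flip I).hasFDerivAt.comp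
        (τ, pstar τ) h1
    rw [h2.fderiv]
    have h3 : (0 : ℝ) < hessian H₀ (join (pstar τ) τ) (I v) := hconvex _ hpt.1 _ fun h => hv (by
      rw [hI] at h
      rw [← slowL_join v 0, h, map_zero])
    rw [hessian_eq] at h3
    exact h3.ne'
  · change (fderiv ℝ H₀ (J (t, pstar t))).comp I = 0
    rw [hJ]
    ext v
    have h1 := (join_mem_resonance hΓ ht).2
    rw [vec_eq_sum v, map_sum]
    refine Finset.sum_eq_zero fun i _ => ?_
    rw [map_smul]
    have : I (EuclideanSpace.single i 1) = EuclideanSpace.single i.castSucc 1 := by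
      rw [hI, join_single_zero]
    rw [ContinuousLinearMap.comp_apply, this, h1 i, smul_zero]

end ResonanceCurve

/-! ### Branches of nondegenerate local maxima: translation and gluing. -/

section Branches

variable {m : ℕ}

/-- A continuous branch of nondegenerate local maxima. -/
structure IsBranch (F : Vec m → ℝ → ℝ) (S : Set ℝ) (c : ℝ) (θ : ℝ → Vec m) : Prop where
  continuousOn : ContinuousOn θ S
  isLocalMax : ∀ τ ∈ S, IsLocalMax (F · τ) (θ τ)
  hessian_le : ∀ τ ∈ S, ∀ v, hessian (F · τ) (θ τ) v ≤ -c * ‖v‖ ^ 2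

/-- `x` is the only global maximum on the torus. -/
def IsUniqueMax (f : Vec m → ℝ) (x : Vec m) : Prop :=
  IsGlobalMax f x ∧ ∀ y, IsGlobalMax f y → SameAngle x y

variable {F : Vec m → ℝ → ℝ} {S S' : Set ℝ} {c c' : ℝ} {θ θ' : ℝ → Vec m}

lemma IsBranch.mono (h : IsBranch F S c θ) (hS : S' ⊆ S) (hc : c' ≤ c) : IsBranch F S' c' θ where
  continuousOn := h.continuousOn.mono hS
  isLocalMax τ hτ := h.isLocalMax τ (hS hτ)
  hessian_le τ hτ v := (h.hessian_le τ (hS hτ) v).trans (by nlinarith [sq_nonneg ‖v‖])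

lemma IsBranch.add_intVec (h : IsBranch F S c θ) (hF : ∀ τ, TorusPeriodic (F · τ))
    (k : Fin m → ℤ) : IsBranch F S c (fun τ => θ τ + intVec k) where
  continuousOn := h.continuousOn.add continuousOn_const
  isLocalMax τ hτ := by
    have h1 := h.isLocalMax τ hτ
    have h2 : Tendsto (fun x : Vec m => x - intVec k) (𝓝 (θ τ + intVec k)) (𝓝 (θ τ)) := by
      have : ContinuousAt (fun x : Vec m => x - intVec k) (θ τ + intVec k) := by fun_prop
      simpa [ContinuousAt] using this
    filter_upwards [h2.eventually h1] with x hx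
    change F x τ ≤ F (θ τ + intVec k) τ
    rw [(hF τ).eq_of_sameAngle (sameAngle_add_intVec (θ τ) k)]
    rwa [← (hF τ).eq_of_sameAngle (sameAngle_sub_intVec x k)]
  hessian_le τ hτ v := by
    rw [(hF τ).hessian (sameAngle_add_intVec (θ τ) k)]
    exact h.hessian_le τ hτ v

lemma IsBranch.glue {t : ℝ} (h : IsBranch F (S ∩ Iic t) c θ) (h' : IsBranch F (S ∩ Ici t) c' θ')
    (ht : θ t = θ' t) :
    IsBranch F S (min c c') (fun τ => if τ ≤ t then θ τ else θ' τ) := by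
  have e1 : EqOn (fun τ => if τ ≤ t then θ τ else θ' τ) θ (Iic t) := fun τ hτ =>
    if_pos (mem_Iic.1 hτ)
  have e2 : EqOn (fun τ => if τ ≤ t then θ τ else θ' τ) θ' (Ici t) := fun τ hτ => by
    rcases eq_or_lt_of_le (mem_Ici.1 hτ) with rfl | h0
    · exact (if_pos le_rfl).trans ht
    · exact if_neg (not_le.2 h0)
  have h1 := h.mono subset_rfl (min_le_left c c')
  have h2 := h'.mono subset_rfl (min_le_right c c')
  refine ⟨fun τ hτ => ?_, fun τ hτ => ?_, fun τ hτ => ?_⟩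
  · have hS : S = (S ∩ Iic t) ∪ (S ∩ Ici t) := by
      rw [← inter_union_distrib_left, Iic_union_Ici, inter_univ]
    have hex : ∀ {A : Set ℝ} {φ : ℝ → Vec m}, IsClosed A → ContinuousOn φ (S ∩ A) →
        EqOn (fun τ => if τ ≤ t then θ τ else θ' τ) φ A →
        ContinuousWithinAt (fun τ => if τ ≤ t then θ τ else θ' τ) (S ∩ A) τ := by
      intro A φ hA hφ he
      by_cases hτA : τ ∈ A
      · exact (hφ τ ⟨hτ, hτA⟩).congr (fun x hx => he hx.2) (he hτA)
      · refine continuousWithinAt_of_notMem_closure fun hcl => hτA ?_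
        exact hA.closure_subset (closure_mono inter_subset_right hcl)
    rw [hS, continuousWithinAt_union]
    exact ⟨hex isClosed_Iic h1.continuousOn e1, hex isClosed_Ici h2.continuousOn e2⟩
  · rcases le_total τ t with h0 | h0
    · rw [show (if τ ≤ t then θ τ else θ' τ) = θ τ from e1 h0]
      exact h1.isLocalMax τ ⟨hτ, h0⟩
    · rw [show (if τ ≤ t then θ τ else θ' τ) = θ' τ from e2 h0]
      exact h2.isLocalMax τ ⟨hτ, h0⟩
  · rcases le_total τ t with h0 | h0
    · rw [show (if τ ≤ t then θ τ else θ' τ) = θ τ from e1 h0]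
      exact h1.hessian_le τ ⟨hτ, h0⟩
    · rw [show (if τ ≤ t then θ τ else θ' τ) = θ' τ from e2 h0]
      exact h2.hessian_le τ ⟨hτ, h0⟩

end Branches

/-! ### Existence and smoothness of branches. -/

section LocalBranches

variable {m : ℕ} {W : Type} [NormedAddCommGroup W] [NormedSpace ℝ W]
  {Z : Vec m × W → ℝ} {P : ℝ → W} {a b : ℝ}

/-- Nondegenerate global maxima continue to branches of strict local maxima. -/
lemma IsFamily.exists_branch (h : IsFamily Z P a b) {τ₀ : ℝ} (hτ₀ : τ₀ ∈ Icc a b)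
    (hnd : AllMaxNondeg fun x => Z (x, P τ₀)) :
    ∃ c > 0, ∃ ρ > 0, ∃ δ > 0, ∀ y, IsGlobalMax (fun x => Z (x, P τ₀)) y → ∃ φ : ℝ → Vec m,
      IsBranch (fun x t => Z (x, P t)) (Icc a b ∩ Metric.ball τ₀ δ) c φ ∧ φ τ₀ = y ∧
      ∀ τ ∈ Icc a b ∩ Metric.ball τ₀ δ, ∀ x, ‖x - y‖ ≤ ρ →
        Z (x, P τ) ≤ Z (φ τ, P τ) - c / 2 * ‖x - φ τ‖ ^ 2 := by
  have hC2 : ∀ p, ContDiff ℝ 2 fun x => Z (x, p) := fun p =>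
    (h.contDiff_slice p).of_le (by norm_num)
  obtain ⟨ε, hε, c, hc, ρ, hρ, hst⟩ := exists_stable (hC2 (P τ₀)) (h.periodic _) hnd
  have hPc : ∀ τ₁ ∈ Icc a b, Tendsto P (𝓝[Icc a b] τ₁) (𝓝 (P τ₁)) := fun τ₁ hτ₁ =>
    h.contDiffOn.continuousOn τ₁ hτ₁
  -- On the boundary of the ball the function at τ₀ has dropped by c ρ² / 2, more than two errors of
  -- c ρ² / 8 can undo; so the maximum over the ball is interior.
  have hε' : 0 < min ε (c * ρ ^ 2 / 8) := by positivity
  obtain ⟨δ, hδ, hball⟩ := Metric.mem_nhdsWithin_iff.1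
    ((hPc τ₀ hτ₀).eventually (h.eventually_c2Close (P τ₀) hε'))
  refine ⟨c, hc, ρ, hρ, δ, hδ, fun y hy => ?_⟩
  have hmax : ∀ τ, ∃ x ∈ Metric.closedBall y ρ, IsMaxOn (fun x => Z (x, P τ))
      (Metric.closedBall y ρ) x := fun τ =>
    (isCompact_closedBall y ρ).exists_isMaxOn ⟨y, by simpa using hρ.le⟩
      (hC2 (P τ)).continuous.continuousOn
  choose φ hφmem hφmax using hmax
  have hself : C2Close ε (fun x => Z (x, P τ₀)) (fun x => Z (x, P τ₀)) := fun x => by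
    simp only [sub_self, abs_zero]
    exact ⟨hε.le, fun v => by positivity⟩
  have hmemy : y ∈ Metric.closedBall y ρ := by simpa using hρ.le
  have hcl : ∀ τ ∈ Icc a b ∩ Metric.ball τ₀ δ,
      C2Close (min ε (c * ρ ^ 2 / 8)) (fun x => Z (x, P τ)) (fun x => Z (x, P τ₀)) :=
    fun τ hτ => hball ⟨hτ.2, hτ.1⟩
  have hhess : ∀ τ ∈ Icc a b ∩ Metric.ball τ₀ δ, ∀ z ∈ Metric.closedBall y ρ, ∀ v,
      hessian (fun x => Z (x, P τ)) z v ≤ -c * ‖v‖ ^ 2 := fun τ hτ z hz =>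
    (hst _ (hC2 _) ((hcl τ hτ).mono (min_le_left _ _))).1 y hy z (by rwa [← mem_closedBall_iff_norm])
  have hint : ∀ τ ∈ Icc a b ∩ Metric.ball τ₀ δ, ‖φ τ - y‖ < ρ := fun τ hτ => by
    have h1 := le_sub_of_hessian_le (hC2 (P τ₀)) (convex_closedBall y ρ)
      (fun z hz => (hst _ (hC2 _) hself).1 y hy z (by rwa [← mem_closedBall_iff_norm]))
      hmemy (hφmem τ) hy.fderiv_eq_zero
    have h2 : Z (y, P τ) ≤ Z (φ τ, P τ) := hφmax τ hmemy
    have h3 := abs_le.1 (((hcl τ hτ) y).1.trans (min_le_right _ _))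
    have h4 := abs_le.1 (((hcl τ hτ) (φ τ)).1.trans (min_le_right _ _))
    by_contra! hge
    have h5 : c * ρ ^ 2 ≤ c * ‖φ τ - y‖ ^ 2 := by gcongr
    have h6 : 0 < c * ρ ^ 2 := by positivity
    linarith [h3.1, h3.2, h4.1, h4.2]
  have hloc : ∀ τ ∈ Icc a b ∩ Metric.ball τ₀ δ, IsLocalMax (fun x => Z (x, P τ)) (φ τ) :=
    fun τ hτ => (hφmax τ).isLocalMax (Filter.mem_of_superset
      (Metric.isOpen_ball.mem_nhds (mem_ball_iff_norm.2 (hint τ hτ))) Metric.ball_subset_closedBall)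
  have hdrop : ∀ τ ∈ Icc a b ∩ Metric.ball τ₀ δ, ∀ x, ‖x - y‖ ≤ ρ →
      Z (x, P τ) ≤ Z (φ τ, P τ) - c / 2 * ‖x - φ τ‖ ^ 2 := fun τ hτ x hx =>
    le_sub_of_hessian_le (hC2 (P τ)) (convex_closedBall y ρ) (hhess τ hτ) (hφmem τ)
      (mem_closedBall_iff_norm.2 hx) (hloc τ hτ).fderiv_eq_zero
  refine ⟨φ, ⟨fun τ₁ hτ₁ => ?_, hloc, fun τ hτ v => hhess τ hτ _ (hφmem τ) v⟩, ?_, hdrop⟩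
  -- Continuity comes from the quadratic drop: a maximiser at distance η from φ τ₁ loses c η² / 2 at
  -- τ₁, which values within c η² / 8 cannot compensate.
  · rw [Metric.continuousWithinAt_iff']
    intro η hη
    have h1 := (hPc τ₁ hτ₁.1).eventually (h.eventually_c2Close (P τ₁)
      (show 0 < c * η ^ 2 / 8 by positivity))
    filter_upwards [nhdsWithin_mono _ inter_subset_left h1] with τ hτ
    have h2 : Z (φ τ₁, P τ) ≤ Z (φ τ, P τ) := hφmax τ (hφmem τ₁)
    have h3 := hdrop τ₁ hτ₁ (φ τ) (mem_closedBall_iff_norm.1 (hφmem τ))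
    have h4 := abs_le.1 (hτ (φ τ)).1
    have h5 := abs_le.1 (hτ (φ τ₁)).1
    rw [dist_eq_norm]
    by_contra! hge
    have h6 : c * η ^ 2 ≤ c * ‖φ τ - φ τ₁‖ ^ 2 := by gcongr
    have h7 : 0 < c * η ^ 2 := by positivity
    linarith [h4.1, h4.2, h5.1, h5.2]
  · have h1 := hdrop τ₀ ⟨hτ₀, Metric.mem_ball_self hδ⟩ y (by simpa using hρ.le)
    have h2 := hy (φ τ₀)
    by_contra hne
    have h3 : 0 < ‖y - φ τ₀‖ := norm_pos_iff.2 (sub_ne_zero.2 (Ne.symm hne))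
    have h4 : 0 < c / 2 * ‖y - φ τ₀‖ ^ 2 := by positivity
    linarith

variable [CompleteSpace W] {d : ℕ}

/-- Branches are as smooth as the equation of critical points. -/
lemma IsBranch.contDiffOn {S : Set ℝ} {c : ℝ} {θ : ℝ → Vec m}
    (hb : IsBranch (fun x t => Z (x, P t)) S c θ) (hc : 0 < c) (hd : d ≠ 0)
    (hZ : ContDiff ℝ (d + 1) Z) (hP : ContDiffOn ℝ d P (Icc a b)) (hS : S ⊆ Icc a b) :
    ContDiffOn ℝ d θ S := fun τ hτ =>
  contDiffWithinAt_branch hd hZ hτ ((hP τ (hS hτ)).mono hS) (hb.continuousOn τ hτ)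
    (fun t ht => (hb.isLocalMax t ht).fderiv_eq_zero) fun v hv => by
      have h1 := hb.hessian_le τ hτ v
      have h2 : 0 < c * ‖v‖ ^ 2 := by have := norm_pos_iff.2 hv; positivity
      linarith

/-- The value along a branch moves with the speed of the base point. -/
lemma IsBranch.hasDerivWithinAt (h : IsFamily Z P a b) {S : Set ℝ} {c : ℝ} {θ : ℝ → Vec m}
    (hb : IsBranch (fun x t => Z (x, P t)) S c θ) (hc : 0 < c) (hS : S ⊆ Icc a b) {τ : ℝ}
    (hτ : τ ∈ S) :
    HasDerivWithinAt (fun t => Z (θ t, P t)) (speed Z P a b (θ τ) τ) S τ := by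
  have h1 : ContDiffOn ℝ (1 : ℕ) θ S := hb.contDiffOn hc one_ne_zero
    (h.contDiff.of_le (by norm_num)) (h.contDiffOn.of_le (by norm_num)) hS
  have h2 := (h1.differentiableOn (by norm_num) τ hτ).hasDerivWithinAt
  have h3 := ((h.contDiffOn.differentiableOn (by norm_num) τ (hS hτ)).hasDerivWithinAt).mono hS
  have hd : Differentiable ℝ Z := h.contDiff.differentiable (by norm_num)
  have h4 := (hd (θ τ, P τ)).hasFDerivAt.comp_hasDerivWithinAt τ (h2.prodMk h3)
  -- Envelope argument: the motion of a critical point does not change the value to first order.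
  have h5 : fderiv ℝ Z (θ τ, P τ) (derivWithin θ S τ, 0) = 0 := by
    have h6 := (hb.isLocalMax τ hτ).fderiv_eq_zero
    have h7 : HasFDerivAt (fun x => Z (x, P τ))
        ((fderiv ℝ Z (θ τ, P τ)).comp (ContinuousLinearMap.inl ℝ (Vec m) W)) (θ τ) :=
      (hd (θ τ, P τ)).hasFDerivAt.comp (θ τ) (hasFDerivAt_prodMk_left (𝕜 := ℝ) (θ τ) (P τ))
    rw [h7.fderiv] at h6
    exact DFunLike.congr_fun h6 (derivWithin θ S τ)
  have h7 : fderiv ℝ Z (θ τ, P τ) (derivWithin θ S τ, derivWithin P (Icc a b) τ) =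
      speed Z P a b (θ τ) τ := by
    have : ((derivWithin θ S τ, derivWithin P (Icc a b) τ) : Vec m × W) =
      (derivWithin θ S τ, 0) + (0, derivWithin P (Icc a b) τ) := by simp
    rw [this, map_add, h5, zero_add, speed]
  rw [h7] at h4
  exact h4

end LocalBranches

/-! ### Global maxima near a good parameter value. -/

section LocalPictures

variable {m : ℕ} {W : Type} [NormedAddCommGroup W] [NormedSpace ℝ W]
  {Z : Vec m × W → ℝ} {P : ℝ → W} {a b : ℝ}

lemma eventually_neg_slope {D : ℝ → ℝ} {D' : ℝ} {S : Set ℝ} {τ₀ : ℝ}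
    (h : HasDerivWithinAt D D' S τ₀) (h0 : D τ₀ = 0) (hD : D' < 0) :
    ∀ᶠ τ in 𝓝[S] τ₀, (τ < τ₀ → 0 < D τ) ∧ (τ₀ < τ → D τ < 0) := by
  have h1 := (hasDerivWithinAt_iff_tendsto_slope.1 h).eventually (gt_mem_nhds hD)
  rw [eventually_nhdsWithin_iff] at h1 ⊢
  filter_upwards [h1] with τ hτ hτS
  have h2 : τ ≠ τ₀ → (τ - τ₀)⁻¹ * D τ < 0 := fun hne => by
    have := hτ ⟨hτS, hne⟩
    rwa [slope_def_module, h0, sub_zero, smul_eq_mul] at this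
  refine ⟨fun hlt => ?_, fun hlt => ?_⟩
  · exact pos_of_mul_neg_right (h2 hlt.ne) (inv_lt_zero.2 (sub_neg.2 hlt)).le
  · exact neg_of_mul_neg_right (h2 hlt.ne') (inv_pos.2 (sub_pos.2 hlt)).le

/-- The global maxima near `τ₀` are on a branch `φL` on the left and on a branch `φR` on the
right. -/
structure LocalPicture (Z : Vec m × W → ℝ) (P : ℝ → W) (a b τ₀ δ c : ℝ) (φL φR : ℝ → Vec m) :
    Prop where
  left : IsBranch (fun x t => Z (x, P t)) (Icc a b ∩ Metric.ball τ₀ δ) c φL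
  right : IsBranch (fun x t => Z (x, P t)) (Icc a b ∩ Metric.ball τ₀ δ) c φR
  unique_left : ∀ τ ∈ Icc a b ∩ Metric.ball τ₀ δ, τ < τ₀ →
    IsUniqueMax (fun x => Z (x, P τ)) (φL τ)
  unique_right : ∀ τ ∈ Icc a b ∩ Metric.ball τ₀ δ, τ₀ < τ →
    IsUniqueMax (fun x => Z (x, P τ)) (φR τ)
  center : (φL = φR ∧ IsUniqueMax (fun x => Z (x, P τ₀)) (φL τ₀)) ∨
    (AreTheTwoMaxima (fun x => Z (x, P τ₀)) (φL τ₀) (φR τ₀) ∧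
      speed Z P a b (φL τ₀) τ₀ ≠ speed Z P a b (φR τ₀) τ₀)

variable [CompleteSpace W]

/-- Nearby global maxima lie on the branches through the maxima at `τ₀`. With two branches the
difference of values has nonzero derivative at its zero, so it changes sign there and each side has
a unique winner. -/
lemma IsFamily.exists_localPicture (h : IsFamily Z P a b) {τ₀ : ℝ} (hτ₀ : τ₀ ∈ Icc a b)
    (hgood : IsGood a b (fun x t => Z (x, P t)) τ₀) :
    ∃ δ > 0, ∃ c > 0, ∃ φL φR, LocalPicture Z P a b τ₀ δ c φL φR := by
  obtain ⟨hnd, h3, hsp⟩ := hgood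
  obtain ⟨c, hc, ρ, hρ, δ, hδ, hbr⟩ := h.exists_branch hτ₀ hnd
  have hcont : ∀ p, Continuous fun x => Z (x, p) := fun p => (h.contDiff_slice p).continuous
  obtain ⟨ε, hε, hnear⟩ := exists_near_max (hcont (P τ₀)) (h.periodic (P τ₀)) hρ
  have hPc : Tendsto P (𝓝[Icc a b] τ₀) (𝓝 (P τ₀)) := h.contDiffOn.continuousOn τ₀ hτ₀
  have hclose : ∀ᶠ τ in 𝓝[Icc a b] τ₀, τ ∈ Icc a b ∩ Metric.ball τ₀ δ ∧
      ∀ x, IsGlobalMax (fun x => Z (x, P τ)) x →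
        ∃ y, IsGlobalMax (fun x => Z (x, P τ₀)) y ∧ ‖x - y‖ < ρ := by
    filter_upwards [hPc.eventually (h.eventually_c2Close (P τ₀) hε), self_mem_nhdsWithin,
      nhdsWithin_le_nhds (Metric.ball_mem_nhds τ₀ hδ)] with τ hτ hτ1 hτ2
    exact ⟨⟨hτ1, hτ2⟩, hnear _ fun x => (hτ x).1⟩
  have hcov : ∀ {y : Vec m} {φ : ℝ → Vec m}, (∀ τ ∈ Icc a b ∩ Metric.ball τ₀ δ, ∀ x, ‖x - y‖ ≤ ρ →
      Z (x, P τ) ≤ Z (φ τ, P τ) - c / 2 * ‖x - φ τ‖ ^ 2) →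
      ∀ τ ∈ Icc a b ∩ Metric.ball τ₀ δ, ∀ x, IsGlobalMax (fun x => Z (x, P τ)) x →
      ∀ y', ‖x - y'‖ < ρ → SameAngle y' y → SameAngle x (φ τ) := by
    intro y φ hdrop τ hτ x hx y' hxy hyy
    obtain ⟨z, hxz, hz⟩ := hyy.exists_shift x
    have h1 := hdrop τ hτ z (by rw [hz]; exact hxy.le)
    have h2 := (h.periodic (P τ)).isGlobalMax hx hxz (φ τ)
    have h4 : z = φ τ := by
      by_contra hne
      have h5 : 0 < ‖z - φ τ‖ := norm_pos_iff.2 (sub_ne_zero.2 hne)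
      have h6 : 0 < c / 2 * ‖z - φ τ‖ ^ 2 := by positivity
      linarith
    rwa [h4] at hxz
  -- The branch with the smaller speed is higher before `τ₀`, hence is the left one.
  have key : ∀ y₁ y₂, IsGlobalMax (fun x => Z (x, P τ₀)) y₁ →
      IsGlobalMax (fun x => Z (x, P τ₀)) y₂ → ¬ SameAngle y₁ y₂ →
      speed Z P a b y₁ τ₀ < speed Z P a b y₂ τ₀ →
      ∃ δ > 0, ∃ c > 0, ∃ φL φR, LocalPicture Z P a b τ₀ δ c φL φR := by
    intro y₁ y₂ hy₁ hy₂ hne hlt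
    obtain ⟨φ₁, hb₁, he₁, hd₁⟩ := hbr y₁ hy₁
    obtain ⟨φ₂, hb₂, he₂, hd₂⟩ := hbr y₂ hy₂
    have hmem : τ₀ ∈ Icc a b ∩ Metric.ball τ₀ δ := ⟨hτ₀, Metric.mem_ball_self hδ⟩
    have hD := (hb₁.hasDerivWithinAt h hc inter_subset_left hmem).sub
      (hb₂.hasDerivWithinAt h hc inter_subset_left hmem)
    have hev := eventually_neg_slope hD (by
      simp only [Pi.sub_apply]; rw [he₁, he₂]; exact sub_eq_zero.2 (hy₁.eq hy₂))
      (by rw [he₁, he₂]; linarith)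
    rw [inter_comm, nhdsWithin_inter_of_mem
      (nhdsWithin_le_nhds (Metric.ball_mem_nhds τ₀ hδ))] at hev
    obtain ⟨δ', hδ', hball⟩ := Metric.mem_nhdsWithin_iff.1 (hev.and hclose)
    have hall : ∀ τ ∈ Icc a b ∩ Metric.ball τ₀ δ', ∀ x, IsGlobalMax (fun x => Z (x, P τ)) x →
        SameAngle x (φ₁ τ) ∨ SameAngle x (φ₂ τ) := by
      intro τ hτ x hx
      obtain ⟨-, hτ1, hτ2⟩ := hball ⟨hτ.2, hτ.1⟩
      obtain ⟨y, hy, hxy⟩ := hτ2 x hx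
      rcases h3 y₁ y₂ y hy₁ hy₂ hy with h' | h' | h'
      · exact absurd h' hne
      · exact Or.inl (hcov hd₁ τ hτ1 x hx y hxy h'.symm)
      · exact Or.inr (hcov hd₂ τ hτ1 x hx y hxy h'.symm)
    have huniq : ∀ τ ∈ Icc a b ∩ Metric.ball τ₀ δ', ∀ φ ψ : ℝ → Vec m,
        (∀ x, IsGlobalMax (fun x => Z (x, P τ)) x → SameAngle x (φ τ) ∨ SameAngle x (ψ τ)) →
        Z (ψ τ, P τ) < Z (φ τ, P τ) → IsUniqueMax (fun x => Z (x, P τ)) (φ τ) := by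
      intro τ hτ φ ψ hφψ hlt
      have h1 : ∀ x, IsGlobalMax (fun x => Z (x, P τ)) x → SameAngle x (φ τ) := fun x hx =>
        (hφψ x hx).resolve_right fun h' =>
          hlt.not_ge ((h.periodic (P τ)).isGlobalMax hx h' (φ τ))
      obtain ⟨x, hx⟩ := (h.periodic (P τ)).exists_isGlobalMax (hcont _)
      exact ⟨(h.periodic (P τ)).isGlobalMax hx (h1 x hx), fun y hy => (h1 y hy).symm⟩
    have hsub : Icc a b ∩ Metric.ball τ₀ δ' ⊆ Icc a b ∩ Metric.ball τ₀ δ :=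
      fun τ hτ => (hball ⟨hτ.2, hτ.1⟩).2.1
    refine ⟨δ', hδ', c, hc, φ₁, φ₂, hb₁.mono hsub le_rfl, hb₂.mono hsub le_rfl,
      fun τ hτ hlt => huniq τ hτ φ₁ φ₂ (hall τ hτ) ?_,
      fun τ hτ hlt => huniq τ hτ φ₂ φ₁ (fun x hx => (hall τ hτ x hx).symm) ?_, Or.inr ⟨?_, ?_⟩⟩
    · have := (hball ⟨hτ.2, hτ.1⟩).1.1 hlt
      simpa using this
    · have := (hball ⟨hτ.2, hτ.1⟩).1.2 hlt
      simpa using this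
    · rw [he₁, he₂]
      refine ⟨hne, hy₁, hy₂, fun x hx => ?_⟩
      rcases h3 y₁ y₂ x hy₁ hy₂ hx with h' | h' | h'
      · exact absurd h' hne
      · exact Or.inl h'
      · exact Or.inr h'
    · rw [he₁, he₂]
      exact hlt.ne
  obtain ⟨y₁, hy₁⟩ := (h.periodic (P τ₀)).exists_isGlobalMax (hcont _)
  by_cases hall : ∀ y, IsGlobalMax (fun x => Z (x, P τ₀)) y → SameAngle y₁ y
  · obtain ⟨φ, hb, he, hd⟩ := hbr y₁ hy₁
    obtain ⟨δ', hδ', hball⟩ := Metric.mem_nhdsWithin_iff.1 hclose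
    have hsub : Icc a b ∩ Metric.ball τ₀ δ' ⊆ Icc a b ∩ Metric.ball τ₀ δ :=
      fun τ hτ => (hball ⟨hτ.2, hτ.1⟩).1
    have huniq : ∀ τ ∈ Icc a b ∩ Metric.ball τ₀ δ', IsUniqueMax (fun x => Z (x, P τ)) (φ τ) := by
      intro τ hτ
      have h1 : ∀ x, IsGlobalMax (fun x => Z (x, P τ)) x → SameAngle x (φ τ) := fun x hx => by
        obtain ⟨y, hy, hxy⟩ := (hball ⟨hτ.2, hτ.1⟩).2 x hx
        exact hcov hd τ (hsub hτ) x hx y hxy (hall y hy).symm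
      obtain ⟨x, hx⟩ := (h.periodic (P τ)).exists_isGlobalMax (hcont _)
      exact ⟨(h.periodic (P τ)).isGlobalMax hx (h1 x hx), fun y hy => (h1 y hy).symm⟩
    exact ⟨δ', hδ', c, hc, φ, φ, hb.mono hsub le_rfl, hb.mono hsub le_rfl,
      fun τ hτ _ => huniq τ hτ, fun τ hτ _ => huniq τ hτ,
      Or.inl ⟨rfl, huniq τ₀ ⟨hτ₀, Metric.mem_ball_self hδ'⟩⟩⟩
  · push Not at hall
    obtain ⟨y₂, hy₂, hne⟩ := hall
    have h4 := hsp y₁ y₂ hy₁ hy₂ hne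
    rw [h.derivWithin_eq _ hτ₀, h.derivWithin_eq _ hτ₀] at h4
    rcases lt_or_gt_of_ne h4 with h5 | h5
    · exact key y₁ y₂ hy₁ hy₂ hne h5
    · exact key y₂ y₁ hy₂ hy₁ (fun h' => hne h'.symm) h5

end LocalPictures

/-! ### Ordering a finite set of parameter values. -/

section Partitions

lemma exists_ordered_partition {a b : ℝ} (hab : a < b) {B : Set ℝ} (hB : B.Finite)
    (hsub : B ⊆ Ioo a b) : ∃ s, 0 < s ∧ ∃ α : ℕ → ℝ, α 0 = a ∧ α s = b ∧
      (∀ i j, i < j → j ≤ s → α i < α j) ∧ ∀ τ, τ ∈ B ↔ ∃ j, 0 < j ∧ j < s ∧ α j = τ := by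
  classical
  obtain ⟨T, hT⟩ : ∃ T : Finset ℝ, T = insert a (insert b hB.toFinset) := ⟨_, rfl⟩
  have hmemT : ∀ x, x ∈ T ↔ x = a ∨ x = b ∨ x ∈ B := by simp [hT]
  have hcard : 1 < T.card := Finset.one_lt_card.2
    ⟨a, (hmemT a).2 (Or.inl rfl), b, (hmemT b).2 (Or.inr (Or.inl rfl)), hab.ne⟩
  obtain ⟨s, hs⟩ : ∃ s, T.card = s + 1 := ⟨T.card - 1, by omega⟩
  let e := T.orderEmbOfFin hs
  have hrange : ∀ x ∈ T, ∃ i, e i = x := fun x hx => by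
    have : x ∈ range e := by rw [Finset.range_orderEmbOfFin]; exact hx
    exact this
  have hin : ∀ i, e i ∈ T := fun i => Finset.orderEmbOfFin_mem T hs i
  have hbd : ∀ x ∈ T, a ≤ x ∧ x ≤ b := fun x hx => by
    rcases (hmemT x).1 hx with rfl | rfl | h
    · exact ⟨le_rfl, hab.le⟩
    · exact ⟨hab.le, le_rfl⟩
    · exact ⟨(hsub h).1.le, (hsub h).2.le⟩
  have h0 : e 0 = a := by
    obtain ⟨i, hi⟩ := hrange a ((hmemT a).2 (Or.inl rfl))
    exact le_antisymm (hi ▸ e.monotone (Fin.zero_le i)) (hbd _ (hin 0)).1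
  have hl : e (Fin.last s) = b := by
    obtain ⟨i, hi⟩ := hrange b ((hmemT b).2 (Or.inr (Or.inl rfl)))
    exact le_antisymm (hbd _ (hin _)).2 (hi ▸ e.monotone (Fin.le_last i))
  -- The default value 0 past the index s is never used.
  refine ⟨s, by omega, fun j => if hj : j < s + 1 then e ⟨j, hj⟩ else 0, by simpa using h0, ?_,
    fun i j hij hj => ?_, fun τ => ⟨fun hτ => ?_, ?_⟩⟩
  · simpa [Fin.last] using hl
  · beta_reduce
    rw [dif_pos (by omega), dif_pos (by omega)]
    exact e.strictMono hij
  · obtain ⟨i, rfl⟩ := hrange τ ((hmemT τ).2 (Or.inr (Or.inr hτ)))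
    refine ⟨i, ?_, ?_, dif_pos i.2⟩
    · rw [Nat.pos_iff_ne_zero]
      intro hi
      have : i = 0 := Fin.ext hi
      rw [this, h0] at hτ
      exact lt_irrefl _ (hsub hτ).1
    · refine lt_of_le_of_ne (Nat.lt_succ_iff.1 i.2) fun hi => ?_
      have : i = Fin.last s := Fin.ext hi
      rw [this, hl] at hτ
      exact lt_irrefl _ (hsub hτ).2
  · rintro ⟨j, hj, hjs, rfl⟩
    beta_reduce
    rw [dif_pos (by omega)]
    rcases (hmemT _).1 (hin ⟨j, by omega⟩) with h | h | h
    · rw [← h0] at h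
      have := congrArg Fin.val (e.injective h)
      simp at this
      omega
    · rw [← hl] at h
      have := congrArg Fin.val (e.injective h)
      simp at this
      omega
    · exact h

lemma exists_pos_le_of_lt (s : ℕ) (f : ℕ → ℝ) (hf : ∀ j < s, 0 < f j) :
    ∃ c > 0, ∀ j < s, c ≤ f j := by
  induction s with
  | zero => exact ⟨1, one_pos, fun j hj => absurd hj (Nat.not_lt_zero j)⟩
  | succ s ih =>
    obtain ⟨c, hc, h⟩ := ih fun j hj => hf j (hj.trans (Nat.lt_succ_self s))
    refine ⟨min c (f s), lt_min hc (hf s (Nat.lt_succ_self s)), fun j hj => ?_⟩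
    rcases Nat.lt_succ_iff_lt_or_eq.1 hj with h' | rfl
    · exact (min_le_left _ _).trans (h j h')
    · exact min_le_right _ _

end Partitions

/-! ### Joining local branches along an interval. -/

section Chains

variable {m : ℕ} {F : Vec m → ℝ → ℝ}

/-- Local branches that are unique up to integer translations can be joined over an interval. -/
lemma exists_branch_of_local (hF : ∀ τ, TorusPeriodic (F · τ)) {α β : ℝ} (hαβ : α ≤ β)
    {G : ℝ → Vec m → Prop} (hinv : ∀ τ x k, G τ x → G τ (x + intVec k))
    (huniq : ∀ τ ∈ Icc α β, ∀ x y, G τ x → G τ y → SameAngle x y)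
    (hloc : ∀ τ₀ ∈ Icc α β, ∃ δ > 0, ∃ c > 0, ∃ ψ,
      IsBranch F (Icc α β ∩ Metric.ball τ₀ δ) c ψ ∧ ∀ τ ∈ Icc α β ∩ Metric.ball τ₀ δ, G τ (ψ τ)) :
    ∃ c > 0, ∃ θ, IsBranch F (Icc α β) c θ ∧ ∀ τ ∈ Icc α β, G τ (θ τ) := by
  choose! δ hδ c hc ψ hψ hG using hloc
  -- A monotone subdivision reaching β at step N, each piece inside one ball that carries a local
  -- branch.
  obtain ⟨t, ht0, htm, ⟨N, hN⟩, hcov⟩ := exists_monotone_Icc_subset_open_cover_Icc hαβ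
    (c := fun τ₀ : Icc α β => Metric.ball τ₀ (δ τ₀)) (fun _ => Metric.isOpen_ball)
    fun τ _ => mem_iUnion.2 ⟨τ, Metric.mem_ball_self (hδ τ τ.2)⟩
  have hcov' : ∀ n, ∃ τ₀ : Icc α β,
      Icc (t n : ℝ) (t (n + 1)) ⊆ Icc α β ∩ Metric.ball (τ₀ : ℝ) (δ τ₀) := fun n => by
    obtain ⟨i, hi⟩ := hcov n
    refine ⟨i, fun τ hτ => ?_⟩
    have h1 : τ ∈ Icc α β := ⟨(t n).2.1.trans hτ.1, hτ.2.trans (t (n + 1)).2.2⟩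
    exact ⟨h1, hi (show (⟨τ, h1⟩ : Icc α β) ∈ Icc (t n) (t (n + 1)) from ⟨hτ.1, hτ.2⟩)⟩
  have hind : ∀ n, ∃ c > 0, ∃ θ, IsBranch F (Icc α (t n)) c θ ∧
      ∀ τ ∈ Icc α (t n : ℝ), G τ (θ τ) := by
    intro n
    induction n with
    | zero =>
      have hα : α ∈ Icc α β := left_mem_Icc.2 hαβ
      have hsub : Icc α (t 0 : ℝ) ⊆ Icc α β ∩ Metric.ball α (δ α) := by
        rw [ht0, Icc_self, singleton_subset_iff]
        exact ⟨hα, Metric.mem_ball_self (hδ α hα)⟩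
      exact ⟨c α, hc α hα, ψ α, (hψ α hα).mono hsub le_rfl, fun τ hτ => hG α hα τ (hsub hτ)⟩
    | succ n ih =>
      obtain ⟨c₁, hc₁, θ, hθ, hθG⟩ := ih
      obtain ⟨τ₀, hτ₀⟩ := hcov' n
      have hle : (t n : ℝ) ≤ t (n + 1) := htm (Nat.le_succ n)
      have hn : (t n : ℝ) ∈ Icc α β := (t n).2
      -- At the junction both branches represent the same torus point, so an integer translation
      -- makes their lifts agree.
      obtain ⟨k, hk⟩ := sameAngle_iff.1 (huniq _ hn _ _
        (hG τ₀ τ₀.2 _ (hτ₀ (left_mem_Icc.2 hle))) (hθG _ (right_mem_Icc.2 hn.1)))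
      refine ⟨min c₁ (c τ₀), lt_min hc₁ (hc τ₀ τ₀.2),
        fun τ => if τ ≤ (t n : ℝ) then θ τ else ψ τ₀ τ + intVec k, ?_, fun τ hτ => ?_⟩
      · refine (hθ.mono ?_ le_rfl).glue (((hψ τ₀ τ₀.2).add_intVec hF k).mono ?_ le_rfl) hk
        · rintro τ ⟨h1, h2⟩
          exact ⟨h1.1, h2⟩
        · rintro τ ⟨h1, h2⟩
          exact hτ₀ ⟨h2, h1.2⟩
      · beta_reduce
        split_ifs with h1
        · exact hθG τ ⟨hτ.1, h1⟩
        · exact hinv _ _ _ (hG τ₀ τ₀.2 τ (hτ₀ ⟨(not_le.1 h1).le, hτ.2⟩))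
  obtain ⟨c₀, hc₀, θ, h1, h2⟩ := hind N
  rw [hN N le_rfl] at h1 h2
  exact ⟨c₀, hc₀, θ, h1, h2⟩

lemma IsUniqueMax.not_areTheTwoMaxima {f : Vec m → ℝ} {x : Vec m} (h : IsUniqueMax f x)
    (y z : Vec m) : ¬ AreTheTwoMaxima f y z := fun h' =>
  h'.1 ((h.2 y h'.2.1).symm.trans (h.2 z h'.2.2.1))

lemma AreTheTwoMaxima.of_sameAngle {f : Vec m → ℝ} (hf : TorusPeriodic f) {x y x' y' : Vec m}
    (h : AreTheTwoMaxima f x y) (hx : SameAngle x x') (hy : SameAngle y y') :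
    AreTheTwoMaxima f x' y' :=
  ⟨fun h' => h.1 (hx.trans (h'.trans hy.symm)), hf.isGlobalMax h.2.1 hx, hf.isGlobalMax h.2.2.1 hy,
    fun z hz => (h.2.2.2 z hz).imp hx.symm.trans hy.symm.trans⟩

lemma IsUniqueMax.of_sameAngle {f : Vec m → ℝ} (hf : TorusPeriodic f) {x y : Vec m}
    (h : IsUniqueMax f x) (hx : SameAngle x y) : IsUniqueMax f y :=
  ⟨hf.isGlobalMax h.1 hx, fun z hz => hx.symm.trans (h.2 z hz)⟩

end Chains

/-! ### Branches between bifurcation values and the quantitative conditions. -/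

section Intervals

variable {m : ℕ} {W : Type} [NormedAddCommGroup W] [NormedSpace ℝ W]
  {Z : Vec m × W → ℝ} {P : ℝ → W} {a b : ℝ}

lemma LocalPicture.isGlobalMax {τ₀ δ c : ℝ} {φL φR : ℝ → Vec m}
    (h : LocalPicture Z P a b τ₀ δ c φL φR) :
    IsGlobalMax (fun x => Z (x, P τ₀)) (φL τ₀) ∧ IsGlobalMax (fun x => Z (x, P τ₀)) (φR τ₀) := by
  rcases h.center with ⟨rfl, h'⟩ | ⟨h', -⟩
  · exact ⟨h'.1, h'.1⟩
  · exact ⟨h'.2.1, h'.2.2.1⟩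

lemma LocalPicture.unique_of_not_isBifurcation {τ₀ δ c : ℝ} {φL φR : ℝ → Vec m}
    (h : LocalPicture Z P a b τ₀ δ c φL φR)
    (hn : ¬ IsBifurcation (fun x t => Z (x, P t)) τ₀) :
    ∀ τ ∈ Icc a b ∩ Metric.ball τ₀ δ, IsUniqueMax (fun x => Z (x, P τ)) (φL τ) := by
  rcases h.center with ⟨rfl, h'⟩ | ⟨h', -⟩
  · intro τ hτ
    rcases lt_trichotomy τ τ₀ with h1 | rfl | h1
    · exact h.unique_left τ hτ h1
    · exact h'
    · exact h.unique_right τ hτ h1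
  · exact absurd ⟨_, _, h'⟩ hn

lemma LocalPicture.not_isBifurcation {τ₀ δ c : ℝ} {φL φR : ℝ → Vec m}
    (h : LocalPicture Z P a b τ₀ δ c φL φR) {τ : ℝ} (hτ : τ ∈ Icc a b ∩ Metric.ball τ₀ δ)
    (hne : τ ≠ τ₀) : ¬ IsBifurcation (fun x t => Z (x, P t)) τ := by
  rintro ⟨y, z, hyz⟩
  rcases lt_or_gt_of_ne hne with h1 | h1
  · exact (h.unique_left τ hτ h1).not_areTheTwoMaxima y z hyz
  · exact (h.unique_right τ hτ h1).not_areTheTwoMaxima y z hyz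

/-- The branch of global maxima between two consecutive bifurcation values, continued a little
beyond them. -/
lemma IsFamily.exists_interval_branch (h : IsFamily Z P a b) {δ c : ℝ → ℝ}
    {φL φR : ℝ → ℝ → Vec m} (hδ : ∀ τ ∈ Icc a b, 0 < δ τ) (hc : ∀ τ ∈ Icc a b, 0 < c τ)
    (hpic : ∀ τ ∈ Icc a b, LocalPicture Z P a b τ (δ τ) (c τ) (φL τ) (φR τ)) {α β : ℝ}
    (hαβ : α < β) (hα : a ≤ α) (hβ : β ≤ b)
    (hreg : ∀ τ ∈ Ioo α β, ¬ IsBifurcation (fun x t => Z (x, P t)) τ) :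
    ∃ lam > 0, ∃ c₀ > 0, ∃ θ, IsBranch (fun x t => Z (x, P t))
      (Icc (α - lam) (β + lam) ∩ Icc a b) c₀ θ ∧
      (∀ τ ∈ Ioo α β, IsUniqueMax (fun x => Z (x, P τ)) (θ τ)) ∧
      SameAngle (φR α α) (θ α) ∧ SameAngle (φL β β) (θ β) := by
  have hsub : Icc α β ⊆ Icc a b := Icc_subset_Icc hα hβ
  have hαm : α ∈ Icc a b := hsub (left_mem_Icc.2 hαβ.le)
  have hβm : β ∈ Icc a b := hsub (right_mem_Icc.2 hαβ.le)
  have hF : ∀ τ, TorusPeriodic fun x => Z (x, P τ) := fun τ => h.periodic (P τ)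
  -- An end of the interval may carry two maxima; `G` selects the one that continues the interior
  -- maximum, which restores uniqueness modulo translations.
  let G : ℝ → Vec m → Prop := fun τ x => IsGlobalMax (fun x => Z (x, P τ)) x ∧
    (τ = α → SameAngle (φR α α) x) ∧ (τ = β → SameAngle (φL β β) x)
  have hGu : ∀ τ x, IsUniqueMax (fun x => Z (x, P τ)) x → G τ x := fun τ x hx =>
    ⟨hx.1, fun e => (hx.2 _ (e ▸ (hpic α hαm).isGlobalMax.2)).symm,
      fun e => (hx.2 _ (e ▸ (hpic β hβm).isGlobalMax.1)).symm⟩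
  have hmid : ∀ τ ∈ Ioo α β, IsUniqueMax (fun x => Z (x, P τ)) (φL τ τ) := fun τ hτ => by
    have hm := hsub (Ioo_subset_Icc_self hτ)
    exact (hpic τ hm).unique_of_not_isBifurcation (hreg τ hτ) τ
      ⟨hm, Metric.mem_ball_self (hδ τ hm)⟩
  obtain ⟨c₁, hc₁, θ, hθ, hθG⟩ := exists_branch_of_local (F := fun x t => Z (x, P t)) hF hαβ.le
    (G := G) (fun τ x k hx => ⟨(hF τ).isGlobalMax hx.1 (sameAngle_add_intVec x k),
      fun e => (hx.2.1 e).trans (sameAngle_add_intVec x k),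
      fun e => (hx.2.2 e).trans (sameAngle_add_intVec x k)⟩)
    (fun τ hτ x y hx hy => by
      rcases eq_or_lt_of_le hτ.1 with e | h1
      · exact (hx.2.1 e.symm).symm.trans (hy.2.1 e.symm)
      rcases eq_or_lt_of_le hτ.2 with e | h2
      · exact (hx.2.2 e).symm.trans (hy.2.2 e)
      · exact ((hmid τ ⟨h1, h2⟩).2 x hx.1).symm.trans ((hmid τ ⟨h1, h2⟩).2 y hy.1))
    (fun τ₀ hτ₀ => by
      have hm := hsub hτ₀
      have hsub' : Icc α β ∩ Metric.ball τ₀ (δ τ₀) ⊆ Icc a b ∩ Metric.ball τ₀ (δ τ₀) :=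
        inter_subset_inter_left _ hsub
      refine ⟨δ τ₀, hδ τ₀ hm, c τ₀, hc τ₀ hm, ?_⟩
      rcases eq_or_lt_of_le hτ₀.1 with rfl | h1
      · refine ⟨φR α, (hpic α hm).right.mono hsub' le_rfl, fun τ hτ => ?_⟩
        rcases eq_or_lt_of_le hτ.1.1 with rfl | h2
        · exact ⟨(hpic α hm).isGlobalMax.2, fun _ => SameAngle.refl _, fun e => absurd e hαβ.ne⟩
        · exact hGu _ _ ((hpic α hm).unique_right τ (hsub' hτ) h2)
      rcases eq_or_lt_of_le hτ₀.2 with rfl | h2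
      · refine ⟨φL τ₀, (hpic τ₀ hm).left.mono hsub' le_rfl, fun τ hτ => ?_⟩
        rcases eq_or_lt_of_le hτ.1.2 with rfl | h2
        · exact ⟨(hpic τ hm).isGlobalMax.1, fun e => absurd e hαβ.ne', fun _ => SameAngle.refl _⟩
        · exact hGu _ _ ((hpic τ₀ hm).unique_left τ (hsub' hτ) h2)
      · exact ⟨φL τ₀, (hpic τ₀ hm).left.mono hsub' le_rfl, fun τ hτ => hGu _ _
          ((hpic τ₀ hm).unique_of_not_isBifurcation (hreg τ₀ ⟨h1, h2⟩) τ (hsub' hτ))⟩)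
  obtain ⟨k, hk⟩ := sameAngle_iff.1 ((hθG α (left_mem_Icc.2 hαβ.le)).2.1 rfl)
  obtain ⟨l, hl⟩ := sameAngle_iff.1 ((hθG β (right_mem_Icc.2 hαβ.le)).2.2 rfl)
  have hδα := hδ α hαm
  have hδβ := hδ β hβm
  obtain ⟨lam, hlam, hlα, hlβ⟩ : ∃ lam > 0, lam < δ α ∧ lam < δ β :=
    ⟨min (δ α) (δ β) / 2, by positivity,
      by linarith [min_le_left (δ α) (δ β), lt_min hδα hδβ],
      by linarith [min_le_right (δ α) (δ β), lt_min hδα hδβ]⟩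
  -- Left of α the branch follows φR α, where it need only be a local maximum; lam < δ α keeps it in
  -- the local picture.
  have hb1 : IsBranch (fun x t => Z (x, P t)) (Icc (α - lam) β ∩ Icc a b) (min (c α) c₁)
      (fun τ => if τ ≤ α then φR α τ + intVec k else θ τ) := by
    refine (((hpic α hαm).right.add_intVec hF k).mono ?_ le_rfl).glue (hθ.mono ?_ le_rfl) hk.symm
    · rintro τ ⟨⟨h1, h2⟩, h3⟩
      refine ⟨h2, ?_⟩
      rw [Metric.mem_ball, Real.dist_eq, abs_lt]
      have := h1.1
      have := mem_Iic.1 h3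
      constructor <;> linarith
    · rintro τ ⟨⟨h1, h2⟩, h3⟩
      exact ⟨h3, h1.2⟩
  have hb2 : IsBranch (fun x t => Z (x, P t)) (Icc (α - lam) (β + lam) ∩ Icc a b)
      (min (min (c α) c₁) (c β)) (fun τ => if τ ≤ β then
        (fun τ => if τ ≤ α then φR α τ + intVec k else θ τ) τ else φL β τ + intVec l) := by
    refine (hb1.mono ?_ le_rfl).glue (((hpic β hβm).left.add_intVec hF l).mono ?_ le_rfl) ?_
    · rintro τ ⟨⟨h1, h2⟩, h3⟩
      exact ⟨⟨h1.1, h3⟩, h2⟩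
    · rintro τ ⟨⟨h1, h2⟩, h3⟩
      refine ⟨h2, ?_⟩
      rw [Metric.mem_ball, Real.dist_eq, abs_lt]
      have := h1.2
      have := mem_Ici.1 h3
      constructor <;> linarith
    · beta_reduce
      rw [if_neg (not_le.2 hαβ), hl]
  refine ⟨lam, hlam, _, lt_min (lt_min (hc α hαm) hc₁) (hc β hβm), _, hb2, fun τ hτ => ?_, ?_, ?_⟩
  · beta_reduce
    rw [if_pos hτ.2.le, if_neg (not_le.2 hτ.1)]
    exact (hmid τ hτ).of_sameAngle (hF τ)
      ((hmid τ hτ).2 _ (hθG τ (Ioo_subset_Icc_self hτ)).1)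
  · beta_reduce
    rw [if_pos hαβ.le, if_pos le_rfl]
    exact sameAngle_add_intVec _ _
  · beta_reduce
    rw [if_pos le_rfl, if_neg (not_le.2 hαβ), hl]
    exact sameAngle_add_intVec _ _

variable [CompleteSpace W]

/-- A local picture admits no bifurcation except at its centre, so compactness leaves finitely many.
-/
lemma IsFamily.finite_isBifurcation (h : IsFamily Z P a b)
    (hgood : ∀ τ ∈ Icc a b, IsGood a b (fun x t => Z (x, P t)) τ) :
    (Icc a b ∩ {τ | IsBifurcation (fun x t => Z (x, P t)) τ}).Finite := by
  have := isCompact_Icc.induction_on (s := Icc a b)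
    (p := fun S => (S ∩ (Icc a b ∩ {τ | IsBifurcation (fun x t => Z (x, P t)) τ})).Finite)
    (by simp) (fun s t hst ht => ht.subset (inter_subset_inter_left _ hst))
    (fun s t hs ht => by rw [union_inter_distrib_right]; exact hs.union ht)
    (fun τ₀ hτ₀ => by
      obtain ⟨δ, hδ, c, -, φL, φR, hpic⟩ := h.exists_localPicture hτ₀ (hgood τ₀ hτ₀)
      refine ⟨Metric.ball τ₀ δ, nhdsWithin_le_nhds (Metric.ball_mem_nhds τ₀ hδ),
        (finite_singleton τ₀).subset ?_⟩
      rintro τ ⟨h1, h2, h3⟩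
      by_contra hne
      exact hpic.not_isBifurcation ⟨h2, h1⟩ hne h3)
  exact this.subset fun τ hτ => ⟨hτ.1, hτ⟩

/-- Good families satisfy the quantitative conditions. -/
theorem IsFamily.exists_quantitativelyGeneric (h : IsFamily Z P a b)
    (hgood : ∀ τ ∈ Icc a b, IsGood a b (fun x t => Z (x, P t)) τ) {d : ℕ} (hd : d ≠ 0)
    (hZ : ContDiff ℝ (d + 1) Z) (hP : ContDiffOn ℝ d P (Icc a b)) {M : ℝ}
    (hM : ∀ τ ∈ Icc a b, ∀ x, (∀ v, hessian (fun x => Z (x, P τ)) x v ≤ 0) →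
      ∀ v, -hessian (fun x => Z (x, P τ)) x v ≤ M * ‖v‖ ^ 2) :
    ∃ lam s α θ, QuantitativelyGeneric a b d M (fun x t => Z (x, P t)) lam s α θ := by
  have hpic : ∀ τ ∈ Icc a b, ∃ δ > 0, ∃ c > 0, ∃ φL φR, LocalPicture Z P a b τ δ c φL φR :=
    fun τ hτ => h.exists_localPicture hτ (hgood τ hτ)
  choose! δ hδ c hc φL φR hpic using hpic
  have hF : ∀ τ, TorusPeriodic fun x => Z (x, P τ) := fun τ => h.periodic (P τ)
  -- Only interior bifurcation values cut the interval; a tie at `a` or `b` is handled by following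
  -- the inner branch.
  obtain ⟨s, hs, α, hα0, hαs, hmono, hB⟩ := exists_ordered_partition h.lt
    (B := Ioo a b ∩ {τ | IsBifurcation (fun x t => Z (x, P t)) τ})
    ((h.finite_isBifurcation hgood).subset (inter_subset_inter_left _ Ioo_subset_Icc_self))
    inter_subset_left
  have hge : ∀ j ≤ s, a ≤ α j := fun j hj => by
    rcases Nat.eq_zero_or_pos j with rfl | h1
    · exact hα0.ge
    · exact hα0 ▸ (hmono 0 j h1 hj).le
  have hle : ∀ j ≤ s, α j ≤ b := fun j hj => by
    rcases eq_or_lt_of_le hj with rfl | h1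
    · exact hαs.le
    · exact hαs ▸ (hmono j s h1 le_rfl).le
  have hint : ∀ j < s, ∃ lam > 0, ∃ c₀ > 0, ∃ θ, IsBranch (fun x t => Z (x, P t))
      (Icc (α j - lam) (α (j + 1) + lam) ∩ Icc a b) c₀ θ ∧
      (∀ τ ∈ Ioo (α j) (α (j + 1)), IsUniqueMax (fun x => Z (x, P τ)) (θ τ)) ∧
      SameAngle (φR (α j) (α j)) (θ (α j)) ∧
      SameAngle (φL (α (j + 1)) (α (j + 1))) (θ (α (j + 1))) := fun j hj =>
    h.exists_interval_branch hδ hc hpic (hmono j (j + 1) (Nat.lt_succ_self j) hj) (hge j hj.le)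
      (hle (j + 1) hj) fun τ hτ hbif => by
        obtain ⟨i, -, his, rfl⟩ := (hB τ).1 ⟨⟨(hge j hj.le).trans_lt hτ.1,
          hτ.2.trans_le (hle (j + 1) hj)⟩, hbif⟩
        have h1 : j < i := by
          by_contra! hij
          rcases eq_or_lt_of_le hij with rfl | h2
          · exact lt_irrefl _ hτ.1
          · exact lt_asymm hτ.1 (hmono i j h2 hj.le)
        rcases eq_or_lt_of_le (Nat.succ_le_of_lt h1) with h2 | h2
        · exact lt_irrefl _ (h2 ▸ hτ.2)
        · exact lt_asymm hτ.2 (hmono (j + 1) i h2 his.le)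
  choose! lam hlam c₀ hc₀ θ hθ hun hR hL using hint
  -- One constant serves both as overlap length and as lower Hessian bound.
  obtain ⟨μ, hμ, hμle⟩ := exists_pos_le_of_lt s (fun j => min (lam j) (c₀ j))
    fun j hj => lt_min (hlam j hj) (hc₀ j hj)
  have hbr : ∀ j < s, IsBranch (fun x t => Z (x, P t))
      (Icc (α j - μ) (α (j + 1) + μ) ∩ Icc a b) μ (θ j) := fun j hj => by
    have h1 := (hμle j hj).trans (min_le_left _ _)
    exact (hθ j hj).mono (inter_subset_inter_left _ (Icc_subset_Icc (by linarith) (by linarith)))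
      ((hμle j hj).trans (min_le_right _ _))
  have htwo : ∀ j, j + 1 < s → AreTheTwoMaxima (fun x => Z (x, P (α (j + 1))))
      (φL (α (j + 1)) (α (j + 1))) (φR (α (j + 1)) (α (j + 1))) ∧
      speed Z P a b (φL (α (j + 1)) (α (j + 1))) (α (j + 1)) ≠
        speed Z P a b (φR (α (j + 1)) (α (j + 1))) (α (j + 1)) := fun j hj => by
    obtain ⟨h1, y, z, h2⟩ := (hB (α (j + 1))).2 ⟨j + 1, Nat.succ_pos j, hj, rfl⟩
    exact (hpic _ (Ioo_subset_Icc_self h1)).center.resolve_left fun h3 =>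
      h3.2.not_areTheTwoMaxima y z h2
  -- The derivative is two-sided, since the overlap defines the branch on a full neighbourhood of
  -- the interior point.
  have hderiv : ∀ j, j + 1 < s → ∀ i < s, α (j + 1) ∈ Ioo (α i - μ) (α (i + 1) + μ) →
      deriv (fun τ => Z (θ i τ, P τ)) (α (j + 1)) =
        speed Z P a b (θ i (α (j + 1))) (α (j + 1)) := fun j hj i hi hmem => by
    have h1 : α (j + 1) ∈ Ioo a b := ((hB (α (j + 1))).2 ⟨j + 1, Nat.succ_pos j, hj, rfl⟩).1
    exact (((hbr i hi).hasDerivWithinAt h hμ inter_subset_right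
      ⟨Ioo_subset_Icc_self hmem, Ioo_subset_Icc_self h1⟩).hasDerivAt
      (inter_mem (Icc_mem_nhds hmem.1 hmem.2) (Icc_mem_nhds h1.1 h1.2))).deriv
  refine ⟨μ, s, α, θ, ⟨hμ, hs, hα0, hαs, fun j hj => hmono j (j + 1) (Nat.lt_succ_self j) hj,
    fun τ hτ => ?_, fun j hj => (hbr j hj).contDiffOn hμ hd hZ hP inter_subset_right,
    fun j hj => (hbr j hj).isLocalMax, fun j hj τ hτ v => ⟨?_, ?_⟩, hun, fun j hj => ?_,
    fun j hj => ?_⟩⟩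
  · rw [← hB τ]
    exact ⟨fun h1 => ⟨hτ, h1⟩, fun h1 => h1.2⟩
  · have := (hbr j hj).hessian_le τ hτ v
    linarith
  · refine hM τ hτ.2 _ (fun w => ((hbr j hj).hessian_le τ hτ w).trans ?_) v
    have : 0 ≤ μ * ‖w‖ ^ 2 := by positivity
    linarith
  · exact (htwo j hj).1.of_sameAngle (hF _) (hL j (by omega)) (hR (j + 1) hj)
  · have h1 := hmono j (j + 1) (Nat.lt_succ_self j) hj.le
    have h2 := hmono (j + 1) (j + 1 + 1) (Nat.lt_succ_self _) hj
    rw [hderiv j hj j (by omega) ⟨by linarith, by linarith⟩,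
      hderiv j hj (j + 1) hj ⟨by linarith, by linarith⟩]
    have h3 : α (j + 1) ∈ Icc a b := ⟨hge _ hj.le, hle _ hj.le⟩
    rw [h.speed_eq_of_sameAngle (hL j (by omega)) h3, h.speed_eq_of_sameAngle (hR (j + 1) hj) h3]
    exact (htwo j hj).2

end Intervals

/-! ### Linearity of averaging, and norms of finite sums. -/

section Linearity

variable {m : ℕ} {r : ℕ} {V : Set (Phase m)}

lemma unitAverage_add {E : Type} [NormedAddCommGroup E] [NormedSpace ℝ E] {g h : E × ℝ → ℝ}
    (hg : Continuous g) (hh : Continuous h) :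
    unitAverage (g + h) = unitAverage g + unitAverage h :=
  funext fun x => intervalIntegral.integral_add
    ((hg.comp (Continuous.prodMk_right x)).intervalIntegrable _ _)
    ((hh.comp (Continuous.prodMk_right x)).intervalIntegrable _ _)

lemma unitAverage_const_smul {E : Type} [NormedAddCommGroup E] [NormedSpace ℝ E] (c : ℝ)
    (g : E × ℝ → ℝ) : unitAverage (c • g) = c • unitAverage g :=
  funext fun _ => intervalIntegral.integral_smul c _

lemma avg_add {H K : Phase m → ℝ} (hH : Continuous H) (hK : Continuous K) :
    avg (H + K) = avg H + avg K := by
  have h1 : ∀ {H : Phase m → ℝ}, Continuous H → Continuous (H ∘ phaseL m) := fun h =>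
    h.comp (phaseL m).continuous
  unfold avg
  rw [show (H + K) ∘ phaseL m = H ∘ phaseL m + K ∘ phaseL m from rfl,
    unitAverage_add (h1 hH) (h1 hK), unitAverage_add]
  · exact (contDiff_unitAverage 0 (contDiff_zero.2 (h1 hH))).continuous
  · exact (contDiff_unitAverage 0 (contDiff_zero.2 (h1 hK))).continuous

lemma avg_const_smul (c : ℝ) (H : Phase m → ℝ) : avg (c • H) = c • avg H := by
  unfold avg
  rw [show (c • H) ∘ phaseL m = c • (H ∘ phaseL m) from rfl, unitAverage_const_smul,
    unitAverage_const_smul]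

lemma isPerturbation_zero : IsPerturbation r (0 : Phase m → ℝ) :=
  ⟨contDiff_const, fun _ _ _ _ => rfl, fun _ _ _ => rfl⟩

lemma crNorm_zero (hV : ∀ v ∈ V, ‖v‖ ≤ 1) : crNorm V r (0 : Phase m → ℝ) = 0 := by
  refine le_antisymm ?_ (crNorm_nonneg _)
  simpa using crNorm_const_smul_le hV (isPerturbation_zero (r := r) (m := m)) 0

lemma isPerturbation_sum {ι : Type*} (s : Finset ι) {K : ι → Phase m → ℝ}
    (hK : ∀ k, IsPerturbation r (K k)) (ξ : ι → ℝ) : IsPerturbation r (∑ k ∈ s, ξ k • K k) := by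
  classical
  induction s using Finset.induction_on with
  | empty => exact isPerturbation_zero
  | insert k s hk ih =>
    rw [Finset.sum_insert hk]
    exact ((hK k).const_smul (ξ k)).add ih

lemma avg_sum {ι : Type*} (s : Finset ι) {K : ι → Phase m → ℝ}
    (hK : ∀ k, IsPerturbation r (K k)) (ξ : ι → ℝ) :
    avg (∑ k ∈ s, ξ k • K k) = ∑ k ∈ s, ξ k • avg (K k) := by
  classical
  induction s using Finset.induction_on with
  | empty => simpa using avg_const_smul 0 (0 : Phase m → ℝ)
  | insert k s hk ih =>
    rw [Finset.sum_insert hk, Finset.sum_insert hk, avg_add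
      ((hK k).const_smul (ξ k)).contDiff.continuous (isPerturbation_sum s hK ξ).contDiff.continuous,
      ih, avg_const_smul]

lemma crNorm_sum_le (hV : ∀ v ∈ V, ‖v‖ ≤ 1) {ι : Type*} (s : Finset ι) {K : ι → Phase m → ℝ}
    (hK : ∀ k, IsPerturbation r (K k)) (ξ : ι → ℝ) :
    crNorm V r (∑ k ∈ s, ξ k • K k) ≤ ∑ k ∈ s, |ξ k| * crNorm V r (K k) := by
  classical
  induction s using Finset.induction_on with
  | empty => simp [crNorm_zero hV]
  | insert k s hk ih =>
    rw [Finset.sum_insert hk, Finset.sum_insert hk]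
    exact (crNorm_add_le hV ((hK k).const_smul (ξ k)) (isPerturbation_sum s hK ξ)).trans
      (add_le_add (crNorm_const_smul_le hV (hK k) (ξ k)) ih)

end Linearity

/-! ### Perturbations of the average lifted to phase space. -/

section Lifts

variable {m : ℕ}

/-- The perturbation `q₁(θˢ) + pᶠ q₂(θˢ)` on phase space. -/
def lift (q : TorusPair m) (z : Phase m) : ℝ := pert (lastL m) q.1 (slowL m z.1, z.2.1)

lemma isPerturbation_lift (r : ℕ) (q : TorusPair m) : IsPerturbation r (lift q) where
  contDiff := (contDiff_pert (lastL m) q r).comp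
    (((slowL m).contDiff.comp contDiff_fst).prodMk (contDiff_fst.comp contDiff_snd))
  periodic_angle θ p t i := by
    have hs : ∃ k, slowL m (EuclideanSpace.single i 1) = intVec k := by
      refine Fin.lastCases ⟨0, ?_⟩ (fun j => ⟨Pi.single j 1, ?_⟩) i
      · rw [← join_zero_one, slowL_join]; ext; simp
      · rw [← join_single_zero, slowL_join]
        ext l
        by_cases h : l = j
        · subst h; simp
        · simp [h]
    obtain ⟨k, hk⟩ := hs
    simp only [lift, pert, map_add, hk]
    rw [q.2.1.periodic k, q.2.2.periodic k]
  periodic_time _ _ _ := rfl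

/-- The lift depends on neither θᶠ nor t, so averaging returns it: perturbations of Z come from
perturbations of H. -/
lemma avg_lift (q : TorusPair m) : avg (lift q) = pert (lastL m) q.1 := by
  funext ⟨x, p⟩
  simp [avg, unitAverage, lift]

lemma avg_add_sum_lift {r : ℕ} {H : Phase m → ℝ} (hH : IsPerturbation r H)
    (s : Finset (TorusPair m)) (ξ : s → ℝ) :
    avg (H + ∑ k, ξ k • lift k.1) = perturbed (avg H) (lastL m) s ξ := by
  rw [avg_add hH.contDiff.continuous
    (isPerturbation_sum (r := r) Finset.univ (fun k : s => isPerturbation_lift r k.1) ξ).contDiff.continuous,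
    avg_sum (r := r) Finset.univ (fun k : s => isPerturbation_lift r k.1)]
  funext z
  simp only [avg_lift, perturbed, Pi.add_apply, Finset.sum_apply, Pi.smul_apply]

end Lifts

/-! ### From the C^r norm to closeness and approximation of resonant families. -/

section Families

variable {m : ℕ} {r : ℕ} {V : Set (Phase m)} {P : ℝ → Vec (m + 1)} {a b : ℝ}

lemma IsPerturbation.isFamily {H : Phase m → ℝ} (hH : IsPerturbation r H) (hr : 4 ≤ r)
    (hP : ContDiffOn ℝ 2 P (Icc a b)) (hab : a < b) : IsFamily (avg H) P a b where
  contDiff := contDiff_avg (n := 4) (hH.contDiff.of_le (by exact_mod_cast hr))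
  periodic p := torusPeriodic_of_single fun i x => by
    have := periodic_avg hH i (x, p)
    rwa [Prod.mk_add_mk, add_zero] at this
  contDiffOn := hP
  lt := hab

lemma hessian_sub {f g : Vec m → ℝ} (hf : ContDiff ℝ 2 f) (hg : ContDiff ℝ 2 g) (x v : Vec m) :
    hessian (fun y => f y - g y) x v = hessian f x v - hessian g x v := by
  have h1 : ∀ {f : Vec m → ℝ}, ContDiff ℝ 2 f → Differentiable ℝ (fderiv ℝ f) := fun hf =>
    (hf.fderiv_right (m := 1) (by norm_num)).differentiable one_ne_zero
  have e1 : fderiv ℝ (fun y => f y - g y) = fun y => fderiv ℝ f y - fderiv ℝ g y := funext fun y =>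
    fderiv_fun_sub (hf.differentiable (by norm_num) y) (hg.differentiable (by norm_num) y)
  simp only [hessian_eq]
  rw [e1, fderiv_fun_sub (h1 hf x) (h1 hg x)]
  rfl

/-- Closeness in the `C^r` norm implies closeness of the resonant families. -/
lemma exists_familyClose_of_crNorm_lt (hV : ∀ v ∈ V, ‖v‖ ≤ 1) (hV' : coordDirs m ⊆ V)
    (hr : 4 ≤ r) (hP : ContDiffOn ℝ 2 P (Icc a b)) (hab : a < b)
    (hPB : ∀ τ ∈ Icc a b, P τ ∈ Metric.closedBall (0 : Vec (m + 1)) 1) {ε : ℝ} (hε : 0 < ε) :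
    ∃ δ > 0, ∀ H H' : Phase m → ℝ, IsPerturbation r H → IsPerturbation r H' →
      crNorm V r (H' - H) < δ → FamilyClose P a b ε (avg H') (avg H) := by
  have hc : ContinuousOn (fun τ => ∑ i, |derivWithin P (Icc a b) τ i|) (Icc a b) := by
    refine continuousOn_finsetSum _ fun i _ => ContinuousOn.abs ?_
    exact (EuclideanSpace.proj (𝕜 := ℝ) i).continuous.comp_continuousOn
      (hP.continuousOn_derivWithin (uniqueDiffOn_Icc hab) (by norm_num))
  obtain ⟨C, hC⟩ := isCompact_Icc.exists_bound_of_continuousOn hc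
  have hC0 : 0 ≤ C := (norm_nonneg _).trans (hC a (left_mem_Icc.2 hab.le))
  -- The summands pay for the values (1), the Hessians (m) and the speeds (C, the ℓ¹ bound on the
  -- velocity of `P`).
  refine ⟨ε / (1 + m + C), by positivity, fun H H' hH hH' hlt τ hτ => ?_⟩
  have hK := hH'.sub hH
  have havg : avg (H' - H) = avg H' - avg H := by
    rw [sub_eq_add_neg, ← neg_one_smul ℝ H, avg_add hH'.contDiff.continuous
      (hH.const_smul (-1)).contDiff.continuous, avg_const_smul, neg_one_smul, ← sub_eq_add_neg]
  have hN0 := crNorm_nonneg (V := V) (r := r) (H' - H)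
  have hNε : crNorm V r (H' - H) * (1 + m + C) ≤ ε := by
    rw [lt_div_iff₀ (by positivity)] at hlt
    exact hlt.le
  have hm0 : (0 : ℝ) ≤ m := Nat.cast_nonneg m
  have h2 : ∀ {H : Phase m → ℝ}, IsPerturbation r H → ContDiff ℝ 2 fun x => avg H (x, P τ) :=
    fun hH => ((hH.isFamily hr hP hab).contDiff_slice _).of_le (by norm_num)
  refine ⟨fun x => ⟨?_, fun v => ?_⟩, fun x => ?_⟩
  · have h1 := hK.abs_avg_le hV x (hPB τ hτ)
    rw [havg] at h1
    refine (show |avg H' (x, P τ) - avg H (x, P τ)| ≤ _ from h1).trans ?_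
    nlinarith
  · have h1 := hK.abs_hessian_avg_le hV hV' (by omega) x (hPB τ hτ) v
    rw [havg] at h1
    simp only [Pi.sub_apply] at h1
    rw [hessian_sub (h2 hH') (h2 hH)] at h1
    refine h1.trans ?_
    rw [← mul_assoc]
    have : crNorm V r (H' - H) * m ≤ ε := by nlinarith
    gcongr
  · have h1 := hK.abs_fderiv_avg_le hV hV' (by omega) x (hPB τ hτ) (derivWithin P (Icc a b) τ)
    have hd : ∀ {H : Phase m → ℝ}, IsPerturbation r H → Differentiable ℝ (avg H) := fun hH =>
      (hH.isFamily hr hP hab).contDiff.differentiable (by norm_num)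
    rw [havg, fderiv_sub (hd hH' _) (hd hH _)] at h1
    refine (show |speed (avg H') P a b x τ - speed (avg H) P a b x τ| ≤ _ from h1).trans ?_
    have h3 := (le_abs_self _).trans (hC τ hτ)
    have := mul_le_mul_of_nonneg_left h3 hN0
    nlinarith

/-- Needed to return to the unit sphere after perturbing. -/
lemma isGood_const_smul {F : Vec m → ℝ → ℝ} {τ c : ℝ} (hc : 0 < c)
    (h2 : ContDiff ℝ 2 (F · τ)) (h : IsGood a b F τ) : IsGood a b (fun x t => c * F x t) τ := by
  have hmax : ∀ x, IsGlobalMax (fun x => c * F x τ) x → IsGlobalMax (F · τ) x := fun x hx y =>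
    le_of_mul_le_mul_left (hx y) hc
  have hH : ∀ x v, hessian (fun x => c * F x τ) x v = c * hessian (F · τ) x v := fun x v => by
    have e1 : fderiv ℝ (fun x => c * F x τ) = fun y => c • fderiv ℝ (F · τ) y := funext fun y =>
      fderiv_const_mul (h2.differentiable (by norm_num) y) c
    simp only [hessian_eq]
    rw [e1, fderiv_fun_const_smul
      ((h2.fderiv_right (m := 1) (by norm_num)).differentiable one_ne_zero x)]
    rfl
  obtain ⟨h3, h4, h5⟩ := h
  refine ⟨fun x hx v hv => ?_, fun x y z hx hy hz => h4 x y z (hmax x hx) (hmax y hy) (hmax z hz),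
    fun x y hx hy hxy => ?_⟩
  · rw [hH]
    exact mul_neg_of_pos_of_neg hc (h3 x (hmax x hx) v hv)
  · have h6 := h5 x y (hmax x hx) (hmax y hy) hxy
    have e : ∀ x, derivWithin (fun t => c * F x t) (Icc a b) τ = c * derivWithin (F x) (Icc a b) τ :=
      fun x => derivWithin_const_mul_field c
    rw [e, e]
    exact fun h7 => h6 (mul_left_cancel₀ hc.ne' h7)

/-- Every perturbation is a limit of perturbations whose resonant family is good. -/
lemma exists_crNorm_lt_isGood (hV : ∀ v ∈ V, ‖v‖ ≤ 1) (hr : 4 ≤ r)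
    (hP : ContDiffOn ℝ 2 P (Icc a b)) (hab : a < b) (hlast : ∀ τ, lastL m (P τ) = τ)
    {H : Phase m → ℝ} (hH : IsPerturbation r H) {η : ℝ} (hη : 0 < η) :
    ∃ K, IsPerturbation r K ∧ crNorm V r K < η ∧
      ∀ τ ∈ Icc a b, IsGood a b (fun x t => avg (H + K) (x, P t)) τ := by
  have hU : ∀ s : Finset (TorusPair m), ∀ᶠ ξ in 𝓝 (0 : s → ℝ),
      crNorm V r (∑ k, ξ k • lift k.1) < η / 2 := fun s => by
    have h1 : Continuous fun ξ : s → ℝ => ∑ k, |ξ k| * crNorm V r (lift k.1) := by fun_prop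
    have h2 := h1.continuousAt.eventually_lt (x₀ := (0 : s → ℝ))
      (continuousAt_const (y := η / 2)) (by simpa using hη)
    filter_upwards [h2] with ξ hξ
    exact (crNorm_sum_le hV _ (fun k : s => isPerturbation_lift r k.1) ξ).trans_lt hξ
  obtain ⟨s₁, hs₁⟩ := (hH.isFamily hr hP hab).exists_perturbed_allMaxNondeg (lastL m)
  obtain ⟨ξ₁, hξ₁, hnd⟩ := hs₁ _ (hU s₁)
  have hK₁ := isPerturbation_sum (r := r) Finset.univ (fun k : s₁ => isPerturbation_lift r k.1) ξ₁
  rw [← avg_add_sum_lift hH] at hnd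
  have hH₁ := hH.add hK₁
  -- The second set of directions depends on the family already freed of degenerate maxima, so the
  -- two stages cannot be merged; each spends η / 2.
  obtain ⟨s₂, hs₂⟩ := (hH₁.isFamily hr hP hab).exists_perturbed_isGood (lastL m)
    (fun τ _ => hlast τ) hnd
  obtain ⟨ξ₂, hξ₂, hgood⟩ := hs₂ _ (hU s₂)
  have hK₂ := isPerturbation_sum (r := r) Finset.univ (fun k : s₂ => isPerturbation_lift r k.1) ξ₂
  rw [← avg_add_sum_lift hH₁, add_assoc] at hgood
  refine ⟨_, hK₁.add hK₂, ?_, hgood⟩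
  have h1 := crNorm_add_le hV hK₁ hK₂
  have h2 : crNorm V r (∑ k, ξ₁ k • lift k.1) < η / 2 := hξ₁
  have h3 : crNorm V r (∑ k, ξ₂ k • lift k.1) < η / 2 := hξ₂
  linarith

end Families

/-! ### The generic set, its openness and its density. -/

section Genericity

variable {m r q : ℕ} {V : Set (Phase m)} {M amin amax : ℝ} {pstar : ℝ → Vec m}

lemma contDiffOn_join_pstar {n : ℕ} (hp : ContDiffOn ℝ n pstar (Icc amin amax)) :
    ContDiffOn ℝ n (fun τ => join (pstar τ) τ) (Icc amin amax) :=
  (joinL m).contDiff.comp_contDiffOn (hp.prodMk contDiffOn_id)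

/-- The quantitative conditions follow from goodness at every τ, so only the latter has to be shown
open and dense. The branch regularity combines C^(r-1) for the gradient of the average with C^(q-1)
for the curve. -/
lemma mem_genericSet_iff (hr : 4 ≤ r) (hq : 4 ≤ q) (hlt : amin < amax)
    (hp : ContDiffOn ℝ (q - 1 : ℕ) pstar (Icc amin amax))
    (hPB : ∀ τ ∈ Icc amin amax, join (pstar τ) τ ∈ Metric.closedBall (0 : Vec (m + 1)) 1)
    (hM : ∀ H ∈ unitSphere V r, ∀ θ, ∀ p ∈ Metric.closedBall (0 : Vec (m + 1)) 1,
      (∀ v, hessian (fun x => avg H (x, p)) θ v ≤ 0) →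
      ∀ v, -hessian (fun x => avg H (x, p)) θ v ≤ M * ‖v‖ ^ 2) (H : Phase m → ℝ) :
    H ∈ genericSet V r (min r q - 1) M amin amax pstar ↔ H ∈ unitSphere V r ∧
      ∀ τ ∈ Icc amin amax, IsGood amin amax (fun x t => avg H (x, join (pstar t) t)) τ := by
  have hP := contDiffOn_join_pstar hp
  have hfam : ∀ H : Phase m → ℝ, IsPerturbation r H →
      IsFamily (avg H) (fun t => join (pstar t) t) amin amax := fun H hH =>
    hH.isFamily hr (hP.of_le (by exact_mod_cast (by omega : 2 ≤ q - 1))) hlt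
  have hiff : ∀ H : Phase m → ℝ, IsPerturbation r H → ∀ τ,
      (IsGood amin amax (fun x t => avg H (x, join (pstar t) t)) τ ↔
        IsNondegRegular (resonantFamily pstar H) τ ∨
        IsNondegBifurcation amin amax (resonantFamily pstar H) τ) := fun H hH τ =>
    isGood_iff (fun t => (hfam H hH).periodic _) ((hfam H hH).contDiff_slice _).continuous
  constructor
  · rintro ⟨h1, h2, -⟩
    exact ⟨h1, fun τ hτ => (hiff H h1.1 τ).2 (h2 τ hτ)⟩
  · rintro ⟨h1, h2⟩
    refine ⟨h1, fun τ hτ => (hiff H h1.1 τ).1 (h2 τ hτ), ?_⟩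
    refine (hfam H h1.1).exists_quantitativelyGeneric h2 (d := min r q - 1) (by omega) ?_ ?_
      fun τ hτ x => hM H h1 x _ (hPB τ hτ)
    · have := contDiff_avg (n := min r q - 1 + 1) (h1.1.contDiff.of_le
        (by exact_mod_cast (by omega : min r q - 1 + 1 ≤ r)))
      exact_mod_cast this
    · exact hP.of_le (by exact_mod_cast (by omega : min r q - 1 ≤ q - 1))

/-- Openness and density for a general family of directions. -/
theorem isOpen_and_isDense_genericSet (hV : ∀ v ∈ V, ‖v‖ ≤ 1) (hV' : coordDirs m ⊆ V)
    (hr : 4 ≤ r) (hq : 4 ≤ q) (hlt : amin < amax)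
    (hp : ContDiffOn ℝ (q - 1 : ℕ) pstar (Icc amin amax))
    (hPB : ∀ τ ∈ Icc amin amax, join (pstar τ) τ ∈ Metric.closedBall (0 : Vec (m + 1)) 1)
    (hM : ∀ H ∈ unitSphere V r, ∀ θ, ∀ p ∈ Metric.closedBall (0 : Vec (m + 1)) 1,
      (∀ v, hessian (fun x => avg H (x, p)) θ v ≤ 0) →
      ∀ v, -hessian (fun x => avg H (x, p)) θ v ≤ M * ‖v‖ ^ 2) :
    IsOpenInSphere V r (genericSet V r (min r q - 1) M amin amax pstar) ∧
      IsDenseInSphere V r (genericSet V r (min r q - 1) M amin amax pstar) := by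
  have hP : ContDiffOn ℝ 2 (fun τ => join (pstar τ) τ) (Icc amin amax) :=
    (contDiffOn_join_pstar hp).of_le (by exact_mod_cast (by omega : 2 ≤ q - 1))
  have hiff := mem_genericSet_iff hr hq hlt hp hPB hM
  constructor
  · intro H hH
    obtain ⟨hH1, hgood⟩ := (hiff H).1 hH
    obtain ⟨ε, hε, hopen⟩ := (hH1.1.isFamily hr hP hlt).isGood_of_close hgood
    obtain ⟨δ, hδ, hclose⟩ := exists_familyClose_of_crNorm_lt hV hV' hr hP hlt hPB hε
    exact ⟨δ, hδ, fun H' hH' hd => (hiff H').2 ⟨hH', hopen _ (hH'.1.isFamily hr hP hlt)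
      (hclose H H' hH1.1 hH'.1 hd)⟩⟩
  · rintro H ⟨hH, hH1⟩ ε hε
    -- From η ≤ 1/2 follows N ≥ 1/2, so normalising multiplies by at most 2 an error of at most 2η:
    -- one η from K and one from N - 1.
    obtain ⟨η, hη, hη1, hη2⟩ : ∃ η > 0, η ≤ 1 / 2 ∧ 4 * η < ε :=
      ⟨min (1 / 2) (ε / 8), by positivity, min_le_left _ _,
        by linarith [min_le_right (1 / 2) (ε / 8)]⟩
    obtain ⟨K, hK, hKη, hgood⟩ := exists_crNorm_lt_isGood hV hr hP hlt
      (fun τ => lastL_join _ _) hH hη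
    have hHK := hH.add hK
    obtain ⟨N, hN⟩ : ∃ N, N = crNorm V r (H + K) := ⟨_, rfl⟩
    have hN1 : N ≤ 1 + η := by
      have := crNorm_add_le hV hH hK
      linarith
    have hN2 : 1 - η ≤ N := by
      have h1 := crNorm_add_le hV hHK (hK.const_smul (-1))
      have h2 := crNorm_const_smul_le hV hK (-1)
      have h3 : H + K + (-1 : ℝ) • K = H := by simp
      rw [h3] at h1
      rw [abs_neg, abs_one, one_mul] at h2
      linarith
    have hN0 : 0 < N := by linarith
    refine ⟨N⁻¹ • (H + K), (hiff _).2 ⟨⟨hHK.const_smul _, ?_⟩, fun τ hτ => ?_⟩, ?_⟩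
    · rw [crNorm_const_smul hV hHK (inv_ne_zero hN0.ne'), ← hN, abs_of_pos (inv_pos.2 hN0),
        inv_mul_cancel₀ hN0.ne']
    · rw [avg_const_smul]
      exact isGood_const_smul (inv_pos.2 hN0)
        (((hHK.isFamily hr hP hlt).contDiff_slice _).of_le (by norm_num)) (hgood τ hτ)
    · have h1 : N⁻¹ • (H + K) - H = N⁻¹ • (K + (1 - N) • H) := by
        funext z
        simp only [Pi.sub_apply, Pi.smul_apply, Pi.add_apply, smul_eq_mul]
        field_simp
        ring
      have h2 := crNorm_const_smul_le hV (hK.add (hH.const_smul (1 - N))) N⁻¹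
      have h3 := crNorm_add_le hV hK (hH.const_smul (1 - N))
      have h4 := crNorm_const_smul_le hV hH (1 - N)
      have h5 : |1 - N| ≤ η := abs_le.2 ⟨by linarith, by linarith⟩
      have h6 : N⁻¹ ≤ 2 := by
        rw [inv_le_comm₀ hN0 two_pos]
        linarith
      rw [h1]
      rw [abs_of_pos (inv_pos.2 hN0)] at h2
      rw [hH1, mul_one] at h4
      have h7 : crNorm V r (K + (1 - N) • H) ≤ 2 * η := by linarith
      have h8 : N⁻¹ * crNorm V r (K + (1 - N) • H) ≤ 2 * (2 * η) :=
        mul_le_mul h6 h7 (crNorm_nonneg _) two_pos.le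
      linarith

end Genericity

end Resonance

end

theorem mainTheorem9 (m : ℕ) (hm : 1 ≤ m) (r q : ℕ) (hr : 4 ≤ r) (hq : 4 ≤ q)
    (O : Set (Resonance.Vec (m + 1))) (hO : IsOpen O)
    (hBO : Metric.closedBall (0 : Resonance.Vec (m + 1)) 1 ⊆ O)
    (H₀ : Resonance.Vec (m + 1) → ℝ) (hH₀ : ContDiffOn ℝ q H₀ O)
    (hconvex : ∀ p ∈ Metric.closedBall (0 : Resonance.Vec (m + 1)) 1, ∀ v, v ≠ 0 →
      0 < Resonance.hessian H₀ p v)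
    (amin amax : ℝ) (hlt : amin < amax) (pstar : ℝ → Resonance.Vec m)
    (hΓ : Resonance.resonance H₀ =
      (fun τ => Resonance.join (pstar τ) τ) '' Set.Icc amin amax) :
    (Resonance.IsOpenInSphere (Resonance.unitDirs m) r
        (Resonance.genericSet (Resonance.unitDirs m) r (min r q - 1) 1 amin amax pstar) ∧
      Resonance.IsDenseInSphere (Resonance.unitDirs m) r
        (Resonance.genericSet (Resonance.unitDirs m) r (min r q - 1) 1 amin amax pstar)) ∧
    (Resonance.IsOpenInSphere (Resonance.coordDirs m) r
        (Resonance.genericSet (Resonance.coordDirs m) r (min r q - 1) (max 1 ((m : ℝ) / 4))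
          amin amax pstar) ∧
      Resonance.IsDenseInSphere (Resonance.coordDirs m) r
        (Resonance.genericSet (Resonance.coordDirs m) r (min r q - 1) (max 1 ((m : ℝ) / 4))
          amin amax pstar)) := by
  have hp := Resonance.contDiffOn_pstar (by omega) hO hBO hH₀ hconvex hΓ
  have hPB : ∀ τ ∈ Set.Icc amin amax, Resonance.join (pstar τ) τ ∈
      Metric.closedBall (0 : Resonance.Vec (m + 1)) 1 := fun τ hτ =>
    (Resonance.join_mem_resonance hΓ hτ).1
  refine ⟨Resonance.isOpen_and_isDense_genericSet Resonance.norm_le_one_of_mem_unitDirs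
      Resonance.coordDirs_subset_unitDirs hr hq hlt hp hPB fun H hH θ p hpB _ v => ?_,
    Resonance.isOpen_and_isDense_genericSet Resonance.norm_le_one_of_mem_coordDirs
      subset_rfl hr hq hlt hp hPB fun H hH θ p hpB hneg v => ?_⟩
  · have := hH.1.neg_hessian_avg_le_unitDirs (by omega) θ hpB v
    rwa [hH.2] at this
  · have := hH.1.neg_hessian_avg_le_coordDirs Resonance.norm_le_one_of_mem_coordDirs subset_rfl
      (by omega) θ hpB hneg v
    rw [hH.2, one_mul] at this
    exact this.trans (mul_le_mul_of_nonneg_right (le_max_right _ _) (by positivity))
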